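/- Let $k$ be a field. For an oriented tangle diagram $T$ in a disk with ordered endpoint set $P$, consider the oriented graph whose vertices are the crossings and the endpoints of $T$, and let $\tilde S_T$ be the polynomial ring over $k$ (variables of degree $2$) with one variable $t_{x,e}$ for each flag (vertex $x$, adjacent edge $e$), and one extra variable for each closed component without crossings. For an edge $e$ from $a$ to $b$ let $L_e$ be the horizontal Koszul complex $\tilde S_T\xrightarrow{t_{a,e}-t_{b,e}}\tilde S_T$; a closed component without crossings contributes $\tilde S_T\xrightarrow{0}\tilde S_T$. At a crossing $x$ let $i,j$ be the variables of the left and right outgoing flags and $k',l$ those of the right and left incoming flags. Let $L'_x$ and $L''_x$ be the Koszul complexes of $(i+j-k'-l,\ ij-k'l)$ and $(i-l,\ j-k')$, with horizontal differential of polynomial degree $2$ and with right-hand term $\tilde S_T$ unshifted. Let $L_x$ be the bicomplex $\rho^+\colon L'_x\to L''_x$ if $x$ is positive and $\rho^-\colon L''_x\to L'_x\{-2\}$ if $x$ is negative, with $L''_x$ in vertical degree $0$, where $\rho^\pm$ are homogeneous chain maps inducing on $H^0$ the projection and the multiplication by $i-k'$, respectively. (Such $\rho^{+}$ and $\rho^-$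 each form a family with one parameter, $\mu$ or $\nu$ in $k$; the choices are fixed and used at all crossings.) Define the trigraded bicomplex $$KR_0(T)=\Big(\bigotimes_e L_e\Big)\otimes_{\tilde S_T}\Big(\bigotimes_x L_x\Big)$$ over the subring $k[P]\subseteq\tilde S_T$ generated by the variables of the endpoints (the closed components without crossings contributing their factors). Let $N(T)=H^0_h(KR_0(T))$ be the naive complex, that is, the horizontal cohomology in the top degree $0$ with the induced vertical differential, and let $\pi_T\colon KR_0(T)\to N(T)$ be the natural map. Let $\eta$ be an oriented planar arc diagram with outer points $P_0$ and holes with points $P_1,\dots,P_m$. For bicomplexes $C_i$ over $k[P_i]$ let $$\tilde\eta(\{C_i\})=Z_\eta\otimes_{k[P_1,\dots,P_m]}(C_1\otimes_k\cdots\otimes_k C_m),$$ a bicomplex over $k[P_0]$, where $Z_\eta$ is the horizontal Koszul complex over $k[P_0,\dots,P_m]$ of the sequence $t_{\alpha_+}-t_{\alpha_-}$, with $\alpha$ running through the arcs of $\eta$ with head $\alpha_+$ and tail $\alpha_-$. **Theorem.** Let $T_1,\dots,T_m$ be oriented tangle diagrams that fit into the holes of $\eta$, and let $\tilde\eta(\{T_i\})$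 be the tangle diagram obtained by pasting them in. 1. There is a homotopy equivalence of bicomplexes over $k[P_0]$ $$KR_0(\tilde\eta(\{T_i\}))\simeq\tilde\eta(\{KR_0(T_i)\}).$$ That is, there are morphisms in both directions that preserve the three gradings and commute with both differentials, and whose two composites are homotopic to the identities through horizontal homotopies that commute with the vertical differentials. 2. If every $\pi_{T_i}\colon KR_0(T_i)\to N(T_i)$ is a term-wise quasi-isomorphism (in each vertical degree it induces an isomorphism on horizontal cohomology), then for every homotopy equivalence as in 1 the composite $$KR_0(\tilde\eta(\{T_i\}))\longrightarrow\tilde\eta(\{KR_0(T_i)\})\xrightarrow{\ \tilde\eta(\{\pi_{T_i}\})\ }\tilde\eta(\{N(T_i)\})$$ is a term-wise quasi-isomorphism. Both claims hold for arbitrary combinatorial diagrams (crossings with their signs, edges, endpoints, arcs), planar or not. -/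

import Mathlib

open MvPolynomial
open scoped TensorProduct

universe u

set_option linter.unusedSectionVars false

namespace KRTangle

noncomputable section

/-! ## Trigraded bicomplexes over a polynomial ring -/

/-- A graded bicomplex over the polynomial ring `k[σ]`, written as one module `M` spanned by its
homogeneous pieces `gr h v q` of horizontal degree `h`, vertical degree `v` and polynomial
degree `q`.  Every variable of `k[σ]` has polynomial degree `2`.  The two differentials commute.
`sh` and `sv` are the sign operators `(-1) ^ h` and `(-1) ^ v` (determined by the grading), used
for the sign rule in tensor products. -/
structure Bicomplex (k : Type u) [Field k] (σ : Type) : Type (u + 1) where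
  M : Type u
  [addCommGroup : AddCommGroup M]
  [module : Module (MvPolynomial σ k) M]
  gr : ℤ → ℤ → ℤ → AddSubgroup M
  dh : M →ₗ[MvPolynomial σ k] M
  dv : M →ₗ[MvPolynomial σ k] M
  sh : M →ₗ[MvPolynomial σ k] M
  sv : M →ₗ[MvPolynomial σ k] M
  span_gr : ∀ x : M, x ∈ AddSubgroup.closure {y | ∃ h v q, y ∈ gr h v q}
  smul_gr : ∀ {h v q : ℤ} {n : ℕ} {r : MvPolynomial σ k} {x : M},
    r.IsHomogeneous n → x ∈ gr h v q → r • x ∈ gr h v (q + 2 * n)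
  dh_gr : ∀ {h v q : ℤ} {x : M}, x ∈ gr h v q → dh x ∈ gr (h + 1) v (q + 2)
  dv_gr : ∀ {h v q : ℤ} {x : M}, x ∈ gr h v q → dv x ∈ gr h (v + 1) q
  sh_gr : ∀ {h v q : ℤ} {x : M}, x ∈ gr h v q → sh x = (h.negOnePow : ℤ) • x
  sv_gr : ∀ {h v q : ℤ} {x : M}, x ∈ gr h v q → sv x = (v.negOnePow : ℤ) • x
  dh_dh : ∀ x, dh (dh x) = 0
  dv_dv : ∀ x, dv (dv x) = 0
  dh_dv : ∀ x, dh (dv x) = dv (dh x)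

attribute [instance] Bicomplex.addCommGroup Bicomplex.module

namespace Bicomplex

variable {k : Type u} [Field k] {σ τ : Type}

theorem mem_of_mem_closure {M N : Type u} [AddCommGroup M] [AddCommGroup N] (f : M →+ N)
    {S : Set M} {K : AddSubgroup N} (H : ∀ x ∈ S, f x ∈ K) {x : M}
    (hx : x ∈ AddSubgroup.closure S) : f x ∈ K :=
  (AddSubgroup.closure_le (K := K.comap f)).2 H hx

/-- Two additive maps that agree on homogeneous elements are equal. -/
theorem eq_of_gr (C : Bicomplex k σ) {N : Type u} [AddCommGroup N] (f g : C.M →+ N)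
    (H : ∀ h v q, ∀ x ∈ C.gr h v q, f x = g x) (x : C.M) : f x = g x := by
  induction C.span_gr x using AddSubgroup.closure_induction with
  | mem y hy => obtain ⟨h, v, q, hy⟩ := hy; exact H h v q y hy
  | zero => simp
  | add y z _ _ hy hz => rw [map_add, map_add, hy, hz]
  | neg y _ hy => rw [map_neg, map_neg, hy]

theorem sh_sh (C : Bicomplex k σ) (x : C.M) : C.sh (C.sh x) = x := by
  refine C.eq_of_gr (C.sh.toAddMonoidHom.comp C.sh.toAddMonoidHom) (AddMonoidHom.id _) ?_ x
  intro h v q x hx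
  simp only [AddMonoidHom.comp_apply, LinearMap.toAddMonoidHom_coe, AddMonoidHom.id_apply]
  rw [C.sh_gr hx, map_zsmul, C.sh_gr hx, smul_smul, ← Units.val_mul, Int.units_mul_self]
  simp

theorem sv_sv (C : Bicomplex k σ) (x : C.M) : C.sv (C.sv x) = x := by
  refine C.eq_of_gr (C.sv.toAddMonoidHom.comp C.sv.toAddMonoidHom) (AddMonoidHom.id _) ?_ x
  intro h v q x hx
  simp only [AddMonoidHom.comp_apply, LinearMap.toAddMonoidHom_coe, AddMonoidHom.id_apply]
  rw [C.sv_gr hx, map_zsmul, C.sv_gr hx, smul_smul, ← Units.val_mul, Int.units_mul_self]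
  simp

theorem sh_sv (C : Bicomplex k σ) (x : C.M) : C.sh (C.sv x) = C.sv (C.sh x) := by
  refine C.eq_of_gr (C.sh.toAddMonoidHom.comp C.sv.toAddMonoidHom)
    (C.sv.toAddMonoidHom.comp C.sh.toAddMonoidHom) ?_ x
  intro h v q x hx
  simp only [AddMonoidHom.comp_apply, LinearMap.toAddMonoidHom_coe]
  rw [C.sv_gr hx, C.sh_gr hx, map_zsmul, map_zsmul, C.sv_gr hx, C.sh_gr hx, smul_comm]

theorem sh_dh (C : Bicomplex k σ) (x : C.M) : C.sh (C.dh x) = -C.dh (C.sh x) := by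
  refine C.eq_of_gr (C.sh.toAddMonoidHom.comp C.dh.toAddMonoidHom)
    (-(C.dh.toAddMonoidHom.comp C.sh.toAddMonoidHom)) ?_ x
  intro h v q x hx
  simp only [AddMonoidHom.comp_apply, LinearMap.toAddMonoidHom_coe, AddMonoidHom.neg_apply]
  rw [C.sh_gr hx, C.sh_gr (C.dh_gr hx), map_zsmul, Int.negOnePow_succ]
  simp

theorem sv_dv (C : Bicomplex k σ) (x : C.M) : C.sv (C.dv x) = -C.dv (C.sv x) := by
  refine C.eq_of_gr (C.sv.toAddMonoidHom.comp C.dv.toAddMonoidHom)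
    (-(C.dv.toAddMonoidHom.comp C.sv.toAddMonoidHom)) ?_ x
  intro h v q x hx
  simp only [AddMonoidHom.comp_apply, LinearMap.toAddMonoidHom_coe, AddMonoidHom.neg_apply]
  rw [C.sv_gr hx, C.sv_gr (C.dv_gr hx), map_zsmul, Int.negOnePow_succ]
  simp

theorem sh_dv (C : Bicomplex k σ) (x : C.M) : C.sh (C.dv x) = C.dv (C.sh x) := by
  refine C.eq_of_gr (C.sh.toAddMonoidHom.comp C.dv.toAddMonoidHom)
    (C.dv.toAddMonoidHom.comp C.sh.toAddMonoidHom) ?_ x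
  intro h v q x hx
  simp only [AddMonoidHom.comp_apply, LinearMap.toAddMonoidHom_coe]
  rw [C.sh_gr hx, C.sh_gr (C.dv_gr hx), map_zsmul]

theorem sv_dh (C : Bicomplex k σ) (x : C.M) : C.sv (C.dh x) = C.dh (C.sv x) := by
  refine C.eq_of_gr (C.sv.toAddMonoidHom.comp C.dh.toAddMonoidHom)
    (C.dh.toAddMonoidHom.comp C.sv.toAddMonoidHom) ?_ x
  intro h v q x hx
  simp only [AddMonoidHom.comp_apply, LinearMap.toAddMonoidHom_coe]
  rw [C.sv_gr hx, C.sv_gr (C.dh_gr hx), map_zsmul]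

/-- Morphisms of bicomplexes: linear maps that preserve all three gradings and commute with both
differentials. -/
structure Hom (C D : Bicomplex k σ) : Type u where
  toLin : C.M →ₗ[MvPolynomial σ k] D.M
  map_gr : ∀ {h v q : ℤ} {x : C.M}, x ∈ C.gr h v q → toLin x ∈ D.gr h v q
  comm_dh : ∀ x, toLin (C.dh x) = D.dh (toLin x)
  comm_dv : ∀ x, toLin (C.dv x) = D.dv (toLin x)

namespace Hom

variable {C D E : Bicomplex k σ}

/-- The identity morphism. -/
def id (C : Bicomplex k σ) : Hom C C where
  toLin := LinearMap.id
  map_gr hx := hx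
  comm_dh _ := rfl
  comm_dv _ := rfl

/-- Composition, `g` after `f`. -/
def comp (g : Hom D E) (f : Hom C D) : Hom C E where
  toLin := g.toLin ∘ₗ f.toLin
  map_gr hx := g.map_gr (f.map_gr hx)
  comm_dh x := by simp [f.comm_dh, g.comm_dh]
  comm_dv x := by simp [f.comm_dv, g.comm_dv]

theorem comm_sh (f : Hom C D) (x : C.M) : f.toLin (C.sh x) = D.sh (f.toLin x) := by
  refine C.eq_of_gr (f.toLin.toAddMonoidHom.comp C.sh.toAddMonoidHom)
    (D.sh.toAddMonoidHom.comp f.toLin.toAddMonoidHom) ?_ x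
  intro h v q x hx
  simp only [AddMonoidHom.comp_apply, LinearMap.toAddMonoidHom_coe]
  rw [C.sh_gr hx, D.sh_gr (f.map_gr hx), map_zsmul]

theorem comm_sv (f : Hom C D) (x : C.M) : f.toLin (C.sv x) = D.sv (f.toLin x) := by
  refine C.eq_of_gr (f.toLin.toAddMonoidHom.comp C.sv.toAddMonoidHom)
    (D.sv.toAddMonoidHom.comp f.toLin.toAddMonoidHom) ?_ x
  intro h v q x hx
  simp only [AddMonoidHom.comp_apply, LinearMap.toAddMonoidHom_coe]
  rw [C.sv_gr hx, D.sv_gr (f.map_gr hx), map_zsmul]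

/-- `f` and `g` are horizontally homotopic: in every vertical degree they are homotopic as maps of
horizontal complexes, by homotopies that are compatible with the vertical differentials. -/
def Homotopic (f g : Hom C D) : Prop :=
  ∃ H : C.M →ₗ[MvPolynomial σ k] D.M,
    (∀ {h v q : ℤ} {x : C.M}, x ∈ C.gr h v q → H x ∈ D.gr (h - 1) v (q - 2)) ∧
    (∀ x, H (C.dv x) = D.dv (H x)) ∧
    ∀ x, f.toLin x - g.toLin x = D.dh (H x) + H (C.dh x)

/-- Homotopy equivalences of bicomplexes. -/
def IsHomotopyEquiv (f : Hom C D) : Prop :=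
  ∃ g : Hom D C, (g.comp f).Homotopic (Hom.id C) ∧ (f.comp g).Homotopic (Hom.id D)

end Hom

/-- Horizontal cocycles of bidegree `(h, v)`. -/
def cycles (C : Bicomplex k σ) (h v : ℤ) : AddSubgroup C.M :=
  (⨆ q, C.gr h v q) ⊓ C.dh.toAddMonoidHom.ker

/-- Horizontal coboundaries of bidegree `(h, v)`. -/
def boundaries (C : Bicomplex k σ) (h v : ℤ) : AddSubgroup C.M :=
  (⨆ q, C.gr (h - 1) v q).map C.dh.toAddMonoidHom

/-- `f` is a term-wise quasi-isomorphism: for each vertical degree `v`, the map between the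
horizontal complexes in vertical degree `v` induces an isomorphism (injective and surjective)
on the cohomology `cycles h v / boundaries h v`, for every `h`. -/
def Hom.IsTermwiseQuasiIso {C D : Bicomplex k σ} (f : Hom C D) : Prop :=
  ∀ h v : ℤ,
    (∀ x ∈ C.cycles h v, f.toLin x ∈ D.boundaries h v → x ∈ C.boundaries h v) ∧
    (∀ y ∈ D.cycles h v, ∃ x ∈ C.cycles h v, y - f.toLin x ∈ D.boundaries h v)

/-! ### Free bicomplexes given by matrices -/

section Free

variable {ι : Type}

/-- The homogeneous elements of the free `k[σ]`-module with the basis `ι`, when the basis element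
`i` has the degrees `(hd i, vd i, qd i)`. -/
def freeGr (k : Type u) [Field k] (σ : Type) (hd vd qd : ι → ℤ) (h v q : ℤ) :
    AddSubgroup (ι → MvPolynomial σ k) where
  carrier := {f | ∀ i, f i = 0 ∨ h = hd i ∧ v = vd i ∧
    ∃ n : ℕ, (f i).IsHomogeneous n ∧ q = qd i + 2 * n}
  zero_mem' := fun i => Or.inl rfl
  add_mem' := by
    intro f g hf hg i
    rcases hf i with hf | ⟨h1, h2, n, h3, h4⟩
    · rcases hg i with hg | hg
      · exact Or.inl (by simp [hf, hg])
      · exact Or.inr (by simpa [hf] using hg)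
    · rcases hg i with hg | ⟨_, _, n', h3', h4'⟩
      · exact Or.inr ⟨h1, h2, n, by simpa [hg] using h3, h4⟩
      · obtain rfl : n = n' := by omega
        exact Or.inr ⟨h1, h2, n, h3.add h3', h4⟩
  neg_mem' := by
    intro f hf i
    rcases hf i with hf | ⟨h1, h2, n, h3, h4⟩
    · exact Or.inl (by simp [hf])
    · exact Or.inr ⟨h1, h2, n, h3.neg, h4⟩

variable [Fintype ι]

theorem freeGr_mulVec (hd vd qd : ι → ℤ) (A : Matrix ι ι (MvPolynomial σ k)) (a b c : ℤ)
    (hA : ∀ i j, A i j = 0 ∨ hd i = hd j + a ∧ vd i = vd j + b ∧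
      ∃ n : ℕ, (A i j).IsHomogeneous n ∧ qd j + c = qd i + 2 * n)
    {h v q : ℤ} {f : ι → MvPolynomial σ k} (hf : f ∈ freeGr k σ hd vd qd h v q) :
    A.mulVec f ∈ freeGr k σ hd vd qd (h + a) (v + b) (q + c) := by
  have key : A.mulVec f = ∑ j, fun i => A i j * f j := by
    funext i
    simp [Matrix.mulVec, dotProduct]
  rw [key]
  refine sum_mem fun j _ i => ?_
  rcases hf j with hf | ⟨h1, h2, n, h3, h4⟩
  · exact Or.inl (by simp [hf])
  rcases hA i j with hA | ⟨g1, g2, n', g3, g4⟩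
  · exact Or.inl (by simp [hA])
  · refine Or.inr ⟨by omega, by omega, n' + n, g3.mul h3, ?_⟩
    push_cast
    omega

theorem freeGr_span (hd vd qd : ι → ℤ) (f : ι → MvPolynomial σ k) :
    f ∈ AddSubgroup.closure {y | ∃ h v q, y ∈ freeGr k σ hd vd qd h v q} := by
  classical
  rw [← Finset.univ_sum_single f]
  refine sum_mem fun i _ => ?_
  have key : (Pi.single i (f i) : ι → MvPolynomial σ k) =
      ∑ n ∈ Finset.range ((f i).totalDegree + 1),
        Pi.single i (homogeneousComponent n (f i)) := by
    conv_lhs => rw [← sum_homogeneousComponent (f i)]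
    exact map_sum (AddMonoidHom.single (fun _ : ι => MvPolynomial σ k) i) _ _
  rw [key]
  refine sum_mem fun n _ => AddSubgroup.subset_closure ⟨hd i, vd i, qd i + 2 * n, fun j => ?_⟩
  by_cases hj : j = i
  · subst hj
    refine Or.inr ⟨rfl, rfl, n, ?_, rfl⟩
    simpa using homogeneousComponent_isHomogeneous n (f j)
  · exact Or.inl (by simp [hj])

/-- The free `k[σ]`-module with the basis `ι`, the basis element `i` having the degrees
`(hd i, vd i, qd i)`, and with the differentials given by the matrices `A` (horizontal) and
`B` (vertical); column `j` of a matrix is the image of the basis element `j`. -/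
def free (hd vd qd : ι → ℤ) (A B : Matrix ι ι (MvPolynomial σ k))
    (hA : ∀ i j, A i j = 0 ∨ hd i = hd j + 1 ∧ vd i = vd j + 0 ∧
      ∃ n : ℕ, (A i j).IsHomogeneous n ∧ qd j + 2 = qd i + 2 * n)
    (hB : ∀ i j, B i j = 0 ∨ hd i = hd j + 0 ∧ vd i = vd j + 1 ∧
      ∃ n : ℕ, (B i j).IsHomogeneous n ∧ qd j + 0 = qd i + 2 * n)
    (hAA : A * A = 0) (hBB : B * B = 0) (hAB : A * B = B * A) : Bicomplex k σ where
  M := ι → MvPolynomial σ k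
  gr := freeGr k σ hd vd qd
  dh := A.mulVecLin
  dv := B.mulVecLin
  sh := LinearMap.pi fun i => ((hd i).negOnePow : ℤ) • LinearMap.proj i
  sv := LinearMap.pi fun i => ((vd i).negOnePow : ℤ) • LinearMap.proj i
  span_gr := freeGr_span hd vd qd
  smul_gr := by
    intro h v q n r f hr hf i
    rcases hf i with hf | ⟨h1, h2, n', h3, h4⟩
    · exact Or.inl (by simp [hf])
    · refine Or.inr ⟨h1, h2, n + n', hr.mul h3, ?_⟩
      push_cast
      omega
  dh_gr {h v q f} hf := by simpa using freeGr_mulVec hd vd qd A 1 0 2 hA hf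
  dv_gr {h v q f} hf := by simpa using freeGr_mulVec hd vd qd B 0 1 0 hB hf
  sh_gr := by
    intro h v q f hf
    funext i
    rcases hf i with hf | ⟨h1, h2, n, h3, h4⟩
    · simp [hf]
    · simp [h1]
  sv_gr := by
    intro h v q f hf
    funext i
    rcases hf i with hf | ⟨h1, h2, n, h3, h4⟩
    · simp [hf]
    · simp [h2]
  dh_dh f := by simp [hAA]
  dv_dv f := by simp [hBB]
  dh_dv f := by simp [hAB]

end Free

/-! ### Change of the polynomial ring -/

/-- Restriction of scalars along the map `k[σ] → k[τ]` that renames the variables by `φ`. -/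
def restrict (φ : σ → τ) (C : Bicomplex k τ) : Bicomplex k σ :=
  letI : Module (MvPolynomial σ k) C.M := Module.compHom C.M (rename φ).toRingHom
  { M := C.M
    gr := C.gr
    dh :=
      { toFun := C.dh
        map_add' := C.dh.map_add
        map_smul' := fun r (x : C.M) => C.dh.map_smul (rename φ r) x }
    dv :=
      { toFun := C.dv
        map_add' := C.dv.map_add
        map_smul' := fun r (x : C.M) => C.dv.map_smul (rename φ r) x }
    sh :=
      { toFun := C.sh
        map_add' := C.sh.map_add
        map_smul' := fun r (x : C.M) => C.sh.map_smul (rename φ r) x }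
    sv :=
      { toFun := C.sv
        map_add' := C.sv.map_add
        map_smul' := fun r (x : C.M) => C.sv.map_smul (rename φ r) x }
    span_gr := C.span_gr
    smul_gr := fun hr hx => C.smul_gr (hr.rename_isHomogeneous (f := φ)) hx
    dh_gr := C.dh_gr
    dv_gr := C.dv_gr
    sh_gr := C.sh_gr
    sv_gr := C.sv_gr
    dh_dh := C.dh_dh
    dv_dv := C.dv_dv
    dh_dv := C.dh_dv }

/-- Restriction of scalars on morphisms. -/
def restrictMap (φ : σ → τ) {C D : Bicomplex k τ} (f : Hom C D) :
    Hom (restrict φ C) (restrict φ D) where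
  toLin :=
    { toFun := f.toLin
      map_add' := fun (x y : C.M) => f.toLin.map_add x y
      map_smul' := fun r (x : C.M) => f.toLin.map_smul (rename φ r) x }
  map_gr := f.map_gr
  comm_dh := f.comm_dh
  comm_dv := f.comm_dv

/-- `k[τ]` as an algebra over `k[σ]` by renaming the variables along `φ`. -/
abbrev renameAlgebra (k : Type u) [Field k] (φ : σ → τ) :
    Algebra (MvPolynomial σ k) (MvPolynomial τ k) :=
  (rename φ : MvPolynomial σ k →ₐ[k] MvPolynomial τ k).toRingHom.toAlgebra

/-- Extension of scalars `k[τ] ⊗ C` along the map `k[σ] → k[τ]` that renames the variables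
by `φ`. -/
def extend (φ : σ → τ) (C : Bicomplex k σ) : Bicomplex k τ :=
  letI := renameAlgebra k φ
  { M := MvPolynomial τ k ⊗[MvPolynomial σ k] C.M
    gr := fun h v q => AddSubgroup.closure {z | ∃ (n : ℕ) (r : MvPolynomial τ k) (c : ℤ) (x : C.M),
      r.IsHomogeneous n ∧ x ∈ C.gr h v c ∧ q = c + 2 * n ∧ z = r ⊗ₜ x}
    dh := C.dh.baseChange (MvPolynomial τ k)
    dv := C.dv.baseChange (MvPolynomial τ k)
    sh := C.sh.baseChange (MvPolynomial τ k)
    sv := C.sv.baseChange (MvPolynomial τ k)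
    span_gr := by
      intro z
      induction z using TensorProduct.induction_on with
      | zero => exact zero_mem _
      | add x y hx hy => exact add_mem hx hy
      | tmul r x =>
        induction C.span_gr x using AddSubgroup.closure_induction with
        | zero => simp
        | add y z _ _ hy hz => rw [TensorProduct.tmul_add]; exact add_mem hy hz
        | neg y _ hy => rw [TensorProduct.tmul_neg]; exact neg_mem hy
        | mem y hy =>
          obtain ⟨h, v, c, hy⟩ := hy
          rw [← sum_homogeneousComponent r, TensorProduct.sum_tmul]
          refine sum_mem fun n _ => AddSubgroup.subset_closure ⟨h, v, c + 2 * n,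
            AddSubgroup.subset_closure ⟨n, _, c, y, homogeneousComponent_isHomogeneous n r, hy,
              rfl, rfl⟩⟩
    smul_gr := by
      intro h v q n r x hr hx
      induction hx using AddSubgroup.closure_induction with
      | zero => rw [smul_zero]; exact zero_mem _
      | add y z _ _ hy hz => rw [smul_add]; exact add_mem hy hz
      | neg y _ hy => rw [smul_neg]; exact neg_mem hy
      | mem y hy =>
        obtain ⟨n', r', c, x, hr', hx, rfl, rfl⟩ := hy
        refine AddSubgroup.subset_closure ⟨n + n', r * r', c, x, hr.mul hr', hx, ?_, ?_⟩
        · push_cast; ring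
        · rw [TensorProduct.smul_tmul', smul_eq_mul]
    dh_gr := fun hx => mem_of_mem_closure (C.dh.baseChange (MvPolynomial τ k)).toAddMonoidHom
      (by
        rintro _ ⟨n', r', c, y, hr', hy, rfl, rfl⟩
        exact AddSubgroup.subset_closure ⟨n', r', c + 2, C.dh y, hr', C.dh_gr hy, by ring, rfl⟩) hx
    dv_gr := fun hx => mem_of_mem_closure (C.dv.baseChange (MvPolynomial τ k)).toAddMonoidHom
      (by
        rintro _ ⟨n', r', c, y, hr', hy, rfl, rfl⟩
        exact AddSubgroup.subset_closure ⟨n', r', c, C.dv y, hr', C.dv_gr hy, by ring, rfl⟩) hx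
    sh_gr := by
      intro h v q x hx
      induction hx using AddSubgroup.closure_induction with
      | zero => simp
      | add y z _ _ hy hz => rw [map_add, smul_add, hy, hz]
      | neg y _ hy => rw [map_neg, smul_neg, hy]
      | mem y hy =>
        obtain ⟨n', r', c, x, hr', hx, rfl, rfl⟩ := hy
        rw [LinearMap.baseChange_tmul, C.sh_gr hx]
        exact map_zsmul (TensorProduct.mk (MvPolynomial σ k) (MvPolynomial τ k) C.M r') _ x
    sv_gr := by
      intro h v q x hx
      induction hx using AddSubgroup.closure_induction with
      | zero => simp
      | add y z _ _ hy hz => rw [map_add, smul_add, hy, hz]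
      | neg y _ hy => rw [map_neg, smul_neg, hy]
      | mem y hy =>
        obtain ⟨n', r', c, x, hr', hx, rfl, rfl⟩ := hy
        rw [LinearMap.baseChange_tmul, C.sv_gr hx]
        exact map_zsmul (TensorProduct.mk (MvPolynomial σ k) (MvPolynomial τ k) C.M r') _ x
    dh_dh := by
      intro x
      rw [← LinearMap.comp_apply, ← LinearMap.baseChange_comp,
        show C.dh ∘ₗ C.dh = 0 from LinearMap.ext C.dh_dh]
      simp
    dv_dv := by
      intro x
      rw [← LinearMap.comp_apply, ← LinearMap.baseChange_comp,
        show C.dv ∘ₗ C.dv = 0 from LinearMap.ext C.dv_dv]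
      simp
    dh_dv := by
      intro x
      rw [← LinearMap.comp_apply, ← LinearMap.baseChange_comp,
        show C.dh ∘ₗ C.dv = C.dv ∘ₗ C.dh from LinearMap.ext C.dh_dv, LinearMap.baseChange_comp]
      rfl }

/-- Extension of scalars on morphisms. -/
def extendMap (φ : σ → τ) {C D : Bicomplex k σ} (f : Hom C D) :
    Hom (extend φ C) (extend φ D) :=
  letI := renameAlgebra k φ
  { toLin := f.toLin.baseChange (MvPolynomial τ k)
    map_gr := fun hx => mem_of_mem_closure (f.toLin.baseChange (MvPolynomial τ k)).toAddMonoidHom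
      (by
        rintro _ ⟨n', r', c, y, hr', hy, rfl, rfl⟩
        exact AddSubgroup.subset_closure ⟨n', r', c, f.toLin y, hr', f.map_gr hy, rfl, rfl⟩) hx
    comm_dh := by
      intro x
      change (f.toLin.baseChange _ ∘ₗ C.dh.baseChange _) x =
        (D.dh.baseChange _ ∘ₗ f.toLin.baseChange _) x
      rw [← LinearMap.baseChange_comp, ← LinearMap.baseChange_comp,
        show f.toLin ∘ₗ C.dh = D.dh ∘ₗ f.toLin from LinearMap.ext f.comm_dh]
    comm_dv := by
      intro x
      change (f.toLin.baseChange _ ∘ₗ C.dv.baseChange _) x =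
        (D.dv.baseChange _ ∘ₗ f.toLin.baseChange _) x
      rw [← LinearMap.baseChange_comp, ← LinearMap.baseChange_comp,
        show f.toLin ∘ₗ C.dv = D.dv ∘ₗ f.toLin from LinearMap.ext f.comm_dv] }

/-! ### Tensor products -/

section Tensor

variable {R : Type u} [CommRing R] {ι : Type} [Fintype ι] [LinearOrder ι]

/-- The total differential `∑ i, s ⊗ ⋯ ⊗ s ⊗ d i ⊗ 1 ⊗ ⋯ ⊗ 1` (with `d i` in position `i`) on a
tensor product of modules with sign operators `s` and differentials `d`. -/
def tensorDiff {M : ι → Type u} [∀ i, AddCommGroup (M i)] [∀ i, Module R (M i)]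
    (s d : ∀ i, M i →ₗ[R] M i) : (⨂[R] i, M i) →ₗ[R] ⨂[R] i, M i :=
  ∑ i, PiTensorProduct.map fun j => if j < i then s j else if j = i then d j else LinearMap.id

theorem tensor_ext {M : ι → Type u} [∀ i, AddCommGroup (M i)] [∀ i, Module R (M i)]
    {N : Type u} [AddCommGroup N] [Module R N] (f g : (⨂[R] i, M i) →ₗ[R] N)
    (h : ∀ m, f (PiTensorProduct.tprod R m) = g (PiTensorProduct.tprod R m)) : f = g :=
  PiTensorProduct.ext (MultilinearMap.ext h)

theorem tprod_neg_of_eq {M : ι → Type u} [∀ i, AddCommGroup (M i)] [∀ i, Module R (M i)]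
    (m m' : ∀ i, M i) (i : ι) (hi : m i = -m' i) (h : ∀ j, j ≠ i → m j = m' j) :
    PiTensorProduct.tprod R m = -PiTensorProduct.tprod R m' := by
  have : m = Function.update m' i (-m' i) := by
    funext j
    by_cases hj : j = i
    · subst hj; simp [hi]
    · simp [hj, h j hj]
  rw [this, MultilinearMap.map_update_neg, Function.update_eq_self]

theorem tensorDiff_sq {M : ι → Type u} [∀ i, AddCommGroup (M i)] [∀ i, Module R (M i)]
    (s d : ∀ i, M i →ₗ[R] M i) (hd : ∀ i x, d i (d i x) = 0)
    (hsd : ∀ i x, s i (d i x) = -d i (s i x)) :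
    tensorDiff s d ∘ₗ tensorDiff s d = 0 := by
  refine tensor_ext _ _ fun m => ?_
  simp only [tensorDiff, LinearMap.comp_apply, LinearMap.sum_apply, map_sum,
    PiTensorProduct.map_tprod, LinearMap.zero_apply]
  rw [← Finset.sum_product']
  refine Finset.sum_involution (fun p _ => (p.2, p.1)) ?_ ?_ (by simp) (by simp)
  · rintro ⟨a, b⟩ -
    dsimp only
    have main : ∀ a b : ι, a < b → (PiTensorProduct.tprod R fun j =>
          (if j < a then s j else if j = a then d j else LinearMap.id)
            ((if j < b then s j else if j = b then d j else LinearMap.id) (m j))) =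
        -PiTensorProduct.tprod R fun j =>
          (if j < b then s j else if j = b then d j else LinearMap.id)
            ((if j < a then s j else if j = a then d j else LinearMap.id) (m j)) := by
      intro a b hab
      refine tprod_neg_of_eq _ _ a ?_ ?_
      · simp [hab, hsd]
      · intro j hj
        rcases lt_trichotomy j a with h | h | h
        · simp [h, h.trans hab]
        · exact absurd h hj
        · simp [h.not_gt, hj]
    rcases lt_trichotomy a b with h | h | h
    · rw [main a b h]; simp
    · subst h
      have : ∀ m' : ∀ i, M i, m' a = 0 → PiTensorProduct.tprod R m' = 0 :=
        fun m' h => MultilinearMap.map_coord_zero _ a h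
      rw [this _ (by simp [hd])]
      simp
    · rw [main b a h]; simp
  · rintro ⟨a, b⟩ - hne heq
    simp only [Prod.mk.injEq] at heq
    obtain ⟨rfl, -⟩ := heq
    exact hne (MultilinearMap.map_coord_zero _ b (by simp [hd]))

theorem tensorDiff_comm {M : ι → Type u} [∀ i, AddCommGroup (M i)] [∀ i, Module R (M i)]
    (s d s' d' : ∀ i, M i →ₗ[R] M i) (hss : ∀ i x, s i (s' i x) = s' i (s i x))
    (hsd : ∀ i x, s i (d' i x) = d' i (s i x)) (hds : ∀ i x, d i (s' i x) = s' i (d i x))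
    (hdd : ∀ i x, d i (d' i x) = d' i (d i x)) :
    tensorDiff s d ∘ₗ tensorDiff s' d' = tensorDiff s' d' ∘ₗ tensorDiff s d := by
  refine tensor_ext _ _ fun m => ?_
  simp only [tensorDiff, LinearMap.comp_apply, LinearMap.sum_apply, map_sum,
    PiTensorProduct.map_tprod]
  rw [Finset.sum_comm]
  refine Finset.sum_congr rfl fun a _ => Finset.sum_congr rfl fun b _ => ?_
  congr 1
  funext j
  split_ifs <;> simp [hss, hsd, hds, hdd]

theorem tensorDiff_map {M N : ι → Type u} [∀ i, AddCommGroup (M i)] [∀ i, Module R (M i)]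
    [∀ i, AddCommGroup (N i)] [∀ i, Module R (N i)]
    (s d : ∀ i, M i →ₗ[R] M i) (s' d' : ∀ i, N i →ₗ[R] N i) (f : ∀ i, M i →ₗ[R] N i)
    (hs : ∀ i x, f i (s i x) = s' i (f i x)) (hd : ∀ i x, f i (d i x) = d' i (f i x)) :
    PiTensorProduct.map f ∘ₗ tensorDiff s d = tensorDiff s' d' ∘ₗ PiTensorProduct.map f := by
  refine tensor_ext _ _ fun m => ?_
  simp only [tensorDiff, LinearMap.comp_apply, LinearMap.sum_apply, map_sum,
    PiTensorProduct.map_tprod]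
  refine Finset.sum_congr rfl fun a _ => ?_
  congr 1
  funext j
  split_ifs <;> simp [hs, hd]

/-- The homogeneous elements of a tensor product: sums of the elements `r • ⨂ i, m i` with `r` and
all `m i` homogeneous and with the appropriate sum of degrees. -/
def tensorGr (C : ι → Bicomplex k σ) (h v q : ℤ) :
    AddSubgroup (⨂[MvPolynomial σ k] i, (C i).M) :=
  AddSubgroup.closure {z | ∃ (n : ℕ) (r : MvPolynomial σ k) (a b c : ι → ℤ) (m : ∀ i, (C i).M),
    r.IsHomogeneous n ∧ (∀ i, m i ∈ (C i).gr (a i) (b i) (c i)) ∧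
    h = ∑ i, a i ∧ v = ∑ i, b i ∧ q = ∑ i, c i + 2 * n ∧
    z = r • PiTensorProduct.tprod (MvPolynomial σ k) m}

theorem tensorGr_map (C D : ι → Bicomplex k σ)
    (f : ∀ i, (C i).M →ₗ[MvPolynomial σ k] (D i).M) (a b c : ι → ℤ)
    (hf : ∀ i h v q x, x ∈ (C i).gr h v q → f i x ∈ (D i).gr (h + a i) (v + b i) (q + c i))
    {h v q : ℤ} {x : ⨂[MvPolynomial σ k] i, (C i).M} (hx : x ∈ tensorGr C h v q) :
    PiTensorProduct.map f x ∈ tensorGr D (h + ∑ i, a i) (v + ∑ i, b i) (q + ∑ i, c i) := by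
  refine mem_of_mem_closure (PiTensorProduct.map f).toAddMonoidHom ?_ hx
  rintro _ ⟨n, r, a', b', c', m, hr, hm, rfl, rfl, rfl, rfl⟩
  refine AddSubgroup.subset_closure ⟨n, r, a' + a, b' + b, c' + c, fun i => f i (m i), hr,
    fun i => hf i _ _ _ _ (hm i), ?_, ?_, ?_, ?_⟩
  · simp [Finset.sum_add_distrib]
  · simp [Finset.sum_add_distrib]
  · simp only [Pi.add_apply, Finset.sum_add_distrib]; ring
  · simp

theorem tensorGr_span (C : ι → Bicomplex k σ) (x : ⨂[MvPolynomial σ k] i, (C i).M) :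
    x ∈ AddSubgroup.closure {y | ∃ h v q, y ∈ tensorGr C h v q} := by
  set G := AddSubgroup.closure {y | ∃ h v q, y ∈ tensorGr C h v q} with hG
  have key : ∀ (s : Finset ι) (r : MvPolynomial σ k) (m : ∀ i, (C i).M),
      (∀ i, i ∉ s → ∃ a b c, m i ∈ (C i).gr a b c) →
      r • PiTensorProduct.tprod (MvPolynomial σ k) m ∈ G := by
    intro s
    induction s using Finset.induction_on with
    | empty =>
      intro r m hm
      choose a b c hm using fun i => hm i (Finset.notMem_empty i)
      rw [← sum_homogeneousComponent r, Finset.sum_smul]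
      refine sum_mem fun n _ => AddSubgroup.subset_closure ⟨_, _, _, AddSubgroup.subset_closure
        ⟨n, _, a, b, c, m, homogeneousComponent_isHomogeneous n r, hm, rfl, rfl, rfl, rfl⟩⟩
    | insert i s hi ih =>
      intro r m hm
      have step : ∀ y : (C i).M,
          r • PiTensorProduct.tprod (MvPolynomial σ k) (Function.update m i y) ∈ G := by
        intro y
        induction (C i).span_gr y using AddSubgroup.closure_induction with
        | zero => rw [MultilinearMap.map_update_zero, smul_zero]; exact zero_mem _
        | add y z _ _ hy hz =>
          rw [MultilinearMap.map_update_add, smul_add]; exact add_mem hy hz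
        | neg y _ hy => rw [MultilinearMap.map_update_neg, smul_neg]; exact neg_mem hy
        | mem y hy =>
          refine ih r _ fun j hj => ?_
          by_cases hji : j = i
          · subst hji; simpa using hy
          · simpa [hji] using hm j (by simp [hji, hj])
      simpa using step (m i)
  induction x using PiTensorProduct.induction_on with
  | smul_tprod r m => exact key Finset.univ r m (by simp)
  | add x y hx hy => exact add_mem hx hy

theorem tensorGr_sign (C : ι → Bicomplex k σ)
    (s : ∀ i, (C i).M →ₗ[MvPolynomial σ k] (C i).M) (a : ι → ℤ) (m : ∀ i, (C i).M)
    (hm : ∀ i, s i (m i) = ((a i).negOnePow : ℤ) • m i) :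
    PiTensorProduct.map s (PiTensorProduct.tprod (MvPolynomial σ k) m) =
      (((∑ i, a i).negOnePow : ℤ) : MvPolynomial σ k) •
        PiTensorProduct.tprod (MvPolynomial σ k) m := by
  have h1 : ∀ t : Finset ι,
      ((∑ i ∈ t, a i).negOnePow : ℤ) = ∏ i ∈ t, ((a i).negOnePow : ℤ) := by
    intro t
    induction t using Finset.induction_on with
    | empty => simp
    | insert i t hi ih => rw [Finset.sum_insert hi, Finset.prod_insert hi, Int.negOnePow_add,
        Units.val_mul, ih]
  rw [PiTensorProduct.map_tprod, h1, Int.cast_prod, ← MultilinearMap.map_smul_univ]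
  congr 1
  funext i
  rw [hm, Int.cast_smul_eq_zsmul]

/-- The tensor product over `k[σ]` of a finite family of bicomplexes, in the order of `ι`.  The
two differentials follow the sign rule separately for the two gradings. -/
def tensor (C : ι → Bicomplex k σ) : Bicomplex k σ where
  M := ⨂[MvPolynomial σ k] i, (C i).M
  gr := tensorGr C
  dh := tensorDiff (fun i => (C i).sh) (fun i => (C i).dh)
  dv := tensorDiff (fun i => (C i).sv) (fun i => (C i).dv)
  sh := PiTensorProduct.map fun i => (C i).sh
  sv := PiTensorProduct.map fun i => (C i).sv
  span_gr := tensorGr_span C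
  smul_gr := by
    intro h v q n r x hr hx
    refine mem_of_mem_closure (DistribSMul.toAddMonoidHom _ r) ?_ hx
    rintro _ ⟨n', r', a, b, c, m, hr', hm, rfl, rfl, rfl, rfl⟩
    refine AddSubgroup.subset_closure ⟨n + n', r * r', a, b, c, m, hr.mul hr', hm, rfl, rfl, ?_,
      ?_⟩
    · push_cast; ring
    · simp [mul_smul]
  dh_gr := by
    intro h v q x hx
    rw [tensorDiff, LinearMap.sum_apply]
    refine sum_mem fun i _ => ?_
    have := tensorGr_map C C (fun j => if j < i then (C j).sh else if j = i then (C j).dh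
      else LinearMap.id) (Pi.single i 1) 0 (Pi.single i 2) ?_ hx
    · simpa using this
    · intro j h v q x hx
      by_cases hj : j = i
      · subst hj; simpa using (C j).dh_gr hx
      · by_cases hj' : j < i
        · simpa [hj, hj', (C j).sh_gr hx] using zsmul_mem hx _
        · simpa [hj, hj'] using hx
  dv_gr := by
    intro h v q x hx
    rw [tensorDiff, LinearMap.sum_apply]
    refine sum_mem fun i _ => ?_
    have := tensorGr_map C C (fun j => if j < i then (C j).sv else if j = i then (C j).dv
      else LinearMap.id) 0 (Pi.single i 1) 0 ?_ hx
    · simpa using this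
    · intro j h v q x hx
      by_cases hj : j = i
      · subst hj; simpa using (C j).dv_gr hx
      · by_cases hj' : j < i
        · simpa [hj, hj', (C j).sv_gr hx] using zsmul_mem hx _
        · simpa [hj, hj'] using hx
  sh_gr := by
    intro h v q x hx
    refine Eq.trans ?_ (Int.cast_smul_eq_zsmul (MvPolynomial σ k) _ x)
    induction hx using AddSubgroup.closure_induction with
    | zero => simp
    | add y z _ _ hy hz => rw [map_add, smul_add, hy, hz]
    | neg y _ hy => rw [map_neg, smul_neg, hy]
    | mem y hy =>
      obtain ⟨n, r, a, b, c, m, hr, hm, rfl, rfl, rfl, rfl⟩ := hy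
      rw [map_smul, tensorGr_sign C _ a m fun i => (C i).sh_gr (hm i), smul_comm]
  sv_gr := by
    intro h v q x hx
    refine Eq.trans ?_ (Int.cast_smul_eq_zsmul (MvPolynomial σ k) _ x)
    induction hx using AddSubgroup.closure_induction with
    | zero => simp
    | add y z _ _ hy hz => rw [map_add, smul_add, hy, hz]
    | neg y _ hy => rw [map_neg, smul_neg, hy]
    | mem y hy =>
      obtain ⟨n, r, a, b, c, m, hr, hm, rfl, rfl, rfl, rfl⟩ := hy
      rw [map_smul, tensorGr_sign C _ b m fun i => (C i).sv_gr (hm i), smul_comm]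
  dh_dh := LinearMap.congr_fun (tensorDiff_sq _ _ (fun i => (C i).dh_dh) fun i => (C i).sh_dh)
  dv_dv := LinearMap.congr_fun (tensorDiff_sq _ _ (fun i => (C i).dv_dv) fun i => (C i).sv_dv)
  dh_dv := LinearMap.congr_fun (tensorDiff_comm _ _ _ _ (fun i => (C i).sh_sv)
    (fun i => (C i).sh_dv) (fun i x => ((C i).sv_dh x).symm) fun i => (C i).dh_dv)

/-- The tensor product of morphisms. -/
def tensorMap {C D : ι → Bicomplex k σ} (f : ∀ i, Hom (C i) (D i)) :
    Hom (tensor C) (tensor D) where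
  toLin := PiTensorProduct.map fun i => (f i).toLin
  map_gr := by
    intro h v q x hx
    have := tensorGr_map C D (fun i => (f i).toLin) 0 0 0
      (fun i h v q x hx => by simpa using (f i).map_gr hx) hx
    simp only [Pi.zero_apply, Finset.sum_const_zero, add_zero] at this
    exact this
  comm_dh := LinearMap.congr_fun (tensorDiff_map _ _ _ _ _ (fun i => (f i).comm_sh)
    fun i => (f i).comm_dh)
  comm_dv := LinearMap.congr_fun (tensorDiff_map _ _ _ _ _ (fun i => (f i).comm_sv)
    fun i => (f i).comm_dv)

end Tensor

/-! ### The naive complex -/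

/-- The submodule generated by the horizontal coboundaries and by everything of nonzero horizontal
degree. -/
def naiveKer (C : Bicomplex k σ) : Submodule (MvPolynomial σ k) C.M :=
  LinearMap.range C.dh ⊔ Submodule.span _ {x | ∃ h v q, h ≠ 0 ∧ x ∈ C.gr h v q}

theorem naiveKer_le (C : Bicomplex k σ) (f : C.M →ₗ[MvPolynomial σ k] C.M)
    (hd : ∀ x, f (C.dh x) = C.dh (f x))
    (hf : ∀ h v q x, x ∈ C.gr h v q → ∃ v' q', f x ∈ C.gr h v' q') :
    C.naiveKer ≤ C.naiveKer.comap f := by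
  refine sup_le ?_ (Submodule.span_le.2 ?_)
  · rintro _ ⟨x, rfl⟩
    exact Submodule.mem_sup_left ⟨f x, (hd x).symm⟩
  · rintro x ⟨h, v, q, hh, hx⟩
    obtain ⟨v', q', hx⟩ := hf h v q x hx
    exact Submodule.mem_sup_right (Submodule.subset_span ⟨h, v', q', hh, hx⟩)

/-- The cohomology in horizontal degree `0` of a bicomplex that vanishes in positive horizontal
degrees, that is, the cokernel of `dh` from degree `-1` to degree `0` in every vertical degree,
regarded as a bicomplex concentrated in horizontal degree `0`. -/
def naive (C : Bicomplex k σ) : Bicomplex k σ where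
  M := C.M ⧸ C.naiveKer
  gr h v q := if h = 0 then (C.gr 0 v q).map C.naiveKer.mkQ.toAddMonoidHom else ⊥
  dh := 0
  dv := C.naiveKer.mapQ C.naiveKer C.dv
    (C.naiveKer_le C.dv (fun x => (C.dh_dv x).symm) fun _ _ _ _ hx => ⟨_, _, C.dv_gr hx⟩)
  sh := LinearMap.id
  sv := C.naiveKer.mapQ C.naiveKer C.sv
    (C.naiveKer_le C.sv C.sv_dh fun _ v q _ hx => ⟨v, q, by
      rw [C.sv_gr hx]; exact zsmul_mem hx _⟩)
  span_gr x := by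
    obtain ⟨x, rfl⟩ := C.naiveKer.mkQ_surjective x
    refine mem_of_mem_closure C.naiveKer.mkQ.toAddMonoidHom ?_ (C.span_gr x)
    rintro y ⟨h, v, q, hy⟩
    by_cases hh : h = 0
    · subst hh
      exact AddSubgroup.subset_closure ⟨0, v, q, by rw [if_pos rfl]; exact ⟨y, hy, rfl⟩⟩
    · have : C.naiveKer.mkQ y = 0 := (Submodule.Quotient.mk_eq_zero _).2
        (Submodule.mem_sup_right (Submodule.subset_span ⟨h, v, q, hh, hy⟩))
      change C.naiveKer.mkQ y ∈ _
      rw [this]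
      exact zero_mem _
  smul_gr := by
    intro h v q n r x hr hx
    split_ifs at hx ⊢
    · obtain ⟨y, hy, rfl⟩ := hx
      exact ⟨r • y, C.smul_gr hr hy, rfl⟩
    · obtain rfl : x = 0 := hx
      simp
  dh_gr := by
    intro h v q x _
    rw [LinearMap.zero_apply]
    exact zero_mem _
  dv_gr := by
    intro h v q x hx
    split_ifs at hx ⊢
    · obtain ⟨y, hy, rfl⟩ := hx
      exact ⟨C.dv y, C.dv_gr hy, rfl⟩
    · obtain rfl : x = 0 := hx
      simp
  sh_gr := by
    intro h v q x hx
    split_ifs at hx with h0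
    · simp [h0]
    · obtain rfl : x = 0 := hx
      simp
  sv_gr := by
    intro h v q x hx
    split_ifs at hx with h0
    · obtain ⟨y, hy, rfl⟩ := hx
      change C.naiveKer.mkQ (C.sv y) = (v.negOnePow : ℤ) • C.naiveKer.mkQ y
      rw [C.sv_gr hy, map_zsmul]
    · obtain rfl : x = 0 := hx
      simp
  dh_dh _ := rfl
  dv_dv x := by
    obtain ⟨x, rfl⟩ := C.naiveKer.mkQ_surjective x
    change C.naiveKer.mkQ (C.dv (C.dv x)) = 0
    rw [C.dv_dv, map_zero]
  dh_dv _ := by simp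

/-- The natural map from a bicomplex to its naive complex. -/
def toNaive (C : Bicomplex k σ) : Hom C C.naive where
  toLin := C.naiveKer.mkQ
  map_gr := by
    intro h v q x hx
    change C.naiveKer.mkQ x ∈
      if h = 0 then (C.gr 0 v q).map C.naiveKer.mkQ.toAddMonoidHom else ⊥
    by_cases h0 : h = 0
    · subst h0
      rw [if_pos rfl]
      exact ⟨x, hx, rfl⟩
    · rw [if_neg h0]
      exact (Submodule.Quotient.mk_eq_zero C.naiveKer).2
        (Submodule.mem_sup_right (Submodule.subset_span ⟨h, v, q, h0, hx⟩))
  comm_dh x := (Submodule.Quotient.mk_eq_zero C.naiveKer).2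
    (Submodule.mem_sup_left (LinearMap.mem_range_self C.dh x))
  comm_dv _ := rfl

end Bicomplex

/-! ## Two-term Koszul complexes and crossings -/

section Local

variable {k : Type u} [Field k] {σ : Type}

/-- The horizontal complex `k[σ] → k[σ]` with the differential `x`, homogeneous of degree `1` in the
variables: the generator of horizontal degree `-1` is sent to `x` times the generator of horizontal
degree `0`, and both generators have polynomial degree `0`. -/
def koszul (x : MvPolynomial σ k) (hx : x.IsHomogeneous 1) : Bicomplex k σ :=
  Bicomplex.free (ι := Fin 2) ![0, -1] 0 0 !![0, x; 0, 0] 0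
    (by
      intro i j
      fin_cases i <;> fin_cases j <;> simp
      exact Or.inr hx)
    (by simp)
    (by ext i j; fin_cases i <;> fin_cases j <;> simp [Matrix.mul_apply])
    (by simp) (by simp)

/-- The matrix of the Koszul differential of a pair `(x, y)` in the basis `1, e₁, e₂, e₁e₂`:
`e₁ ↦ x`, `e₂ ↦ y`, `e₁e₂ ↦ x e₂ - y e₁`. -/
def koszulMatrix (x y : MvPolynomial σ k) : Matrix (Fin 4) (Fin 4) (MvPolynomial σ k) :=
  !![0, x, y, 0; 0, 0, 0, -y; 0, 0, 0, x; 0, 0, 0, 0]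

theorem koszulMatrix_sq (x y : MvPolynomial σ k) : koszulMatrix x y * koszulMatrix x y = 0 := by
  refine Matrix.ext fun i j => ?_
  fin_cases i <;> fin_cases j <;> simp [koszulMatrix, Matrix.mul_apply, Fin.sum_univ_four, mul_comm]

/-- The differential of `L'`, the Koszul complex of `(i + j - k - l, i j - k l)`. -/
def singularMatrix (i j k' l : σ) : Matrix (Fin 4) (Fin 4) (MvPolynomial σ k) :=
  koszulMatrix (X i + X j - X k' - X l) (X i * X j - X k' * X l)

/-- The differential of `L''`, the Koszul complex of `(i - l, j - k)`. -/
def smoothMatrix (i j k' l : σ) : Matrix (Fin 4) (Fin 4) (MvPolynomial σ k) :=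
  koszulMatrix (X i - X l) (X j - X k')

/-- The map `ρ⁺ : L' → L''`.  On cohomology in degree `0` it is the projection.  The homogeneous
chain maps with this property are exactly those below, one for each constant `μ`. -/
def rhoPos (μ : k) (i j k' l : σ) : Matrix (Fin 4) (Fin 4) (MvPolynomial σ k) :=
  !![1, 0, 0, 0;
     0, 1, X j - C μ * (X j - X k'), 0;
     0, 1, X l + C μ * (X i - X l), 0;
     0, 0, 0, X l - X j + C μ * (X i + X j - X k' - X l)]

/-- The map `ρ⁻ : L'' → L'{-2}`.  On cohomology in degree `0` it is the multiplication by `i - k`.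
The homogeneous chain maps with this property are exactly those below, one for each constant
`ν`. -/
def rhoNeg (ν : k) (i j k' l : σ) : Matrix (Fin 4) (Fin 4) (MvPolynomial σ k) :=
  !![X i - X k' + C ν * (X i + X j - X k' - X l), 0, 0, 0;
     0, X i + C ν * (X i - X l), -X k' + C ν * (X j - X k'), 0;
     0, -1, 1, 0;
     0, 0, 0, 1]

theorem rhoPos_comm (μ : k) (i j k' l : σ) :
    smoothMatrix i j k' l * rhoPos μ i j k' l = rhoPos μ i j k' l * singularMatrix i j k' l := by
  refine Matrix.ext fun a b => ?_
  fin_cases a <;> fin_cases b <;>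
    simp [smoothMatrix, singularMatrix, koszulMatrix, rhoPos, Matrix.mul_apply,
      Fin.sum_univ_four] <;> ring

theorem rhoNeg_comm (ν : k) (i j k' l : σ) :
    singularMatrix i j k' l * rhoNeg ν i j k' l = rhoNeg ν i j k' l * smoothMatrix i j k' l := by
  refine Matrix.ext fun a b => ?_
  fin_cases a <;> fin_cases b <;>
    simp [smoothMatrix, singularMatrix, koszulMatrix, rhoNeg, Matrix.mul_apply,
      Fin.sum_univ_four] <;> ring

/-- Horizontal degrees of the Koszul basis `1, e₁, e₂, e₁e₂`. -/
def koszulDeg : Fin 4 → ℤ := ![0, -1, -1, -2]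

theorem hom_sub (i j : σ) : (X i - X j : MvPolynomial σ k).IsHomogeneous 1 :=
  (isHomogeneous_X k i).sub (isHomogeneous_X k j)

theorem hom_lin (i j k' l : σ) : (X i + X j - X k' - X l : MvPolynomial σ k).IsHomogeneous 1 :=
  (((isHomogeneous_X k i).add (isHomogeneous_X k j)).sub (isHomogeneous_X k k')).sub
    (isHomogeneous_X k l)

theorem hom_quad (i j k' l : σ) : (X i * X j - X k' * X l : MvPolynomial σ k).IsHomogeneous 2 :=
  ((isHomogeneous_X k i).mul (isHomogeneous_X k j)).sub
    ((isHomogeneous_X k k').mul (isHomogeneous_X k l))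

theorem singularMatrix_deg (c : ℤ) (i j k' l : σ) (a b : Fin 4) :
    (singularMatrix i j k' l a b : MvPolynomial σ k) = 0 ∨ koszulDeg a = koszulDeg b + 1 ∧
      ∃ n : ℕ, (singularMatrix i j k' l a b : MvPolynomial σ k).IsHomogeneous n ∧
        ![c, c, c + 2, c + 2] b + 2 = ![c, c, c + 2, c + 2] a + 2 * n := by
  have h1 := hom_lin (k := k) i j k' l
  have h2 := hom_quad (k := k) i j k' l
  fin_cases a <;> fin_cases b <;>
    first
    | exact Or.inl rfl
    | exact Or.inr ⟨rfl, 1, h1, by simp⟩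
    | exact Or.inr ⟨rfl, 2, h2, by simp; ring⟩
    | exact Or.inr ⟨rfl, 2, h2.neg, by simp; ring⟩

theorem smoothMatrix_deg (i j k' l : σ) (a b : Fin 4) :
    (smoothMatrix i j k' l a b : MvPolynomial σ k) = 0 ∨ koszulDeg a = koszulDeg b + 1 ∧
      ∃ n : ℕ, (smoothMatrix i j k' l a b : MvPolynomial σ k).IsHomogeneous n ∧
        (0 : ℤ) + 2 = 0 + 2 * n := by
  have h1 := hom_sub (k := k) i l
  have h2 := hom_sub (k := k) j k'
  fin_cases a <;> fin_cases b <;>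
    first
    | exact Or.inl rfl
    | exact Or.inr ⟨rfl, 1, h1, by simp⟩
    | exact Or.inr ⟨rfl, 1, h2, by simp⟩
    | exact Or.inr ⟨rfl, 1, h2.neg, by simp⟩

theorem rhoPos_deg (μ : k) (i j k' l : σ) (a b : Fin 4) :
    rhoPos μ i j k' l a b = 0 ∨ koszulDeg a = koszulDeg b ∧
      ∃ n : ℕ, (rhoPos μ i j k' l a b).IsHomogeneous n ∧
        (![0, 0, 2, 2] b : ℤ) + 0 = 0 + 2 * n := by
  have h1 := (hom_lin (k := k) i j k' l).C_mul μ
  have h2 := (isHomogeneous_X k j).sub ((hom_sub (k := k) j k').C_mul μ)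
  have h3 := (isHomogeneous_X k l).add ((hom_sub (k := k) i l).C_mul μ)
  have h4 := (hom_sub (k := k) l j).add h1
  have h0 := isHomogeneous_one σ k
  fin_cases a <;> fin_cases b <;>
    first
    | exact Or.inl rfl
    | exact Or.inr ⟨rfl, 0, h0, by simp⟩
    | exact Or.inr ⟨rfl, 1, h2, by simp⟩
    | exact Or.inr ⟨rfl, 1, h3, by simp⟩
    | exact Or.inr ⟨rfl, 1, h4, by simp⟩

theorem rhoNeg_deg (ν : k) (i j k' l : σ) (a b : Fin 4) :
    rhoNeg ν i j k' l a b = 0 ∨ koszulDeg a = koszulDeg b ∧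
      ∃ n : ℕ, (rhoNeg ν i j k' l a b).IsHomogeneous n ∧
        (0 : ℤ) + 0 = ![-2, -2, 0, 0] a + 2 * n := by
  have h1 := (hom_sub (k := k) i k').add ((hom_lin (k := k) i j k' l).C_mul ν)
  have h2 := (isHomogeneous_X k i).add ((hom_sub (k := k) i l).C_mul ν)
  have h3 := (isHomogeneous_X k k').neg.add ((hom_sub (k := k) j k').C_mul ν)
  have h0 := isHomogeneous_one σ k
  fin_cases a <;> fin_cases b <;>
    first
    | exact Or.inl rfl
    | exact Or.inr ⟨rfl, 0, h0, by simp⟩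
    | exact Or.inr ⟨rfl, 0, h0.neg, by simp⟩
    | exact Or.inr ⟨rfl, 1, h1, by simp⟩
    | exact Or.inr ⟨rfl, 1, h2, by simp⟩
    | exact Or.inr ⟨rfl, 1, h3, by simp⟩

/-- The complex `ρ⁺ : L' → L''` of a positive crossing, with `L''` in vertical degree `0`. -/
def posCrossing (μ : k) (i j k' l : σ) : Bicomplex k σ :=
  Bicomplex.free (ι := Fin 4 ⊕ Fin 4) (Sum.elim koszulDeg koszulDeg)
    (Sum.elim (fun _ => -1) (fun _ => 0)) (Sum.elim ![0, 0, 2, 2] 0)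
    (Matrix.fromBlocks (singularMatrix i j k' l) 0 0 (smoothMatrix i j k' l))
    (Matrix.fromBlocks 0 0 (rhoPos μ i j k' l) 0)
    (by
      rintro (a | a) (b | b)
      · rcases singularMatrix_deg (k := k) 0 i j k' l a b with h | ⟨h1, n, h2, h3⟩
        · exact Or.inl h
        · exact Or.inr ⟨h1, by simp, n, h2, by simpa using h3⟩
      · exact Or.inl rfl
      · exact Or.inl rfl
      · rcases smoothMatrix_deg (k := k) i j k' l a b with h | ⟨h1, n, h2, h3⟩
        · exact Or.inl h
        · exact Or.inr ⟨h1, by simp, n, h2, h3⟩)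
    (by
      rintro (a | a) (b | b)
      · exact Or.inl rfl
      · exact Or.inl rfl
      · rcases rhoPos_deg μ i j k' l a b with h | ⟨h1, n, h2, h3⟩
        · exact Or.inl h
        · exact Or.inr ⟨by simp [h1], by simp, n, h2, h3⟩
      · exact Or.inl rfl)
    (by simp [Matrix.fromBlocks_multiply, singularMatrix, smoothMatrix, koszulMatrix_sq])
    (by simp [Matrix.fromBlocks_multiply])
    (by simp [Matrix.fromBlocks_multiply, rhoPos_comm])

/-- The complex `ρ⁻ : L'' → L'{-2}` of a negative crossing, with `L''` in vertical degree `0`. -/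
def negCrossing (ν : k) (i j k' l : σ) : Bicomplex k σ :=
  Bicomplex.free (ι := Fin 4 ⊕ Fin 4) (Sum.elim koszulDeg koszulDeg)
    (Sum.elim (fun _ => 0) (fun _ => 1)) (Sum.elim 0 ![-2, -2, 0, 0])
    (Matrix.fromBlocks (smoothMatrix i j k' l) 0 0 (singularMatrix i j k' l))
    (Matrix.fromBlocks 0 0 (rhoNeg ν i j k' l) 0)
    (by
      rintro (a | a) (b | b)
      · rcases smoothMatrix_deg (k := k) i j k' l a b with h | ⟨h1, n, h2, h3⟩
        · exact Or.inl h
        · exact Or.inr ⟨h1, by simp, n, h2, h3⟩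
      · exact Or.inl rfl
      · exact Or.inl rfl
      · rcases singularMatrix_deg (k := k) (-2) i j k' l a b with h | ⟨h1, n, h2, h3⟩
        · exact Or.inl h
        · exact Or.inr ⟨h1, by simp, n, h2, by simpa using h3⟩)
    (by
      rintro (a | a) (b | b)
      · exact Or.inl rfl
      · exact Or.inl rfl
      · rcases rhoNeg_deg ν i j k' l a b with h | ⟨h1, n, h2, h3⟩
        · exact Or.inl h
        · exact Or.inr ⟨by simp [h1], by simp, n, h2, h3⟩
      · exact Or.inl rfl)
    (by simp [Matrix.fromBlocks_multiply, singularMatrix, smoothMatrix, koszulMatrix_sq])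
    (by simp [Matrix.fromBlocks_multiply])
    (by simp [Matrix.fromBlocks_multiply, rhoNeg_comm])

end Local

/-! ## Tangle diagrams and planar arc diagrams -/

/-- A finite totally ordered set of signed points on a circle, in the order in which they are met
starting from the distinguished point. -/
structure SignedPoints where
  n : ℕ
  sign : Fin n → ℤˣ

namespace SignedPoints

/-- The points of sign `+1`. -/
abbrev Pos (P : SignedPoints) : Type := {x : Fin P.n // P.sign x = 1}

/-- The points of sign `-1`. -/
abbrev Neg (P : SignedPoints) : Type := {x : Fin P.n // ¬P.sign x = 1}

end SignedPoints

/-- The flags at which an edge starts, in a diagram with the crossings `Γ` and the endpoints `P`: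
the two outgoing flags of each crossing, and the endpoints of sign `-1`. -/
def Source (Γ : Type) (P : SignedPoints) : Type := (Γ × Fin 2) ⊕ P.Neg

/-- The flags at which an edge ends: the two incoming flags of each crossing, and the endpoints of
sign `+1`. -/
def Target (Γ : Type) (P : SignedPoints) : Type := (Γ × Fin 2) ⊕ P.Pos

instance (Γ : Type) [Fintype Γ] (P : SignedPoints) : Fintype (Source Γ P) :=
  inferInstanceAs (Fintype ((Γ × Fin 2) ⊕ P.Neg))

instance (Γ : Type) [LinearOrder Γ] (P : SignedPoints) : LinearOrder (Source Γ P) :=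
  inferInstanceAs (LinearOrder ((Γ ×ₗ Fin 2) ⊕ₗ P.Neg))

/-- The combinatorial data of an oriented tangle diagram in a disk with the endpoints `P`: its
crossings with their signs, its oriented edges, and the number of closed components without
crossings.

An endpoint has the sign `+1` if its edge is directed into it (out of the tangle) and the sign `-1`
if its edge is directed out of it.  The two outgoing flags of a crossing `c` are `(c, 0)` (left) and
`(c, 1)` (right) among the sources; the two incoming flags are `(c, 0)` (right) and `(c, 1)` (left)
among the targets.  Thus the two strands through `c` lead from the incoming flag `(c, 0)` to the
outgoing flag `(c, 0)` and from the incoming flag `(c, 1)` to the outgoing flag `(c, 1)`, while the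
oriented smoothing of `c` joins the incoming flag `(c, 1)` to the outgoing flag `(c, 0)` and the
incoming flag `(c, 0)` to the outgoing flag `(c, 1)`.

An edge is given by its first flag `s`, and `next s` is its last flag.  The definition of the
complexes below uses nothing else; in particular planarity of the diagram is not required. -/
structure Tangle (P : SignedPoints) where
  Crossing : Type
  [fintype : Fintype Crossing]
  [linearOrder : LinearOrder Crossing]
  sign : Crossing → ℤˣ
  next : Source Crossing P ≃ Target Crossing P
  circles : ℕ

attribute [instance] Tangle.fintype Tangle.linearOrder

section Arc

variable {m : ℕ}

/-- The points at which an arc of an arc diagram starts, where `P₀` are the points on the outer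
boundary and `P i` those on the boundary of the `i`-th hole. -/
def Tail (P₀ : SignedPoints) (P : Fin m → SignedPoints) : Type := P₀.Neg ⊕ (Σ i, (P i).Pos)

/-- The points at which an arc of an arc diagram ends. -/
def Head (P₀ : SignedPoints) (P : Fin m → SignedPoints) : Type := P₀.Pos ⊕ (Σ i, (P i).Neg)

instance (P₀ : SignedPoints) (P : Fin m → SignedPoints) : Fintype (Tail P₀ P) :=
  inferInstanceAs (Fintype (P₀.Neg ⊕ (Σ i, (P i).Pos)))

instance (P₀ : SignedPoints) (P : Fin m → SignedPoints) : LinearOrder (Tail P₀ P) :=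
  inferInstanceAs (LinearOrder (P₀.Neg ⊕ₗ (Σₗ i, (P i).Pos)))

/-- The combinatorial data of an oriented planar arc diagram with `m` ordered holes: every marked
point of the outer boundary and of the boundaries of the holes is an end of exactly one arc, and
`arc` sends the tail of an arc to its head.  The signs on the boundary of a hole are those of the
tangles that fit into the hole. -/
structure ArcDiagram (P₀ : SignedPoints) (P : Fin m → SignedPoints) where
  arc : Tail P₀ P ≃ Head P₀ P

end Arc

/-! ### Gluing -/

/-- Singles out the first of `n + 1` marks. -/
def splitMark (D : Type) (n : ℕ) : D ⊕ Fin (n + 1) ≃ Option (D ⊕ Fin n) where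
  toFun := Sum.elim (fun d => some (.inl d)) fun x => (finSuccEquiv n x).map .inr
  invFun
    | none => .inr 0
    | some (.inl d) => .inl d
    | some (.inr x) => .inr x.succ
  left_inv := by
    rintro (d | x)
    · rfl
    · cases x using Fin.cases <;> rfl
  right_inv := by rintro (_ | d | x) <;> rfl

/-- `e` describes oriented edges from sources in `A` and from `n` bivalent marks to targets in `B`
and to the same `n` marks.  The marks are erased one after the other: the edge that ends at a mark
and the edge that starts there are joined, and if they are the same edge, then a closed component
arises.  The result is the remaining matching of `A` with `B` and the number of the closed
components. -/
def eraseMarks {A B : Type} : (n : ℕ) → (A ⊕ Fin n ≃ B ⊕ Fin n) → (A ≃ B) × ℕ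
  | 0, e => (((Equiv.sumEmpty A (Fin 0)).symm.trans e).trans (Equiv.sumEmpty B (Fin 0)), 0)
  | n + 1, e =>
    let e' : Option (A ⊕ Fin n) ≃ Option (B ⊕ Fin n) :=
      ((splitMark A n).symm.trans e).trans (splitMark B n)
    let r := eraseMarks n e'.removeNone
    (r.1, r.2 + if (e' none).isNone then 1 else 0)

/-- A bookkeeping bijection: the flags of the diagrams with the crossings `Γ i` and the ends of the
arcs are the crossing flags and the outer ends `Y` together with the marks, that is, the
points on the holes. -/
def regroup {m : ℕ} (Γ S S' : Fin m → Type) (Y : Type) :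
    (((Σ i, Γ i) × Fin 2) ⊕ Y) ⊕ ((Σ i, S i) ⊕ (Σ i, S' i)) ≃
      (Σ i, (Γ i × Fin 2) ⊕ S' i) ⊕ (Y ⊕ (Σ i, S i)) where
  toFun
    | .inl (.inl (⟨i, c⟩, b)) => .inl ⟨i, .inl (c, b)⟩
    | .inl (.inr y) => .inr (.inl y)
    | .inr (.inl s) => .inr (.inr s)
    | .inr (.inr ⟨i, s⟩) => .inl ⟨i, .inr s⟩
  invFun
    | .inl ⟨i, .inl (c, b)⟩ => .inl (.inl (⟨i, c⟩, b))
    | .inl ⟨i, .inr s⟩ => .inr (.inr ⟨i, s⟩)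
    | .inr (.inl y) => .inl (.inr y)
    | .inr (.inr s) => .inr (.inl s)
  left_inv := by rintro ((⟨⟨i, c⟩, b⟩ | y) | (s | ⟨i, s⟩)) <;> rfl
  right_inv := by rintro (⟨i, (⟨c, b⟩ | s)⟩ | (y | s)) <;> rfl

namespace ArcDiagram

variable {m : ℕ} {P₀ : SignedPoints} {P : Fin m → SignedPoints}

/-- The points on the boundaries of the holes. -/
abbrev Mark (P : Fin m → SignedPoints) : Type := (Σ i, (P i).Pos) ⊕ (Σ i, (P i).Neg)

/-- The edges of the tangle diagrams `T i` and the arcs of `η`, with the points on the boundaries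
of the holes as marks. -/
def markedEdges (η : ArcDiagram P₀ P) (T : ∀ i, Tangle (P i)) :
    (((Σ i, (T i).Crossing) × Fin 2) ⊕ P₀.Neg) ⊕ Mark P ≃
      (((Σ i, (T i).Crossing) × Fin 2) ⊕ P₀.Pos) ⊕ Mark P :=
  let src : (((Σ i, (T i).Crossing) × Fin 2) ⊕ P₀.Neg) ⊕ Mark P ≃
      (Σ i, Source (T i).Crossing (P i)) ⊕ Tail P₀ P :=
    regroup (fun i => (T i).Crossing) (fun i => (P i).Pos) (fun i => (P i).Neg) P₀.Neg
  let tgt : (((Σ i, (T i).Crossing) × Fin 2) ⊕ P₀.Pos) ⊕ ((Σ i, (P i).Neg) ⊕ (Σ i, (P i).Pos)) ≃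
      (Σ i, Target (T i).Crossing (P i)) ⊕ Head P₀ P :=
    regroup (fun i => (T i).Crossing) (fun i => (P i).Neg) (fun i => (P i).Pos) P₀.Pos
  ((src.trans ((Equiv.sigmaCongrRight fun i => (T i).next).sumCongr η.arc)).trans tgt.symm).trans
    ((Equiv.refl _).sumCongr (Equiv.sumComm _ _))

/-- The tangle diagram `η̃({T i})`, obtained by pasting `T i` into the `i`-th hole of `η`. -/
def glue (η : ArcDiagram P₀ P) (T : ∀ i, Tangle (P i)) : Tangle P₀ :=
  let marks := Fintype.equivFin (Mark P)
  let r := eraseMarks (Fintype.card (Mark P))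
    ((((Equiv.refl _).sumCongr marks.symm).trans (η.markedEdges T)).trans
      ((Equiv.refl _).sumCongr marks))
  { Crossing := Σₗ i, (T i).Crossing
    fintype := inferInstanceAs (Fintype (Σ i, (T i).Crossing))
    sign := fun c => (T (ofLex c).1).sign (ofLex c).2
    next := r.1
    circles := (∑ i, (T i).circles) + r.2 }

end ArcDiagram

/-! ## The complexes -/

namespace Tangle

variable {P : SignedPoints}

/-- The variables `t_{x, e}`: one for every flag, and one for every closed component without
crossings. -/
abbrev Var (T : Tangle P) : Type := Source T.Crossing P ⊕ Target T.Crossing P ⊕ Fin T.circles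

/-- The variable of a flag at which an edge starts. -/
def src (T : Tangle P) (s : Source T.Crossing P) : T.Var := .inl s

/-- The variable of a flag at which an edge ends. -/
def tgt (T : Tangle P) (t : Target T.Crossing P) : T.Var := .inr (.inl t)

/-- The variable of an endpoint. -/
def endVar (T : Tangle P) (x : Fin P.n) : T.Var :=
  if h : P.sign x = 1 then T.tgt (.inr ⟨x, h⟩) else T.src (.inr ⟨x, h⟩)

/-- The tensor factors: closed components without crossings, edges, and crossings. -/
def Factor (T : Tangle P) : Type := Fin T.circles ⊕ Source T.Crossing P ⊕ T.Crossing

instance (T : Tangle P) : Fintype T.Factor :=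
  inferInstanceAs (Fintype (Fin T.circles ⊕ Source T.Crossing P ⊕ T.Crossing))

instance (T : Tangle P) : LinearOrder T.Factor :=
  inferInstanceAs (LinearOrder (Fin T.circles ⊕ₗ (Source T.Crossing P ⊕ₗ T.Crossing)))

variable {k : Type u} [Field k]

/-- The factors of the Khovanov-Rozansky complex.  A closed component without crossings is regarded
as an edge from a mark to itself, with the single variable `t` and the Koszul differential
`t - t = 0`. -/
def factor (μ ν : k) (T : Tangle P) : T.Factor → Bicomplex k T.Var
  | .inl _ => koszul 0 (isHomogeneous_zero _ _ _)
  | .inr (.inl s) => koszul (X (T.src s) - X (T.tgt (T.next s))) (hom_sub _ _)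
  | .inr (.inr c) =>
    if T.sign c = 1 then
      posCrossing μ (T.src (.inl (c, 0))) (T.src (.inl (c, 1)))
        (T.tgt (.inl (c, 0))) (T.tgt (.inl (c, 1)))
    else
      negCrossing ν (T.src (.inl (c, 0))) (T.src (.inl (c, 1)))
        (T.tgt (.inl (c, 0))) (T.tgt (.inl (c, 1)))

/-- The bicomplex `KR₀(T) = (⨂ L_e) ⊗ (⨂ L_x)` over the ring generated by the variables of the
endpoints of `T`.  The constants `μ` and `ν` are those in the maps `ρ⁺` and `ρ⁻`. -/
def KR₀ (μ ν : k) (T : Tangle P) : Bicomplex k (Fin P.n) :=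
  (Bicomplex.tensor (T.factor μ ν)).restrict T.endVar

end Tangle

namespace ArcDiagram

variable {m : ℕ} {P₀ : SignedPoints} {P : Fin m → SignedPoints}

/-- The variables of the ring `k[P₀, P 0, …, P (m - 1)]`. -/
abbrev Var (P₀ : SignedPoints) (P : Fin m → SignedPoints) : Type :=
  Fin P₀.n ⊕ (Σ i, Fin (P i).n)

/-- The variable at the tail of an arc. -/
def tailVar : Tail P₀ P → Var P₀ P
  | .inl x => .inl x.1
  | .inr ⟨i, x⟩ => .inr ⟨i, x.1⟩

/-- The variable at the head of an arc. -/
def headVar : Head P₀ P → Var P₀ P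
  | .inl x => .inl x.1
  | .inr ⟨i, x⟩ => .inr ⟨i, x.1⟩

/-- The tensor factors in the action of an arc diagram: arcs and holes. -/
def Factor (P₀ : SignedPoints) (P : Fin m → SignedPoints) : Type := Tail P₀ P ⊕ Fin m

instance : Fintype (Factor P₀ P) := inferInstanceAs (Fintype (Tail P₀ P ⊕ Fin m))

instance : LinearOrder (Factor P₀ P) := inferInstanceAs (LinearOrder (Tail P₀ P ⊕ₗ Fin m))

variable {k : Type u} [Field k]

/-- The factors in the action of `η`, over `k[P₀, P 0, …, P (m - 1)]`: the complexes
`t_{head} - t_{tail}` of the arcs, whose product is the Koszul complex of `η`, and the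
extensions of scalars of the given bicomplexes. -/
def factor (η : ArcDiagram P₀ P) (C : ∀ i, Bicomplex k (Fin (P i).n)) :
    Factor P₀ P → Bicomplex k (Var P₀ P)
  | .inl a => koszul (X (headVar (η.arc a)) - X (tailVar a)) (hom_sub _ _)
  | .inr i => (C i).extend fun x => .inr ⟨i, x⟩

/-- The canopolis action of `η` on bicomplexes: the tensor product, over
`k[P 0, …, P (m - 1)]`, of the Koszul complex of `η` with `⨂ C i`, as a bicomplex
over `k[P₀]`. -/
def act (η : ArcDiagram P₀ P) (C : ∀ i, Bicomplex k (Fin (P i).n)) : Bicomplex k (Fin P₀.n) :=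
  (Bicomplex.tensor (η.factor C)).restrict Sum.inl

/-- The action of `η` on morphisms. -/
def actMap (η : ArcDiagram P₀ P) {C D : ∀ i, Bicomplex k (Fin (P i).n)}
    (f : ∀ i, Bicomplex.Hom (C i) (D i)) : Bicomplex.Hom (η.act C) (η.act D) :=
  Bicomplex.restrictMap _ (Bicomplex.tensorMap fun
    | .inl a => Bicomplex.Hom.id (η.factor C (.inl a))
    | .inr i => Bicomplex.extendMap _ (f i))

end ArcDiagram

end

end KRTangle

/-! Both sides of the first claim are iterated tensor products of finite free bicomplexes over
polynomial rings. Each can therefore be written in coordinates, as functions on the product of the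
bases of all factors with a total differential that carries Koszul signs (`Loc.prod`). In this form
factors can be reordered and relabelled, variables renamed, scalars extended, and nested tensor
products flattened (`prodReindex`, `prodRename`, `extendProd`, `tensorProd`). Written out, the
action of `η` on the complexes of the `T i` is the complex of the pasted diagram in which every
point on a hole is kept as a bivalent mark with a variable of its own (`actDiagIso`). The complex of
the pasted tangle is the one in which the marks are erased.

It remains to erase one mark, with the variable `t`. If two different edges meet there, their Koszul
complexes are those of `t - a` and `t - b` up to sign, and `t` occurs in no other factor. Over
`R[t]` the complex of `t - a` contracts to `R`: substitute `a` for `t`, with the homotopy that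
divides `p - p(a)` by `t - a`. This is `R`-linear, so it is compatible with the differentials of all
other factors, the vertical ones included, and `t - b` becomes `a - b`, the joined edge
(`htpyEquiv_withEdge`). If a single edge runs from the mark to itself, its differential is `t - t =
0`, which is the factor of a circle (`circleIso`). The induction over the marks is
`htpyEquiv_eraseMarks`.

For the second claim, being a term-wise quasi-isomorphism is restated as exactness of the mapping
cone of the whole horizontal complex (`ConeExact`). Homotopy equivalences have exact cones and exact
cones compose, so only the map `actMap` induced by the projections needs an argument
(`actMap_coneExact`). Its factors are exchanged one hole at a time. While the hole `i` is treated,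
the other factors form a module `W`. It may contain naive complexes, for which no flatness is known
over their own rings, but these involve only the variables of other holes, and the arcs are free. So
`W` is extended from the polynomial ring in the variables outside of the hole `i`; since the ring in
all variables is the tensor product over the field `k` of that ring with `k[P i]`, the module `W` is
flat over `k[P i]` (`IsExtended.flat`), and tensoring keeps the cone exact. The passage from the
differential of one factor to the total differential uses the bounded grading by the horizontal
degree of the other factors (`exact_add_of_graded`). -/

namespace KRTangle
noncomputable section
-- Isomorphisms and homotopy equivalences of bicomplexes.
namespace Bicomplex

variable {k : Type u} [Field k] {σ τ υ : Type}

/-- Isomorphisms of bicomplexes. -/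
structure Iso (C D : Bicomplex k σ) where
  hom : Hom C D
  inv : Hom D C
  hom_inv : ∀ x, inv.toLin (hom.toLin x) = x
  inv_hom : ∀ y, hom.toLin (inv.toLin y) = y

namespace Iso

variable {C D E : Bicomplex k σ}

def symm (e : Iso C D) : Iso D C := ⟨e.inv, e.hom, e.inv_hom, e.hom_inv⟩

def trans (e : Iso C D) (e' : Iso D E) : Iso C E where
  hom := e'.hom.comp e.hom
  inv := e.inv.comp e'.inv
  hom_inv x := by simp [Hom.comp, e'.hom_inv, e.hom_inv]
  inv_hom x := by simp [Hom.comp, e'.inv_hom, e.inv_hom]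

/-- A bijective morphism whose inverse respects the gradings is an isomorphism. -/
def ofBijective (f : Hom C D) (hf : Function.Bijective f.toLin)
    (hgr : ∀ h v q x, f.toLin x ∈ D.gr h v q → x ∈ C.gr h v q) : Iso C D :=
  let e := LinearEquiv.ofBijective f.toLin hf
  have he : ∀ y, f.toLin (e.symm y) = y := e.apply_symm_apply
  { hom := f
    inv :=
      { toLin := e.symm.toLinearMap
        map_gr := fun {h v q y} hy => hgr _ _ _ _ (by
          change f.toLin (e.symm y) ∈ _
          rwa [he])
        comm_dh := fun y => hf.1 (by
          change f.toLin (e.symm (D.dh y)) = f.toLin (C.dh (e.symm y))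
          rw [he, f.comm_dh, he])
        comm_dv := fun y => hf.1 (by
          change f.toLin (e.symm (D.dv y)) = f.toLin (C.dv (e.symm y))
          rw [he, f.comm_dv, he]) }
    hom_inv := e.symm_apply_apply
    inv_hom := he }

/-- Restriction of scalars on isomorphisms. -/
def restrict (φ : τ → σ) (e : Iso C D) : Iso (C.restrict φ) (D.restrict φ) :=
  ⟨restrictMap φ e.hom, restrictMap φ e.inv, e.hom_inv, e.inv_hom⟩

/-- Extension of scalars on isomorphisms. -/
def extend (φ : σ → τ) (e : Iso C D) : Iso (C.extend φ) (D.extend φ) where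
  hom := extendMap φ e.hom
  inv := extendMap φ e.inv
  hom_inv x := by
    letI := renameAlgebra k φ
    change (e.inv.toLin.baseChange _ ∘ₗ e.hom.toLin.baseChange _) x = x
    rw [← LinearMap.baseChange_comp, show e.inv.toLin ∘ₗ e.hom.toLin = LinearMap.id from
      LinearMap.ext e.hom_inv, LinearMap.baseChange_id]
    rfl
  inv_hom x := by
    letI := renameAlgebra k φ
    change (e.hom.toLin.baseChange _ ∘ₗ e.inv.toLin.baseChange _) x = x
    rw [← LinearMap.baseChange_comp, show e.hom.toLin ∘ₗ e.inv.toLin = LinearMap.id from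
      LinearMap.ext e.inv_hom, LinearMap.baseChange_id]
    rfl

/-- Tensor products of isomorphisms. -/
def tensor {ι : Type} [Fintype ι] [LinearOrder ι] {C D : ι → Bicomplex k σ}
    (e : ∀ i, Iso (C i) (D i)) : Iso (Bicomplex.tensor C) (Bicomplex.tensor D) where
  hom := tensorMap fun i => (e i).hom
  inv := tensorMap fun i => (e i).inv
  hom_inv x := by
    change (PiTensorProduct.map _ ∘ₗ PiTensorProduct.map _) x = x
    rw [← PiTensorProduct.map_comp]
    rw [show (fun i => (e i).inv.toLin ∘ₗ (e i).hom.toLin) = fun i => LinearMap.id from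
      funext fun i => LinearMap.ext (e i).hom_inv, PiTensorProduct.map_id]
    rfl
  inv_hom x := by
    change (PiTensorProduct.map _ ∘ₗ PiTensorProduct.map _) x = x
    rw [← PiTensorProduct.map_comp]
    rw [show (fun i => (e i).hom.toLin ∘ₗ (e i).inv.toLin) = fun i => LinearMap.id from
      funext fun i => LinearMap.ext (e i).inv_hom, PiTensorProduct.map_id]
    rfl

end Iso

/-- Restriction of scalars in two steps. -/
def restrictRestrict (φ : σ → τ) (ψ : τ → υ) (C : Bicomplex k υ) :
    Iso (restrict φ (restrict ψ C)) (restrict (ψ ∘ φ) C) :=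
  have key : ∀ (r : MvPolynomial σ k) (x : C.M),
      rename ψ (rename φ r) • x = rename (ψ ∘ φ) r • x := fun r x => by rw [rename_rename]
  { hom :=
      { toLin :=
          { toFun := fun x : C.M => x
            map_add' := fun _ _ => rfl
            map_smul' := key }
        map_gr := fun hx => hx
        comm_dh := fun _ => rfl
        comm_dv := fun _ => rfl }
    inv :=
      { toLin :=
          { toFun := fun x : C.M => x
            map_add' := fun _ _ => rfl
            map_smul' := fun r x => (key r x).symm }
        map_gr := fun hx => hx
        comm_dh := fun _ => rfl
        comm_dv := fun _ => rfl }
    hom_inv := fun _ => rfl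
    inv_hom := fun _ => rfl }

/-- Homotopy equivalence of bicomplexes. -/
def HtpyEquiv (C D : Bicomplex k σ) : Prop := ∃ f : Hom C D, f.IsHomotopyEquiv

namespace Hom

variable {C D E F : Bicomplex k σ}

theorem Homotopic.of_eq {f g : Hom C D} (h : ∀ x, f.toLin x = g.toLin x) : f.Homotopic g :=
  ⟨0, fun _ => zero_mem _, fun _ => by simp, fun x => by simp [h]⟩

theorem Homotopic.trans {f g h : Hom C D} (hfg : f.Homotopic g) (hgh : g.Homotopic h) :
    f.Homotopic h := by
  obtain ⟨H, H1, H2, H3⟩ := hfg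
  obtain ⟨K, K1, K2, K3⟩ := hgh
  refine ⟨H + K, fun hx => add_mem (H1 hx) (K1 hx), fun x => by simp [H2, K2], fun x => ?_⟩
  rw [← sub_add_sub_cancel _ (g.toLin x), H3, K3]
  simp only [LinearMap.add_apply, map_add]
  abel

theorem Homotopic.comp_left {f g : Hom C D} (p : Hom D E) (h : f.Homotopic g) :
    (p.comp f).Homotopic (p.comp g) := by
  obtain ⟨H, H1, H2, H3⟩ := h
  refine ⟨p.toLin ∘ₗ H, fun hx => p.map_gr (H1 hx), fun x => by simp [H2, p.comm_dv],
    fun x => ?_⟩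
  simp only [comp, LinearMap.comp_apply]
  rw [← map_sub, H3, map_add, p.comm_dh]

theorem Homotopic.comp_right {f g : Hom D E} (p : Hom C D) (h : f.Homotopic g) :
    (f.comp p).Homotopic (g.comp p) := by
  obtain ⟨H, H1, H2, H3⟩ := h
  refine ⟨H ∘ₗ p.toLin, fun hx => H1 (p.map_gr hx), fun x => by simp [H2, p.comm_dv],
    fun x => ?_⟩
  simp only [comp, LinearMap.comp_apply]
  rw [H3, p.comm_dh]

end Hom

variable {C D E : Bicomplex k σ}

theorem Iso.htpyEquiv (e : Iso C D) : HtpyEquiv C D :=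
  ⟨e.hom, e.inv, .of_eq e.hom_inv, .of_eq e.inv_hom⟩

theorem HtpyEquiv.symm (h : HtpyEquiv C D) : HtpyEquiv D C := by
  obtain ⟨f, g, h1, h2⟩ := h
  exact ⟨g, f, h2, h1⟩

theorem HtpyEquiv.trans (h : HtpyEquiv C D) (h' : HtpyEquiv D E) : HtpyEquiv C E := by
  obtain ⟨f, g, h1, h2⟩ := h
  obtain ⟨f', g', h1', h2'⟩ := h'
  exact ⟨f'.comp f, g.comp g', ((h1'.comp_right f).comp_left g).trans h1,
    ((h2.comp_right g').comp_left f').trans h2'⟩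

theorem HtpyEquiv.restrict (φ : τ → σ) (h : HtpyEquiv C D) :
    HtpyEquiv (C.restrict φ) (D.restrict φ) := by
  have key : ∀ {C D : Bicomplex k σ} {f g : Hom C D}, f.Homotopic g →
      (restrictMap φ f).Homotopic (restrictMap φ g) := by
    rintro C D f g ⟨H, H1, H2, H3⟩
    exact ⟨{ toFun := H
             map_add' := fun (x y : C.M) => H.map_add x y
             map_smul' := fun r (x : C.M) => H.map_smul (rename φ r) x }, H1, H2, H3⟩
  obtain ⟨f, g, h1, h2⟩ := h
  exact ⟨restrictMap φ f, restrictMap φ g, key h1, key h2⟩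

end Bicomplex
end
end KRTangle

namespace KRTangle
noncomputable section

/-! ### Multi-Koszul operators on functions -/

/-- An irreflexive relation in which any two different elements are comparable in exactly one
direction. -/
structure IsTournament {F : Type} (r : F → F → Prop) : Prop where
  irrefl : ∀ i, ¬r i i
  total : ∀ i j, i ≠ j → (r i j ↔ ¬r j i)

/-- Transitivity of an order is never needed: the sign in a slot depends only on which slots lie
below it. Tournaments can be pulled back, summed lexicographically and extended by a least element
without constructing linear orders. -/
theorem isTournament_lt (F : Type) [LinearOrder F] :
    IsTournament (fun a b : F => a < b) where
  irrefl := lt_irrefl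
  total _ _ h := ⟨fun h' => h'.not_gt, fun h' => lt_of_le_of_ne (not_lt.1 h') h⟩

theorem negOnePow_sum {ι : Type} (t : Finset ι) (a : ι → ℤ) :
    ((∑ i ∈ t, a i).negOnePow : ℤ) = ∏ i ∈ t, ((a i).negOnePow : ℤ) := by
  classical
  induction t using Finset.induction_on with
  | empty => simp
  | insert i t hi ih =>
    rw [Finset.sum_insert hi, Finset.prod_insert hi, Int.negOnePow_add, Units.val_mul, ih]

theorem negOnePow_mul_self (a : ℤ) : (a.negOnePow : ℤ) * a.negOnePow = 1 := by
  rw [← Units.val_mul, Int.units_mul_self, Units.val_one]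

section Tot

variable {R : Type u} [CommRing R] {F : Type} [Fintype F] [DecidableEq F] (r : F → F → Prop)
  {ι : F → Type} [∀ f, Fintype (ι f)]

open Classical in
/-- The product of the signs `s l (x l)` over all `l` below `i`. -/
def sgnBelow (s : ∀ f, ι f → ℤ) (i : F) (x : ∀ f, ι f) : ℤ :=
  ∏ l, if r l i then s l (x l) else 1

theorem sgnBelow_update_of_not {s : ∀ f, ι f → ℤ} {i j : F} (h : ¬r j i) (x : ∀ f, ι f)
    (z : ι j) : sgnBelow r s i (Function.update x j z) = sgnBelow r s i x := by
  refine Finset.prod_congr rfl fun l _ => ?_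
  by_cases hl : l = j
  · subst hl; simp [h]
  · simp [hl]

/-- Only the factor of the slot `j` changes. The constant `c` is kept general: it will be `-1` for
an operator that raises the degree counted by `s`, and `1` for one that preserves it. -/
theorem sgnBelow_update_of_rel {s : ∀ f, ι f → ℤ} {i j : F} (h : r j i) (x : ∀ f, ι f)
    (z : ι j) {c : ℤ} (hc : s j z = c * s j (x j)) :
    sgnBelow r s i (Function.update x j z) = c * sgnBelow r s i x := by
  classical
  rw [sgnBelow, sgnBelow, ← Finset.mul_prod_erase _ _ (Finset.mem_univ j),
    ← Finset.mul_prod_erase (a := j) _ _ (Finset.mem_univ j), ← mul_assoc]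
  congr 1
  · simp [h, hc]
  · refine Finset.prod_congr rfl fun l hl => ?_
    simp [(Finset.mem_erase.1 hl).1]

/-- The operator `A i` acting on the slot `i`, with the signs of the slots below. -/
def totAt (s : ∀ f, ι f → ℤ) (A : ∀ f, Matrix (ι f) (ι f) R) (i : F) :
    ((∀ f, ι f) → R) →ₗ[R] ((∀ f, ι f) → R) where
  toFun g x := sgnBelow r s i x • ∑ z, A i (x i) z * g (Function.update x i z)
  map_add' g g' := by
    funext x
    simp [mul_add, Finset.sum_add_distrib]
  map_smul' c g := by
    funext x
    simp only [Pi.smul_apply, smul_eq_mul, RingHom.id_apply, Finset.mul_sum, mul_smul_comm]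
    congr 1
    exact Finset.sum_congr rfl fun _ _ => by ring

/-- The total operator of a family of operators on the slots. -/
def tot (s : ∀ f, ι f → ℤ) (A : ∀ f, Matrix (ι f) (ι f) R) :
    ((∀ f, ι f) → R) →ₗ[R] ((∀ f, ι f) → R) := ∑ i, totAt r s A i

theorem totAt_apply (s : ∀ f, ι f → ℤ) (A : ∀ f, Matrix (ι f) (ι f) R) (i : F)
    (g : (∀ f, ι f) → R) (x : ∀ f, ι f) :
    totAt r s A i g x = sgnBelow r s i x • ∑ z, A i (x i) z * g (Function.update x i z) := rfl

theorem tot_apply (s : ∀ f, ι f → ℤ) (A : ∀ f, Matrix (ι f) (ι f) R) (g : (∀ f, ι f) → R)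
    (x : ∀ f, ι f) :
    tot r s A g x = ∑ i, sgnBelow r s i x • ∑ z, A i (x i) z * g (Function.update x i z) := by
  rw [tot, LinearMap.sum_apply, Finset.sum_apply]
  rfl

-- Operators in different slots interact only through signs. If `i` lies below `j`, the sign of the
-- inner operator is read off after the slot `i` has moved, which costs the factor `c`; otherwise it
-- costs nothing. With `c = -1` this gives anticommutation within one grading, with `c = 1`
-- commutation between the two gradings.
open Classical in
theorem totAt_totAt_of_ne (s s' : ∀ f, ι f → ℤ) (A B : ∀ f, Matrix (ι f) (ι f) R) {c : ℤ}
    (hc : ∀ f z w, A f z w = 0 ∨ s' f w = c * s' f z) {i j : F} (hij : i ≠ j)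
    (g : (∀ f, ι f) → R) (x : ∀ f, ι f) :
    totAt r s A i (totAt r s' B j g) x = ((if r i j then c else 1) * sgnBelow r s i x *
      sgnBelow r s' j x) • ∑ z, ∑ w, A i (x i) z * B j (x j) w *
        g (Function.update (Function.update x i z) j w) := by
  rw [totAt_apply, mul_comm _ (sgnBelow r s i x), mul_assoc, mul_smul]
  refine congrArg _ ?_
  rw [Finset.smul_sum]
  refine Finset.sum_congr rfl fun z _ => ?_
  rcases hc i (x i) z with h | h
  · simp [h]
  · rw [totAt_apply, mul_smul_comm, Finset.mul_sum]
    congr 1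
    · split_ifs with hr
      · exact sgnBelow_update_of_rel r hr x z h
      · rw [one_mul, sgnBelow_update_of_not r hr]
    · refine Finset.sum_congr rfl fun w _ => ?_
      rw [Function.update_of_ne hij.symm, mul_assoc]

/-- No slot lies below itself, so a move within the slot leaves both signs alone and the operators
compose as matrices. -/
theorem totAt_totAt_self (s s' : ∀ f, ι f → ℤ) (A B : ∀ f, Matrix (ι f) (ι f) R) (hr : ¬r i i)
    (g : (∀ f, ι f) → R) (x : ∀ f, ι f) :
    totAt r s A i (totAt r s' B i g) x = (sgnBelow r s i x * sgnBelow r s' i x) •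
      ∑ w, (A i * B i) (x i) w * g (Function.update x i w) := by
  rw [totAt_apply, mul_smul]
  congr 1
  simp only [totAt_apply, sgnBelow_update_of_not r hr, Function.update_self, Matrix.mul_apply,
    Finset.sum_mul, Function.update_idem, mul_smul_comm, Finset.mul_sum]
  rw [Finset.sum_comm, Finset.smul_sum]
  refine Finset.sum_congr rfl fun w _ => ?_
  rw [Finset.smul_sum, Finset.smul_sum]
  exact Finset.sum_congr rfl fun _ _ => by rw [mul_assoc]

theorem sum_update_comm (A B : ∀ f, Matrix (ι f) (ι f) R) {i j : F} (hij : i ≠ j)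
    (g : (∀ f, ι f) → R) (x : ∀ f, ι f) :
    ∑ z, ∑ w, A i (x i) z * B j (x j) w * g (Function.update (Function.update x i z) j w) =
      ∑ w, ∑ z, B j (x j) w * A i (x i) z *
        g (Function.update (Function.update x j w) i z) := by
  rw [Finset.sum_comm]
  refine Finset.sum_congr rfl fun w _ => Finset.sum_congr rfl fun z _ => ?_
  rw [Function.update_comm hij, mul_comm (A _ _ _)]

variable {r}

/-- The terms for `(i, j)` and `(j, i)` cancel, because exactly one of `r i j` and `r j i` holds and
so exactly one of them carries the extra `-1`. The diagonal terms vanish because each matrix squares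
to zero. -/
theorem tot_sq (hr : IsTournament r) (s : ∀ f, ι f → ℤ) (A : ∀ f, Matrix (ι f) (ι f) R)
    (hA : ∀ f z w, A f z w = 0 ∨ s f w = -1 * s f z) (hAA : ∀ f, A f * A f = 0)
    (g : (∀ f, ι f) → R) : tot r s A (tot r s A g) = 0 := by
  simp only [tot, LinearMap.sum_apply, map_sum]
  rw [← Finset.sum_product']
  refine Finset.sum_involution (fun p _ => (p.2, p.1)) ?_ ?_ (by simp) (by simp)
  · rintro ⟨i, j⟩ -
    dsimp only
    by_cases hij : i = j
    · subst hij
      funext x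
      simp [totAt_totAt_self r s s A A (hr.irrefl i), hAA]
    · funext x
      rw [Pi.add_apply, totAt_totAt_of_ne r s s A A hA hij,
        totAt_totAt_of_ne r s s A A hA (Ne.symm hij), sum_update_comm A A hij, ← add_smul]
      have h := hr.total i j hij
      by_cases h1 : r i j
      · have h2 := h.1 h1
        simp [h1, h2, mul_comm]
      · have h2 := not_not.1 (mt h.2 h1)
        simp [h1, h2, mul_comm]
  · rintro ⟨i, j⟩ - hne heq
    simp only [Prod.mk.injEq] at heq
    obtain ⟨rfl, -⟩ := heq
    refine hne (funext fun x => ?_)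
    simp [totAt_totAt_self r s s A A (hr.irrefl _), hAA]

/-- Each operator preserves the sign that belongs to the other grading, so the factor `c` is `1` and
no sign arises. -/
theorem tot_comm (hr : IsTournament r) (s s' : ∀ f, ι f → ℤ) (A B : ∀ f, Matrix (ι f) (ι f) R)
    (hA : ∀ f z w, A f z w = 0 ∨ s' f w = s' f z) (hB : ∀ f z w, B f z w = 0 ∨ s f w = s f z)
    (hAB : ∀ f, A f * B f = B f * A f)
    (g : (∀ f, ι f) → R) : tot r s A (tot r s' B g) = tot r s' B (tot r s A g) := by
  have hA' : ∀ f z w, A f z w = 0 ∨ s' f w = 1 * s' f z := by simpa using hA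
  have hB' : ∀ f z w, B f z w = 0 ∨ s f w = 1 * s f z := by simpa using hB
  simp only [tot, LinearMap.sum_apply, map_sum]
  rw [Finset.sum_comm]
  refine Finset.sum_congr rfl fun j _ => Finset.sum_congr rfl fun i _ => funext fun x => ?_
  by_cases hij : j = i
  · subst hij
    rw [totAt_totAt_self r s s' A B (hr.irrefl _), totAt_totAt_self r s' s B A (hr.irrefl _),
      hAB, mul_comm]
  · rw [totAt_totAt_of_ne r s s' A B hA' hij, totAt_totAt_of_ne r s' s B A hB' (Ne.symm hij),
      sum_update_comm A B hij]
    congr 1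
    simp [mul_comm]

/-- Total operators commute with coefficientwise maps. -/
theorem tot_comp {S : Type u} [CommRing S] (s : ∀ f, ι f → ℤ) (A : ∀ f, Matrix (ι f) (ι f) R)
    (B : ∀ f, Matrix (ι f) (ι f) S) (φ : R →+ S)
    (h : ∀ f z w c, φ (A f z w * c) = B f z w * φ c) (g : (∀ f, ι f) → R) (x : ∀ f, ι f) :
    φ (tot r s A g x) = tot r s B (fun y => φ (g y)) x := by
  simp only [tot_apply, map_sum, map_zsmul, h]

end Tot

/-! ### Free local data -/

/-- The data of a finite free bicomplex. -/
structure Loc (k : Type u) [Field k] (σ : Type) : Type (u + 1) where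
  ι : Type
  [fintype : Fintype ι]
  hd : ι → ℤ
  vd : ι → ℤ
  qd : ι → ℤ
  A : Matrix ι ι (MvPolynomial σ k)
  B : Matrix ι ι (MvPolynomial σ k)
  hA : ∀ i j, A i j = 0 ∨ hd i = hd j + 1 ∧ vd i = vd j + 0 ∧
    ∃ n : ℕ, (A i j).IsHomogeneous n ∧ qd j + 2 = qd i + 2 * n
  hB : ∀ i j, B i j = 0 ∨ hd i = hd j + 0 ∧ vd i = vd j + 1 ∧
    ∃ n : ℕ, (B i j).IsHomogeneous n ∧ qd j + 0 = qd i + 2 * n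
  hAA : A * A = 0
  hBB : B * B = 0
  hAB : A * B = B * A

attribute [instance] Loc.fintype

namespace Loc

variable {k : Type u} [Field k] {σ τ : Type}

/-- The bicomplex given by local data. -/
def toBicomplex (L : Loc k σ) : Bicomplex k σ :=
  Bicomplex.free L.hd L.vd L.qd L.A L.B L.hA L.hB L.hAA L.hBB L.hAB

/-- Renaming the variables in the matrices. -/
@[reducible]
def map (φ : σ → τ) (L : Loc k σ) : Loc k τ where
  ι := L.ι
  hd := L.hd
  vd := L.vd
  qd := L.qd
  A := L.A.map (rename φ)
  B := L.B.map (rename φ)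
  hA i j := by
    rcases L.hA i j with h | ⟨h1, h2, n, h3, h4⟩
    · exact Or.inl (by simp [h])
    · exact Or.inr ⟨h1, h2, n, h3.rename_isHomogeneous, h4⟩
  hB i j := by
    rcases L.hB i j with h | ⟨h1, h2, n, h3, h4⟩
    · exact Or.inl (by simp [h])
    · exact Or.inr ⟨h1, h2, n, h3.rename_isHomogeneous, h4⟩
  hAA := by
    rw [← Matrix.map_mul, L.hAA, Matrix.map_zero _ (map_zero _)]
  hBB := by
    rw [← Matrix.map_mul, L.hBB, Matrix.map_zero _ (map_zero _)]
  hAB := by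
    rw [← Matrix.map_mul, L.hAB, Matrix.map_mul]

/-- The sign `(-1) ^ h` of a basis element. -/
def hs (L : Loc k σ) (z : L.ι) : ℤ := (L.hd z).negOnePow

/-- The sign `(-1) ^ v` of a basis element. -/
def vs (L : Loc k σ) (z : L.ι) : ℤ := (L.vd z).negOnePow

section Prod

variable {F : Type} [Fintype F] [DecidableEq F]

theorem freeGr_totAt (r : F → F → Prop) {ι : F → Type} [∀ f, Fintype (ι f)]
    (hd vd qd s : ∀ f, ι f → ℤ)
    (A : ∀ f, Matrix (ι f) (ι f) (MvPolynomial σ k)) (a b c : ℤ)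
    (hA : ∀ f i j, A f i j = 0 ∨ hd f i = hd f j + a ∧ vd f i = vd f j + b ∧
      ∃ n : ℕ, (A f i j).IsHomogeneous n ∧ qd f j + c = qd f i + 2 * n)
    {h v q : ℤ} {g : (∀ f, ι f) → MvPolynomial σ k}
    (hg : g ∈ Bicomplex.freeGr k σ (fun x : ∀ f, ι f => ∑ f, hd f (x f))
      (fun x => ∑ f, vd f (x f)) (fun x => ∑ f, qd f (x f)) h v q) :
    tot r s A g ∈ Bicomplex.freeGr k σ (fun x : ∀ f, ι f => ∑ f, hd f (x f))
      (fun x => ∑ f, vd f (x f)) (fun x => ∑ f, qd f (x f)) (h + a) (v + b) (q + c) := by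
  have upd : ∀ (t : ∀ f, ι f → ℤ) (x : ∀ f, ι f) (i : F) (z : ι i),
      ∑ f, t f (Function.update x i z f) = ∑ f, t f (x f) - t i (x i) + t i z := by
    intro t x i z
    rw [← Finset.add_sum_erase _ _ (Finset.mem_univ i),
      ← Finset.add_sum_erase (a := i) _ (fun f => t f (x f)) (Finset.mem_univ i)]
    rw [Finset.sum_congr rfl fun f hf => by
      rw [Function.update_of_ne (Finset.ne_of_mem_erase hf)]]
    rw [Function.update_self]
    ring
  -- The homogeneous elements form a subgroup, so one slot can be treated at a time; the sum over
  -- `Unit` has a single term.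
  have key : tot r s A g = ∑ i, ∑ x' : Unit, fun x => sgnBelow r s i x • ∑ z, A i (x i) z *
      g (Function.update x i z) := by
    funext x; simp [tot_apply]
  rw [key]
  refine sum_mem fun i _ => sum_mem fun _ _ x => ?_
  suffices H : ∀ z, A i (x i) z * g (Function.update x i z) = 0 ∨
      h + a = ∑ f, hd f (x f) ∧ v + b = ∑ f, vd f (x f) ∧
      ∃ n : ℕ, (A i (x i) z * g (Function.update x i z)).IsHomogeneous n ∧
        q + c = ∑ f, qd f (x f) + 2 * n by
    by_cases hz : ∀ z, A i (x i) z * g (Function.update x i z) = 0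
    · exact Or.inl (by simp [hz])
    push Not at hz
    obtain ⟨z, hz⟩ := hz
    obtain ⟨h1, h2, n, h3, h4⟩ := (H z).resolve_left hz
    refine Or.inr ⟨h1, h2, n, ?_, h4⟩
    -- The polynomial degree is determined by `q` and by the degree of the basis element `x`, so all
    -- nonzero summands are homogeneous of the same degree.
    have hsum : (∑ z, A i (x i) z * g (Function.update x i z)).IsHomogeneous n := by
      refine IsHomogeneous.sum _ _ _ fun w _ => ?_
      rcases H w with h | ⟨_, _, n', h5, h6⟩
      · rw [h]; exact isHomogeneous_zero _ _ _
      · obtain rfl : n' = n := by omega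
        exact h5
    exact (mem_homogeneousSubmodule n _).1
      (zsmul_mem ((mem_homogeneousSubmodule n _).2 hsum) _)
  intro z
  rcases hg (Function.update x i z) with hg | ⟨h1, h2, n, h3, h4⟩
  · exact Or.inl (by simp [hg])
  rcases hA i (x i) z with hA | ⟨g1, g2, n', g3, g4⟩
  · exact Or.inl (by simp [hA])
  simp only [upd] at h1 h2 h4
  refine Or.inr ⟨by omega, by omega, n' + n, g3.mul h3, ?_⟩
  push_cast
  omega

variable {r : F → F → Prop}

/-- The tensor product of a family of free bicomplexes, in the basis formed by the products of
the basis elements; the signs are determined by `r`. -/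
def prod (hr : IsTournament r) (L : F → Loc k σ) : Bicomplex k σ where
  M := (∀ f, (L f).ι) → MvPolynomial σ k
  gr := Bicomplex.freeGr k σ (fun x => ∑ f, (L f).hd (x f)) (fun x => ∑ f, (L f).vd (x f))
    (fun x => ∑ f, (L f).qd (x f))
  dh := tot r (fun f => (L f).hs) fun f => (L f).A
  dv := tot r (fun f => (L f).vs) fun f => (L f).B
  sh := LinearMap.pi fun x => (∏ f, (L f).hs (x f)) • LinearMap.proj x
  sv := LinearMap.pi fun x => (∏ f, (L f).vs (x f)) • LinearMap.proj x
  span_gr := by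
    classical
    exact Bicomplex.freeGr_span _ _ _
  smul_gr := by
    intro h v q n r f hr hf i
    rcases hf i with hf | ⟨h1, h2, n', h3, h4⟩
    · exact Or.inl (by simp [hf])
    · refine Or.inr ⟨h1, h2, n + n', hr.mul h3, ?_⟩
      push_cast
      rw [h4]
      ring
  dh_gr {h v q f} hf := by
    simpa using freeGr_totAt r (fun f => (L f).hd) (fun f => (L f).vd) (fun f => (L f).qd) _
      (fun f => (L f).A) 1 0 2 (fun f => (L f).hA) hf
  dv_gr {h v q f} hf := by
    simpa using freeGr_totAt r (fun f => (L f).hd) (fun f => (L f).vd) (fun f => (L f).qd) _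
      (fun f => (L f).B) 0 1 0 (fun f => (L f).hB) hf
  sh_gr := by
    intro h v q f hf
    funext x
    rcases hf x with hf | ⟨h1, h2, n, h3, h4⟩
    · simp [hf]
    · subst h1
      rw [negOnePow_sum]
      rfl
  sv_gr := by
    intro h v q f hf
    funext x
    rcases hf x with hf | ⟨h1, h2, n, h3, h4⟩
    · simp [hf]
    · subst h2
      rw [negOnePow_sum]
      rfl
  dh_dh := tot_sq hr _ _ (fun f z w => ((L f).hA z w).imp_right fun h => by
    simp [hs, h.1, Int.negOnePow_succ]) fun f => (L f).hAA
  dv_dv := tot_sq hr _ _ (fun f z w => ((L f).hB z w).imp_right fun h => by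
    simp [vs, h.2.1, Int.negOnePow_succ]) fun f => (L f).hBB
  dh_dv := tot_comm hr _ _ _ _ (fun f z w => ((L f).hA z w).imp_right fun h => by
    simp [vs, h.2.1]) (fun f z w => ((L f).hB z w).imp_right fun h => by
    simp [hs, h.1]) fun f => (L f).hAB

end Prod

end Loc
end
end KRTangle

/-! ### Isomorphisms of products in coordinates: signs, order, labels and variables. -/

namespace KRTangle
noncomputable section
namespace Loc
open Bicomplex

variable {k : Type u} [Field k] {σ τ V W : Type}

section Monomial

variable {F F' : Type} [Fintype F] [DecidableEq F] [Fintype F'] [DecidableEq F']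
  {r : F → F → Prop} {r' : F' → F' → Prop}

theorem smul_eq_zero_iff_of_mul_self {c : ℤ} (hc : c * c = 1) {x : MvPolynomial σ k} :
    c • x = 0 ↔ x = 0 := by
  refine ⟨fun h => ?_, fun h => by simp [h]⟩
  have : c • c • x = 0 := by rw [h, smul_zero]
  rwa [smul_smul, hc, one_smul] at this

theorem isHomogeneous_zsmul {n : ℕ} {x : MvPolynomial σ k} (h : x.IsHomogeneous n) (c : ℤ) :
    (c • x).IsHomogeneous n :=
  (mem_homogeneousSubmodule n _).1 (zsmul_mem ((mem_homogeneousSubmodule n _).2 h) _)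

theorem isHomogeneous_zsmul_iff {c : ℤ} (hc : c * c = 1) {n : ℕ} {x : MvPolynomial σ k} :
    (c • x).IsHomogeneous n ↔ x.IsHomogeneous n := by
  refine ⟨fun h => ?_, fun h => isHomogeneous_zsmul h c⟩
  have := isHomogeneous_zsmul h c
  rwa [smul_smul, hc, one_smul] at this

/-- A bijection between the bases with signs that is compatible with the differentials. -/
def prodIsoOfSigns (hr : IsTournament r) (hr' : IsTournament r') (L : F → Loc k σ)
    (L' : F' → Loc k σ) (p : (∀ f, (L' f).ι) ≃ (∀ f, (L f).ι)) (c : (∀ f, (L' f).ι) → ℤ)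
    (hc : ∀ x, c x * c x = 1)
    (hhd : ∀ x, ∑ f, (L f).hd (p x f) = ∑ f, (L' f).hd (x f))
    (hvd : ∀ x, ∑ f, (L f).vd (p x f) = ∑ f, (L' f).vd (x f))
    (hqd : ∀ x, ∑ f, (L f).qd (p x f) = ∑ f, (L' f).qd (x f))
    (hA : ∀ g x, tot r' (fun f => (L' f).hs) (fun f => (L' f).A) (fun x => c x • g (p x)) x =
      c x • tot r (fun f => (L f).hs) (fun f => (L f).A) g (p x))
    (hB : ∀ g x, tot r' (fun f => (L' f).vs) (fun f => (L' f).B) (fun x => c x • g (p x)) x =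
      c x • tot r (fun f => (L f).vs) (fun f => (L f).B) g (p x)) :
    Iso (prod hr L) (prod hr' L') :=
  -- An equivalence is needed, since `Iso.ofBijective` asks that the map also reflect the grading;
  -- it holds because the signs are invertible.
  have hgr : ∀ h v q (g : (∀ f, (L f).ι) → MvPolynomial σ k),
      (fun x => c x • g (p x)) ∈ (prod hr' L').gr h v q ↔ g ∈ (prod hr L).gr h v q := by
    intro h v q g
    have key : ∀ x, (c x • g (p x) = 0 ∨ h = ∑ f, (L' f).hd (x f) ∧ v = ∑ f, (L' f).vd (x f) ∧
        ∃ n : ℕ, (c x • g (p x)).IsHomogeneous n ∧ q = ∑ f, (L' f).qd (x f) + 2 * n) ↔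
        (g (p x) = 0 ∨ h = ∑ f, (L f).hd (p x f) ∧ v = ∑ f, (L f).vd (p x f) ∧
        ∃ n : ℕ, (g (p x)).IsHomogeneous n ∧ q = ∑ f, (L f).qd (p x f) + 2 * n) := by
      intro x
      rw [hhd, hvd, hqd, smul_eq_zero_iff_of_mul_self (hc x)]
      simp only [isHomogeneous_zsmul_iff (hc x)]
    exact ⟨fun H x => by simpa using (key (p.symm x)).1 (H _), fun H x => (key x).2 (H _)⟩
  Iso.ofBijective (C := prod hr L) (D := prod hr' L')
    { toLin :=
        { toFun := fun g x => c x • g (p x)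
          map_add' := fun g g' => funext fun x => smul_add _ _ _
          map_smul' := fun s (g : (∀ f, (L f).ι) → MvPolynomial σ k) => funext fun x =>
            smul_comm (c x) s (g (p x)) }
      map_gr := fun {h v q g} hg => (hgr h v q g).2 hg
      comm_dh := fun g => funext fun x => (hA g x).symm
      comm_dv := fun g => funext fun x => (hB g x).symm }
    (by
      refine ⟨fun g g' h => funext fun x => ?_, fun g => ⟨fun x => c (p.symm x) • g (p.symm x),
        funext fun x => ?_⟩⟩
      · have h1 : c (p.symm x) • g (p (p.symm x)) = c (p.symm x) • g' (p (p.symm x)) :=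
          congrFun h (p.symm x)
        rw [Equiv.apply_symm_apply] at h1
        have h2 := congrArg (fun y => c (p.symm x) • y) h1
        simpa only [smul_smul, hc, one_smul] using h2
      · change c x • c (p.symm (p x)) • g (p.symm (p x)) = g x
        rw [Equiv.symm_apply_apply, smul_smul, hc, one_smul])
    (fun h v q g => (hgr h v q g).1)

end Monomial

/-! ### Changing the order of the factors -/

section Reorder

variable {F : Type} [Fintype F] [DecidableEq F]

open Classical in
/-- The sign of the change of order from `r` to `r'`, where `p` is the sign of a transposition. -/
def reorderSign (r r' : F → F → Prop) {ι : F → Type} (p : ∀ i j, ι i → ι j → ℤ)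
    (x : ∀ f, ι f) : ℤ :=
  ∏ i, ∏ j, if r i j ∧ r' j i then p i j (x i) (x j) else 1

variable {r r' : F → F → Prop} {ι : F → Type}

theorem reorderSign_mul_self (p : ∀ i j, ι i → ι j → ℤ) (hp : ∀ i j a b, p i j a b * p i j a b = 1)
    (x : ∀ f, ι f) : reorderSign r r' p x * reorderSign r r' p x = 1 := by
  rw [reorderSign, ← Finset.prod_mul_distrib]
  refine Finset.prod_eq_one fun i _ => ?_
  rw [← Finset.prod_mul_distrib]
  refine Finset.prod_eq_one fun j _ => ?_
  split_ifs <;> simp [hp]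

/-- The sign of a change of order is the product of `p` over the inverted pairs. A move in the slot
`i` by an operator of degree one multiplies it by `s j` for every `j` whose position relative to `i`
differs in the two orders. That is exactly the quotient of the signs `sgnBelow` for `r'` and for
`r`. -/
theorem reorderSign_update (hr : IsTournament r) (hr' : IsTournament r')
    (p : ∀ i j, ι i → ι j → ℤ) (hp : ∀ i j a b, p i j a b = p j i b a)
    (s : ∀ f, ι f → ℤ) (hs : ∀ f z, s f z * s f z = 1) (x : ∀ f, ι f) (i : F) (z : ι i)
    (h : ∀ j b, p i j z b = p i j (x i) b * s j b) :
    sgnBelow r' s i x * reorderSign r r' p (Function.update x i z) =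
      reorderSign r r' p x * sgnBelow r s i x := by
  classical
  have key : reorderSign r r' p (Function.update x i z) = reorderSign r r' p x *
      ((∏ b, if r i b ∧ r' b i then s b (x b) else 1) *
        ∏ a, if r a i ∧ r' i a then s a (x a) else 1) := by
    -- Single products are spread out over all pairs, so that both sides can be compared pair by
    -- pair.
    have h1 : (∏ b, if r i b ∧ r' b i then s b (x b) else 1) =
        ∏ a, ∏ b, if a = i ∧ r i b ∧ r' b i then s b (x b) else 1 := by
      rw [Fintype.prod_eq_single i fun a ha => Finset.prod_eq_one fun b _ => by simp [ha]]
      simp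
    have h2 : (∏ a, if r a i ∧ r' i a then s a (x a) else 1) =
        ∏ a, ∏ b, if b = i ∧ r a i ∧ r' i a then s a (x a) else 1 := by
      refine Finset.prod_congr rfl fun a _ => ?_
      rw [Fintype.prod_eq_single i fun b hb => by simp [hb]]
      simp
    rw [h1, h2, reorderSign, reorderSign, ← Finset.prod_mul_distrib, ← Finset.prod_mul_distrib]
    refine Finset.prod_congr rfl fun a _ => ?_
    rw [← Finset.prod_mul_distrib, ← Finset.prod_mul_distrib]
    refine Finset.prod_congr rfl fun b _ => ?_
    by_cases ha : a = i
    · subst ha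
      by_cases hb : b = a
      · subst hb
        simp [hr.irrefl]
      · by_cases hc : r a b ∧ r' b a <;> simp [hb, hc, h]
    · by_cases hb : b = i
      · subst hb
        by_cases hc : r a b ∧ r' b a
        · simp [ha, hc, hp a b, h]
        · simp [ha, hc]
      · simp [ha, hb]
  rw [key, mul_left_comm]
  congr 1
  rw [sgnBelow, sgnBelow, ← Finset.prod_mul_distrib, ← Finset.prod_mul_distrib]
  refine Finset.prod_congr rfl fun j _ => ?_
  by_cases hj : i = j
  · subst hj
    simp [hr.irrefl, hr'.irrefl]
  -- Four cases, by the position of `j` relative to `i` in the two orders. If `j` is below `i` for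
  -- `r'` only, then `s j` occurs twice and cancels.
  · rw [hr.total i j hj, hr'.total i j hj]
    by_cases h1 : r j i <;> by_cases h2 : r' j i <;> simp [h1, h2, hs]

variable {k : Type u} [Field k] {σ : Type}

/-- The total operators of two orders are conjugate by the sign of the change of order. -/
theorem tot_reorder [∀ f, Fintype (ι f)] (hr : IsTournament r) (hr' : IsTournament r')
    (p : ∀ i j, ι i → ι j → ℤ) (hp : ∀ i j a b, p i j a b = p j i b a)
    (s : ∀ f, ι f → ℤ) (hs : ∀ f z, s f z * s f z = 1)
    (A : ∀ f, Matrix (ι f) (ι f) (MvPolynomial σ k))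
    (h : ∀ i w z, A i w z = 0 ∨ ∀ j b, p i j z b = p i j w b * s j b)
    (g : (∀ f, ι f) → MvPolynomial σ k) (x : ∀ f, ι f) :
    tot r' s A (fun x => reorderSign r r' p x • g x) x =
      reorderSign r r' p x • tot r s A g x := by
  simp only [tot_apply, Finset.smul_sum, smul_smul]
  refine Finset.sum_congr rfl fun i _ => Finset.sum_congr rfl fun z _ => ?_
  rcases h i (x i) z with h | h
  · simp [h]
  · rw [← reorderSign_update hr hr' p hp s hs x i z h, mul_smul_comm, smul_smul]

/-- The sign of a transposition of two homogeneous elements. -/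
def swapSign (L : F → Loc k σ) (i j : F) (a : (L i).ι) (b : (L j).ι) : ℤ :=
  ((L i).hd a * (L j).hd b + (L i).vd a * (L j).vd b).negOnePow

theorem swapSign_comm (L : F → Loc k σ) (i j : F) (a : (L i).ι) (b : (L j).ι) :
    swapSign L i j a b = swapSign L j i b a := by
  rw [swapSign, swapSign, mul_comm, mul_comm (vd _ _)]

/-- A change of `h` by one multiplies `(-1) ^ (h * h' + v * v')` by `(-1) ^ h'`, the sign of the
horizontal differential on passing the other factor. The products `h * h'` and `v * v'` are added
because the two gradings have separate sign rules; mixed terms do not occur. -/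
theorem swapSign_eq_mul_hs (L : F → Loc k σ) {i j : F} {w z : (L i).ι}
    (h1 : (L i).hd w = (L i).hd z + 1) (h2 : (L i).vd w = (L i).vd z + 0) (b : (L j).ι) :
    swapSign L i j z b = swapSign L i j w b * (L j).hs b := by
  rw [swapSign, swapSign, h1, h2, hs, ← Units.val_mul, ← Int.negOnePow_add,
    show ((L i).hd z + 1) * (L j).hd b + ((L i).vd z + 0) * (L j).vd b + (L j).hd b =
      ((L i).hd z * (L j).hd b + (L i).vd z * (L j).vd b) + 2 * (L j).hd b by ring,
    Int.negOnePow_add _ (2 * _), Int.negOnePow_two_mul, mul_one]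

theorem swapSign_eq_mul_vs (L : F → Loc k σ) {i j : F} {w z : (L i).ι}
    (h1 : (L i).hd w = (L i).hd z + 0) (h2 : (L i).vd w = (L i).vd z + 1) (b : (L j).ι) :
    swapSign L i j z b = swapSign L i j w b * (L j).vs b := by
  rw [swapSign, swapSign, h1, h2, vs, ← Units.val_mul, ← Int.negOnePow_add,
    show ((L i).hd z + 0) * (L j).hd b + ((L i).vd z + 1) * (L j).vd b + (L j).vd b =
      ((L i).hd z * (L j).hd b + (L i).vd z * (L j).vd b) + 2 * (L j).vd b by ring,
    Int.negOnePow_add _ (2 * _), Int.negOnePow_two_mul, mul_one]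

/-- A tensor product does not depend on the order of the factors. -/
def prodReorder (hr : IsTournament r) (hr' : IsTournament r') (L : F → Loc k σ) :
    Iso (prod hr L) (prod hr' L) :=
  prodIsoOfSigns hr hr' L L (Equiv.refl _) (reorderSign r r' (swapSign L))
    (reorderSign_mul_self _ fun _ _ _ _ => negOnePow_mul_self _)
    (fun _ => rfl) (fun _ => rfl) (fun _ => rfl)
    (tot_reorder hr hr' _ (swapSign_comm L) (fun f => (L f).hs) (fun _ _ => negOnePow_mul_self _)
      (fun f => (L f).A) fun i w z => ((L i).hA w z).imp_right fun h _ b =>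
        swapSign_eq_mul_hs L h.1 h.2.1 b)
    (tot_reorder hr hr' _ (swapSign_comm L) (fun f => (L f).vs) (fun _ _ => negOnePow_mul_self _)
      (fun f => (L f).B) fun i w z => ((L i).hB w z).imp_right fun h _ b =>
        swapSign_eq_mul_vs L h.1 h.2.1 b)

end Reorder

/-! ### Relabelling -/

/-- Isomorphisms of local data: a bijection of the bases and signs. -/
structure Sim (L L' : Loc k σ) where
  e : L.ι ≃ L'.ι
  u : L.ι → ℤ
  hu : ∀ z, u z * u z = 1
  hd : ∀ z, L'.hd (e z) = L.hd z
  vd : ∀ z, L'.vd (e z) = L.vd z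
  qd : ∀ z, L'.qd (e z) = L.qd z
  A : ∀ z w, L'.A (e z) (e w) = (u z * u w) • L.A z w
  B : ∀ z w, L'.B (e z) (e w) = (u z * u w) • L.B z w

theorem Sim.map_hs {L L' : Loc k σ} (I : Sim L L') (z : L.ι) : L'.hs (I.e z) = L.hs z := by
  rw [hs, hs, I.hd]

theorem Sim.map_vs {L L' : Loc k σ} (I : Sim L L') (z : L.ι) : L'.vs (I.e z) = L.vs z := by
  rw [vs, vs, I.vd]

/-- Equal local data are isomorphic. -/
def Sim.ofEq {L L' : Loc k σ} (h : L = L') : Sim L L' := by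
  subst h
  exact ⟨Equiv.refl _, fun _ => 1, by simp, fun _ => rfl, fun _ => rfl, fun _ => rfl,
    by simp, by simp⟩

section Relabel

variable {F F' : Type} [Fintype F] [DecidableEq F] [Fintype F'] [DecidableEq F']
  {r' : F' → F' → Prop} {ι : F → Type} {ι' : F' → Type} [∀ f, Fintype (ι f)]
  [∀ f, Fintype (ι' f)]

/-- The bijection between the bases of two tensor products. -/
def pullEquiv (θ : F ≃ F') (e : ∀ f, ι f ≃ ι' (θ f)) : (∀ f, ι' f) ≃ ∀ f, ι f :=
  (Equiv.piCongr θ e).symm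

theorem pullEquiv_apply (θ : F ≃ F') (e : ∀ f, ι f ≃ ι' (θ f)) (x : ∀ f, ι' f) (f : F) :
    pullEquiv θ e x f = (e f).symm (x (θ f)) := by
  simp [pullEquiv, Equiv.piCongr]

theorem pullEquiv_update (θ : F ≃ F') (e : ∀ f, ι f ≃ ι' (θ f)) (x : ∀ f, ι' f) (i : F)
    (z : ι i) : pullEquiv θ e (Function.update x (θ i) (e i z)) =
      Function.update (pullEquiv θ e x) i z := by
  funext f
  rw [pullEquiv_apply]
  by_cases hf : f = i
  · subst hf; simp
  · rw [Function.update_of_ne hf, Function.update_of_ne (θ.injective.ne hf), pullEquiv_apply]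

/-- The product of the signs of the local isomorphisms. -/
def relabelSign (θ : F ≃ F') (e : ∀ f, ι f ≃ ι' (θ f)) (u : ∀ f, ι f → ℤ) (x : ∀ f, ι' f) : ℤ :=
  ∏ f, u f (pullEquiv θ e x f)

/-- With the order pulled back along `θ`, corresponding slots have equal signs in front of them.
Conjugation by the product of the local signs `u` accounts for the signs in the matrix entries. -/
theorem tot_relabel (θ : F ≃ F') (e : ∀ f, ι f ≃ ι' (θ f)) (u : ∀ f, ι f → ℤ)
    (hu : ∀ f z, u f z * u f z = 1) (s : ∀ f, ι f → ℤ) (s' : ∀ f, ι' f → ℤ)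
    (hs : ∀ f z, s' (θ f) (e f z) = s f z) (A : ∀ f, Matrix (ι f) (ι f) (MvPolynomial σ k))
    (A' : ∀ f, Matrix (ι' f) (ι' f) (MvPolynomial σ k))
    (hA : ∀ f z w, A' (θ f) (e f z) (e f w) = (u f z * u f w) • A f z w)
    (g : (∀ f, ι f) → MvPolynomial σ k) (x : ∀ f, ι' f) :
    tot r' s' A' (fun x => relabelSign θ e u x • g (pullEquiv θ e x)) x =
      relabelSign θ e u x • tot (fun i j => r' (θ i) (θ j)) s A g
        (pullEquiv θ e x) := by
  have hx : ∀ f, x (θ f) = e f (pullEquiv θ e x f) := fun f => by simp [pullEquiv_apply]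
  rw [tot_apply, tot_apply, ← θ.sum_comp, Finset.smul_sum]
  refine Finset.sum_congr rfl fun i _ => ?_
  rw [smul_comm]
  congr 1
  · rw [sgnBelow, sgnBelow, ← θ.prod_comp]
    exact Finset.prod_congr rfl fun f _ => by rw [hx, hs]
  · rw [← (e i).sum_comp, Finset.smul_sum]
    refine Finset.sum_congr rfl fun z _ => ?_
    rw [relabelSign, relabelSign, pullEquiv_update, hx, hA, mul_smul_comm, smul_mul_assoc, smul_smul]
    congr 1
    rw [← Finset.mul_prod_erase _ _ (Finset.mem_univ i),
      ← Finset.mul_prod_erase (a := i) _ (fun f => u f (pullEquiv θ e x f)) (Finset.mem_univ i),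
      Function.update_self, Finset.prod_congr rfl fun f hf => by
        rw [Function.update_of_ne (Finset.ne_of_mem_erase hf)]]
    -- The local sign at the new basis element `z` occurs twice, once from the matrix entry and once
    -- from the product of signs.
    linear_combination (u i (pullEquiv θ e x i) *
      ∏ f ∈ Finset.univ.erase i, u f (pullEquiv θ e x f)) * hu i z

theorem relabelSign_mul_self (θ : F ≃ F') (e : ∀ f, ι f ≃ ι' (θ f)) (u : ∀ f, ι f → ℤ)
    (hu : ∀ f z, u f z * u f z = 1) (x : ∀ f, ι' f) :
    relabelSign θ e u x * relabelSign θ e u x = 1 := by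
  rw [relabelSign, ← Finset.prod_mul_distrib]
  exact Finset.prod_eq_one fun f _ => hu _ _

theorem sum_pullEquiv (θ : F ≃ F') (e : ∀ f, ι f ≃ ι' (θ f)) (d : ∀ f, ι f → ℤ)
    (d' : ∀ f, ι' f → ℤ) (h : ∀ f z, d' (θ f) (e f z) = d f z) (x : ∀ f, ι' f) :
    ∑ f, d f (pullEquiv θ e x f) = ∑ f, d' f (x f) := by
  rw [← θ.sum_comp]
  exact Finset.sum_congr rfl fun f _ => by rw [← h, pullEquiv_apply, Equiv.apply_symm_apply]

theorem tot_relabel_hs (L : F → Loc k σ) (L' : F' → Loc k σ) (θ : F ≃ F')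
    (I : ∀ f, Sim (L f) (L' (θ f))) (g : (∀ f, (L f).ι) → MvPolynomial σ k)
    (x : ∀ f, (L' f).ι) :
    tot r' (fun f => (L' f).hs) (fun f => (L' f).A) (fun x =>
      relabelSign θ (fun f => (I f).e) (fun f => (I f).u) x •
        g (pullEquiv θ (fun f => (I f).e) x)) x =
      relabelSign θ (fun f => (I f).e) (fun f => (I f).u) x •
        tot (fun i j => r' (θ i) (θ j)) (fun f => (L f).hs) (fun f => (L f).A) g
          (pullEquiv θ (fun f => (I f).e) x) :=
  tot_relabel (ι := fun f => (L f).ι) (ι' := fun f => (L' f).ι) θ (fun f => (I f).e)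
    (fun f => (I f).u) (fun f => (I f).hu) (fun f => (L f).hs) (fun f => (L' f).hs) (fun f => (I f).map_hs)
    (fun f => (L f).A) (fun f => (L' f).A) (fun f => (I f).A) g x

theorem tot_relabel_vs (L : F → Loc k σ) (L' : F' → Loc k σ) (θ : F ≃ F')
    (I : ∀ f, Sim (L f) (L' (θ f))) (g : (∀ f, (L f).ι) → MvPolynomial σ k)
    (x : ∀ f, (L' f).ι) :
    tot r' (fun f => (L' f).vs) (fun f => (L' f).B) (fun x =>
      relabelSign θ (fun f => (I f).e) (fun f => (I f).u) x •
        g (pullEquiv θ (fun f => (I f).e) x)) x =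
      relabelSign θ (fun f => (I f).e) (fun f => (I f).u) x •
        tot (fun i j => r' (θ i) (θ j)) (fun f => (L f).vs) (fun f => (L f).B) g
          (pullEquiv θ (fun f => (I f).e) x) :=
  tot_relabel (ι := fun f => (L f).ι) (ι' := fun f => (L' f).ι) θ (fun f => (I f).e)
    (fun f => (I f).u) (fun f => (I f).hu) (fun f => (L f).vs) (fun f => (L' f).vs) (fun f => (I f).map_vs)
    (fun f => (L f).B) (fun f => (L' f).B) (fun f => (I f).B) g x

theorem isTournament_comp {r : F' → F' → Prop} (hr : IsTournament r) (θ : F ≃ F') :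
    IsTournament fun i j => r (θ i) (θ j) :=
  ⟨fun _ => hr.irrefl _, fun _ _ h => hr.total _ _ (θ.injective.ne h)⟩

/-- Relabelling the factors of a tensor product along a bijection. -/
def prodRelabel (hr' : IsTournament r') (L : F → Loc k σ) (L' : F' → Loc k σ) (θ : F ≃ F')
    (I : ∀ f, Sim (L f) (L' (θ f))) :
    Iso (prod (isTournament_comp hr' θ) L) (prod hr' L') :=
  prodIsoOfSigns _ hr' L L' (pullEquiv θ fun f => (I f).e)
    (relabelSign θ (fun f => (I f).e) (fun f => (I f).u))
    (relabelSign_mul_self θ _ _ fun f => (I f).hu)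
    (sum_pullEquiv θ _ _ _ fun f => (I f).hd) (sum_pullEquiv θ _ _ _ fun f => (I f).vd)
    (sum_pullEquiv θ _ _ _ fun f => (I f).qd)
    (tot_relabel_hs L L' θ I) (tot_relabel_vs L L' θ I)

/-- Relabelling the factors of a tensor product along a bijection, in any orders. -/
def prodReindex {r : F → F → Prop} (hr : IsTournament r) (hr' : IsTournament r')
    (L : F → Loc k σ) (L' : F' → Loc k σ) (θ : F ≃ F') (I : ∀ f, Sim (L f) (L' (θ f))) :
    Iso (prod hr L) (prod hr' L') :=
  (prodReorder hr (isTournament_comp hr' θ) L).trans (prodRelabel hr' L L' θ I)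

end Relabel

/-! ### Renaming the variables -/

/-- Renaming the variables along a bijection. -/
def prodRename {F : Type} [Fintype F] [DecidableEq F] {r : F → F → Prop} (hr : IsTournament r)
    (L : F → Loc k V) (e : V ≃ W) (ψ : σ → V) :
    Iso ((prod hr L).restrict ψ) ((prod hr fun f => (L f).map e).restrict (e ∘ ψ)) :=
  have hgr : ∀ h v q (g : (∀ f, (L f).ι) → MvPolynomial V k),
      (fun x => rename e (g x)) ∈ (prod hr fun f => (L f).map e).gr h v q ↔
        g ∈ (prod hr L).gr h v q := by
    intro h v q g
    have key : ∀ x, (rename e (g x) = 0 ∨ h = ∑ f, (L f).hd (x f) ∧ v = ∑ f, (L f).vd (x f) ∧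
        ∃ n : ℕ, (rename e (g x)).IsHomogeneous n ∧ q = ∑ f, (L f).qd (x f) + 2 * n) ↔
        (g x = 0 ∨ h = ∑ f, (L f).hd (x f) ∧ v = ∑ f, (L f).vd (x f) ∧
        ∃ n : ℕ, (g x).IsHomogeneous n ∧ q = ∑ f, (L f).qd (x f) + 2 * n) := by
      intro x
      rw [map_eq_zero_iff _ (rename_injective _ e.injective)]
      simp only [IsHomogeneous.rename_isHomogeneous_iff e.injective]
    exact ⟨fun H x => (key x).1 (H x), fun H x => (key x).2 (H x)⟩
  Iso.ofBijective (C := (prod hr L).restrict ψ)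
    (D := (prod hr fun f => (L f).map e).restrict (e ∘ ψ))
    { toLin :=
        { toFun := fun (g : (∀ f, (L f).ι) → MvPolynomial V k) x => rename e (g x)
          map_add' := fun g g' => funext fun x => map_add _ _ _
          map_smul' := fun s g => funext fun x => by
            change rename e (rename ψ s * (show (∀ f, (L f).ι) → MvPolynomial V k from g) x) =
              rename (e ∘ ψ) s * rename e ((show (∀ f, (L f).ι) → MvPolynomial V k from g) x)
            rw [map_mul, rename_rename] }
      map_gr := fun {h v q g} hg => (hgr h v q g).2 hg
      comm_dh := fun g => funext fun x =>
        tot_comp _ (fun f => (L f).A) (fun f => ((L f).map e).A) (rename e).toAddMonoidHom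
          (fun f z w c => map_mul (rename e) _ _) g x
      comm_dv := fun g => funext fun x =>
        tot_comp _ (fun f => (L f).B) (fun f => ((L f).map e).B) (rename e).toAddMonoidHom
          (fun f z w c => map_mul (rename e) _ _) g x }
    (by
      refine ⟨fun g g' h => funext fun x => rename_injective _ e.injective (congrFun h x),
        fun g => ⟨fun x => rename e.symm
          ((show (∀ f, (L f).ι) → MvPolynomial W k from g) x), funext fun x => ?_⟩⟩
      change rename e (rename e.symm _) = _
      rw [rename_rename, Equiv.self_comp_symm, rename_id_apply])
    (fun h v q g => (hgr h v q g).1)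

end Loc
end
end KRTangle

namespace KRTangle
noncomputable section
open Bicomplex

/-! ### Division by the difference of two variables -/

section DivDiff

variable {k : Type u} [Field k] {V : Type}

/-- The substitution of the variable `a` for the extra variable. -/
def evalAt (a : V) : MvPolynomial (Option V) k →ₐ[k] MvPolynomial V k :=
  aeval fun o => o.elim (X a) X

@[simp]
theorem evalAt_X_none (a : V) : evalAt a (X none : MvPolynomial (Option V) k) = X a := by
  simp [evalAt]

@[simp]
theorem evalAt_X_some (a b : V) : evalAt a (X (some b) : MvPolynomial (Option V) k) = X b := by
  simp [evalAt]

@[simp]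
theorem evalAt_rename (a : V) (p : MvPolynomial V k) : evalAt a (rename some p) = p := by
  rw [evalAt, aeval_rename]
  exact aeval_X_left_apply p

theorem evalAt_isHomogeneous (a : V) {n : ℕ} {p : MvPolynomial (Option V) k}
    (hp : p.IsHomogeneous n) : (evalAt a p).IsHomogeneous n := by
  have := hp.aeval (fun o : Option V => (o.elim (X a) X : MvPolynomial V k)) (n := 1)
    (by rintro (_ | o) <;> exact isHomogeneous_X _ _)
  simpa [evalAt] using this

/-- The factor theorem. The polynomials that satisfy it are closed under sums and under
multiplication by variables; for a variable itself the difference is `t - a` or `0`. -/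
theorem dvd_sub_evalAt (a : V) (p : MvPolynomial (Option V) k) :
    (X none - X (some a)) ∣ p - rename some (evalAt a p) := by
  induction p using MvPolynomial.induction_on with
  | C c => simp [evalAt]
  | add p q hp hq =>
    rw [map_add, map_add, add_sub_add_comm]
    exact dvd_add hp hq
  | mul_X p o hp =>
    rw [map_mul, map_mul, show p * X o - rename some (evalAt a p) * rename some (evalAt a (X o)) =
      (p - rename some (evalAt a p)) * X o +
        rename some (evalAt a p) * (X o - rename some (evalAt a (X o))) by ring]
    refine dvd_add (hp.mul_right _) (Dvd.dvd.mul_left ?_ _)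
    cases o <;> simp

theorem X_none_sub_ne_zero (a : V) : (X none - X (some a) : MvPolynomial (Option V) k) ≠ 0 := by
  rw [sub_ne_zero]
  exact fun h => by simpa using X_injective h

/-- The quotient of `p - p(a)` by `t - a`, where `t` is the extra variable. -/
def divDiff (a : V) (p : MvPolynomial (Option V) k) : MvPolynomial (Option V) k :=
  (dvd_sub_evalAt a p).choose

theorem mul_divDiff (a : V) (p : MvPolynomial (Option V) k) :
    (X none - X (some a)) * divDiff a p = p - rename some (evalAt a p) :=
  (dvd_sub_evalAt a p).choose_spec.symm

/-- The quotient was merely chosen, so its properties follow from uniqueness: the polynomial ring is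
a domain and `t - a` is not zero. -/
theorem divDiff_eq_of_mul {a : V} {p q : MvPolynomial (Option V) k}
    (h : (X none - X (some a)) * q = p - rename some (evalAt a p)) : divDiff a p = q :=
  mul_left_cancel₀ (X_none_sub_ne_zero a) ((mul_divDiff a p).trans h.symm)

theorem divDiff_add (a : V) (p q : MvPolynomial (Option V) k) :
    divDiff a (p + q) = divDiff a p + divDiff a q :=
  divDiff_eq_of_mul (by rw [mul_add, mul_divDiff, mul_divDiff, map_add, map_add]; ring)

/-- Linearity over the polynomials without `t`. This is why the division commutes with the
differentials of all factors in which the mark does not occur. -/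
theorem divDiff_rename_mul (a : V) (c : MvPolynomial V k) (p : MvPolynomial (Option V) k) :
    divDiff a (rename some c * p) = rename some c * divDiff a p :=
  divDiff_eq_of_mul (by
    rw [mul_left_comm, mul_divDiff, map_mul, map_mul, evalAt_rename]; ring)

theorem divDiff_self_mul (a : V) (p : MvPolynomial (Option V) k) :
    divDiff a ((X none - X (some a)) * p) = p :=
  divDiff_eq_of_mul (by simp)

/-- Division by `t - a` as an additive map. -/
def divDiffHom (a : V) : MvPolynomial (Option V) k →+ MvPolynomial (Option V) k :=
  AddMonoidHom.mk' (divDiff a) (divDiff_add a)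

/-- This serves to read off the degrees of a quotient from those of the dividend. -/
theorem homogeneousComponent_mul_of_isHomogeneous {σ : Type} {m : ℕ} {p : MvPolynomial σ k}
    (hp : p.IsHomogeneous m) (q : MvPolynomial σ k) (j : ℕ) :
    homogeneousComponent (m + j) (p * q) = p * homogeneousComponent j q := by
  conv_lhs => rw [← sum_homogeneousComponent q]
  rw [Finset.mul_sum, map_sum]
  have h : ∀ i, homogeneousComponent (m + j) (p * homogeneousComponent i q) =
      if i = j then p * homogeneousComponent j q else 0 := by
    intro i
    rw [homogeneousComponent_of_mem (hp.mul (homogeneousComponent_isHomogeneous i q))]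
    by_cases hij : i = j
    · simp [hij]
    · rw [if_neg (by omega), if_neg hij]
  simp only [h, Finset.sum_ite_eq', Finset.mem_range]
  split_ifs with hj
  · rfl
  · rw [homogeneousComponent_eq_zero _ _ (by omega), mul_zero]

/-- Since `t - a` is a nonzero form of degree one, a nonzero component of the quotient in degree `j`
gives one of the product in degree `j + 1`. For `n = 0` this leaves only the quotient zero, hence
the first alternative. -/
theorem divDiff_isHomogeneous (a : V) {n : ℕ} {p : MvPolynomial (Option V) k}
    (hp : p.IsHomogeneous n) : divDiff a p = 0 ∨ ∃ m, n = m + 1 ∧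
      (divDiff a p).IsHomogeneous m := by
  have h1 : (X none - X (some a) : MvPolynomial (Option V) k).IsHomogeneous 1 := hom_sub _ _
  have h2 : ((X none - X (some a)) * divDiff a p).IsHomogeneous n := by
    rw [mul_divDiff]
    exact hp.sub (evalAt_isHomogeneous a hp).rename_isHomogeneous
  have h3 : ∀ j, 1 + j ≠ n → homogeneousComponent j (divDiff a p) = 0 := by
    intro j hj
    have := homogeneousComponent_mul_of_isHomogeneous h1 (divDiff a p) j
    rw [homogeneousComponent_of_mem h2, if_neg (by omega)] at this
    exact (mul_eq_zero.1 this.symm).resolve_left (X_none_sub_ne_zero a)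
  rcases n with - | m
  · left
    rw [← sum_homogeneousComponent (divDiff a p)]
    exact Finset.sum_eq_zero fun j _ => h3 j (by omega)
  · refine Or.inr ⟨m, rfl, ?_⟩
    rw [← sum_homogeneousComponent (divDiff a p)]
    refine IsHomogeneous.sum _ _ _ fun j _ => ?_
    by_cases hj : j = m
    · rw [hj]; exact homogeneousComponent_isHomogeneous m _
    · rw [h3 j (by omega)]; exact isHomogeneous_zero _ _ _

end DivDiff

/-! ### Splitting off a factor -/

section Option

variable {G : Type} [Fintype G] [DecidableEq G]

/-- The order on `Option G` with `none` below everything else. -/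
def optRel (r : G → G → Prop) : Option G → Option G → Prop
  | none, some _ => True
  | some a, some b => r a b
  | _, none => False

theorem isTournament_optRel {r : G → G → Prop} (hr : IsTournament r) :
    IsTournament (optRel r) where
  irrefl := by
    rintro (_ | a)
    · exact id
    · exact hr.irrefl a
  total := by
    rintro (_ | a) (_ | b) h
    · exact absurd rfl h
    · simp [optRel]
    · simp [optRel]
    · exact hr.total a b fun h' => h (congrArg some h')

/-- The function on `Option G` with the given values. -/
def optCons {ι : Option G → Type} (z : ι none) (y : ∀ g, ι (some g)) : ∀ o, ι o
  | none => z
  | some g => y g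

theorem update_optCons_none {ι : Option G → Type} (z z' : ι none) (y : ∀ g, ι (some g)) :
    Function.update (optCons z y) none z' = optCons z' y := by
  funext o
  cases o
  · simp [optCons]
  · simp [optCons]

theorem update_optCons_some {ι : Option G → Type} (z : ι none) (y : ∀ g, ι (some g)) (i : G)
    (w : ι (some i)) :
    Function.update (optCons z y) (some i) w = optCons z (Function.update y i w) := by
  funext o
  cases o with
  | none => simp [optCons]
  | some g =>
    by_cases h : g = i
    · subst h; simp [optCons]
    · simp [optCons, h]

/-- The slot `none` is the lowest. Its operator carries no sign, and all other operators carry its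
sign: `D = d ⊗ 1 + s ⊗ D'`. -/
theorem tot_optCons {R : Type u} [CommRing R] (r : G → G → Prop) {ι : Option G → Type}
    [∀ o, Fintype (ι o)] (s : ∀ o, ι o → ℤ) (A : ∀ o, Matrix (ι o) (ι o) R)
    (g : (∀ o, ι o) → R) (z : ι none) (y : ∀ g, ι (some g)) :
    tot (optRel r) s A g (optCons z y) = ∑ z', A none z z' * g (optCons z' y) +
      s none z • tot r (fun f => s (some f)) (fun f => A (some f)) (fun y' => g (optCons z y'))
        y := by
  classical
  rw [tot_apply, Fintype.sum_option]
  congr 1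
  · rw [show sgnBelow (optRel r) s none (optCons z y) = 1 from
      Finset.prod_eq_one fun o _ => by cases o <;> simp [optRel], one_smul]
    exact Finset.sum_congr rfl fun z' _ => by rw [update_optCons_none]; rfl
  · rw [tot_apply, Finset.smul_sum]
    refine Finset.sum_congr rfl fun i _ => ?_
    have h : sgnBelow (optRel r) s (some i) (optCons z y) =
        s none z * sgnBelow r (fun f => s (some f)) i y := by
      rw [sgnBelow, Fintype.prod_option, sgnBelow]
      congr 1
      · simp [optRel, optCons]
    rw [h, mul_smul]
    congr 2
    exact Finset.sum_congr rfl fun w _ => by rw [update_optCons_some]; rfl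

end Option

namespace Loc

variable {k : Type u} [Field k] {V : Type}

/-- The local data of the two-term Koszul complex. -/
def koszul (x : MvPolynomial V k) (hx : x.IsHomogeneous 1) : Loc k V where
  ι := Fin 2
  hd := ![0, -1]
  vd := 0
  qd := 0
  A := !![0, x; 0, 0]
  B := 0
  hA := by
    intro i j
    fin_cases i <;> fin_cases j <;> simp
    exact Or.inr hx
  hB := by simp
  hAA := by ext i j; fin_cases i <;> fin_cases j <;> simp [Matrix.mul_apply]
  hBB := by simp
  hAB := by simp

variable {G : Type} [Fintype G] [DecidableEq G]

/-- A family of local data, and the edges from `a` to the extra variable and from there to `b`. -/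
def withMark (M : G → Loc k V) (a b : V) : Option (Option G) → Loc k (Option V)
  | none => koszul (X none - X (some a)) (hom_sub _ _)
  | some none => koszul (X none - X (some b)) (hom_sub _ _)
  | some (some g) => (M g).map some

/-- A family of local data, and the edge from `a` to `b`. -/
def withEdge (M : G → Loc k V) (a b : V) : Option G → Loc k V
  | none => koszul (X a - X b) (hom_sub _ _)
  | some g => M g

section Elim

variable {r : G → G → Prop} (hr : IsTournament r) (M : G → Loc k V) (a b : V)

/-- The basis element with the given components. -/
def markIdx (z w : Fin 2) (y : ∀ g, (M g).ι) : ∀ o, (withMark M a b o).ι :=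
  optCons (ι := fun o => (withMark M a b o).ι) z
    (optCons (ι := fun o => (withMark M a b (some o)).ι) w y)

/-- The basis element with the given components. -/
def edgeIdx (w : Fin 2) (y : ∀ g, (M g).ι) : ∀ o, (withEdge M a b o).ι :=
  optCons (ι := fun o => (withEdge M a b o).ι) w y

theorem exists_markIdx (x : ∀ o, (withMark M a b o).ι) :
    ∃ z w y, x = markIdx M a b z w y := by
  refine ⟨x none, x (some none), fun g => x (some (some g)), ?_⟩
  funext o
  rcases o with _ | _ | o <;> rfl

theorem exists_edgeIdx (x : ∀ o, (withEdge M a b o).ι) : ∃ w y, x = edgeIdx M a b w y := by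
  refine ⟨x none, fun g => x (some g), ?_⟩
  funext o
  rcases o with _ | o <;> rfl

theorem sum_koszul_mul {R : Type u} [CommRing R] (x : R) (g : Fin 2 → R) (z : Fin 2) :
    ∑ z', !![0, x; 0, 0] z z' * g z' = if z = 0 then x * g 1 else 0 := by
  fin_cases z <;> simp

theorem negOnePow_koszul (z : Fin 2) :
    (((![0, -1] : Fin 2 → ℤ) z).negOnePow : ℤ) = if z = 0 then 1 else -1 := by
  fin_cases z <;> simp

/-- The horizontal total operator of the remaining factors. -/
abbrev restH (r : G → G → Prop) (M : G → Loc k V) :=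
  tot r (fun f => (M f).hs) fun f => ((M f).map some).A

/-- The vertical total operator of the remaining factors. -/
abbrev restV (r : G → G → Prop) (M : G → Loc k V) :=
  tot r (fun f => (M f).vs) fun f => ((M f).map some).B

/-- The coordinate `z` belongs to the factor `t - a` and `w` to `t - b`; the value `0` stands for
the generator of degree `0` and `1` for that of degree `-1`. All later verifications are case
distinctions in `z` and `w`. -/
theorem withMark_dh (g : (∀ o, (withMark M a b o).ι) → MvPolynomial (Option V) k) (z w : Fin 2)
    (y : ∀ g, (M g).ι) :
    tot (optRel (optRel r)) (fun f => (withMark M a b f).hs) (fun f => (withMark M a b f).A) g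
        (markIdx M a b z w y) =
      (if z = 0 then (X none - X (some a)) * g (markIdx M a b 1 w y) else 0) +
      (if z = 0 then (1 : ℤ) else -1) •
        ((if w = 0 then (X none - X (some b)) * g (markIdx M a b z 1 y) else 0) +
          (if w = 0 then (1 : ℤ) else -1) • restH r M (fun y => g (markIdx M a b z w y)) y) := by
  rw [← sum_koszul_mul _ (fun z' => g (markIdx M a b z' w y)),
    ← sum_koszul_mul _ (fun w' => g (markIdx M a b z w' y)), ← negOnePow_koszul,
    ← negOnePow_koszul]
  refine (tot_optCons (ι := fun o => (withMark M a b o).ι) (optRel r) _ _ g z _).trans ?_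
  refine congrArg₂ (· + ·) rfl (congrArg₂ (· • ·) rfl ?_)
  exact tot_optCons (ι := fun o => (withMark M a b (some o)).ι) r _ _ _ w y

/-- The Koszul factors lie in vertical degree zero and have no vertical differential, so they
contribute neither terms nor signs. -/
theorem withMark_dv (g : (∀ o, (withMark M a b o).ι) → MvPolynomial (Option V) k) (z w : Fin 2)
    (y : ∀ g, (M g).ι) :
    tot (optRel (optRel r)) (fun f => (withMark M a b f).vs) (fun f => (withMark M a b f).B) g
        (markIdx M a b z w y) = restV r M (fun y => g (markIdx M a b z w y)) y := by
  refine (tot_optCons (ι := fun o => (withMark M a b o).ι) (optRel r) _ _ g z _).trans ?_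
  rw [Finset.sum_eq_zero fun z' _ => zero_mul _, zero_add]
  refine (one_smul ℤ _).trans ?_
  refine (tot_optCons (ι := fun o => (withMark M a b (some o)).ι) r _ _ _ w y).trans ?_
  rw [Finset.sum_eq_zero fun z' _ => zero_mul _, zero_add]
  exact one_smul ℤ _

theorem withEdge_dh (g : (∀ o, (withEdge M a b o).ι) → MvPolynomial V k) (w : Fin 2)
    (y : ∀ g, (M g).ι) :
    tot (optRel r) (fun f => (withEdge M a b f).hs) (fun f => (withEdge M a b f).A) g
        (edgeIdx M a b w y) =
      (if w = 0 then (X a - X b) * g (edgeIdx M a b 1 y) else 0) +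
        (if w = 0 then (1 : ℤ) else -1) •
          tot r (fun f => (M f).hs) (fun f => (M f).A) (fun y => g (edgeIdx M a b w y)) y := by
  rw [← sum_koszul_mul _ (fun w' => g (edgeIdx M a b w' y)), ← negOnePow_koszul]
  exact tot_optCons (ι := fun o => (withEdge M a b o).ι) r _ _ g w y

theorem withEdge_dv (g : (∀ o, (withEdge M a b o).ι) → MvPolynomial V k) (w : Fin 2)
    (y : ∀ g, (M g).ι) :
    tot (optRel r) (fun f => (withEdge M a b f).vs) (fun f => (withEdge M a b f).B) g
        (edgeIdx M a b w y) =
      tot r (fun f => (M f).vs) (fun f => (M f).B) (fun y => g (edgeIdx M a b w y)) y := by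
  refine (tot_optCons (ι := fun o => (withEdge M a b o).ι) r _ _ g w y).trans ?_
  rw [Finset.sum_eq_zero fun z' _ => zero_mul _, zero_add]
  exact one_smul ℤ _

/-- Evaluation of the extra variable, and the projection to the degree zero part of the first
Koszul complex. -/
def elimFun : ((∀ o, (withMark M a b o).ι) → MvPolynomial (Option V) k) →+
    ((∀ o, (withEdge M a b o).ι) → MvPolynomial V k) where
  toFun g x := evalAt a (g (markIdx M a b 0 (x none) fun i => x (some i)))
  map_zero' := funext fun _ => map_zero _
  map_add' _ _ := funext fun _ => map_add _ _ _

theorem elimFun_apply (g : (∀ o, (withMark M a b o).ι) → MvPolynomial (Option V) k) (w : Fin 2)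
    (y : ∀ g, (M g).ι) :
    elimFun M a b g (edgeIdx M a b w y) = evalAt a (g (markIdx M a b 0 w y)) := rfl

/-- The components of `elimInv`. -/
def elimInvAux (c : (∀ o, (withEdge M a b o).ι) → MvPolynomial V k) (z w : Fin 2)
    (y : ∀ g, (M g).ι) : MvPolynomial (Option V) k :=
  if z = 0 then rename some (c (edgeIdx M a b w y))
    else if w = 0 then -rename some (c (edgeIdx M a b 1 y)) else 0

/-- The homotopy inverse of `elimFun`. -/
def elimInv : ((∀ o, (withEdge M a b o).ι) → MvPolynomial V k) →+
    ((∀ o, (withMark M a b o).ι) → MvPolynomial (Option V) k) where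
  toFun c x := elimInvAux M a b c (x none) (x (some none)) fun i => x (some (some i))
  map_zero' := funext fun x => by simp [elimInvAux]
  map_add' c c' := funext fun x => by
    simp only [elimInvAux, Pi.add_apply, map_add]
    split_ifs <;> simp [add_comm]

theorem elimInv_apply (c : (∀ o, (withEdge M a b o).ι) → MvPolynomial V k) (z w : Fin 2)
    (y : ∀ g, (M g).ι) :
    elimInv M a b c (markIdx M a b z w y) = if z = 0 then rename some (c (edgeIdx M a b w y))
      else if w = 0 then -rename some (c (edgeIdx M a b 1 y)) else 0 := rfl

theorem elimInv_smul (p : MvPolynomial V k)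
    (c : (∀ o, (withEdge M a b o).ι) → MvPolynomial V k) (x : ∀ o, (withMark M a b o).ι) :
    elimInv M a b (p • c) x = rename some p * elimInv M a b c x := by
  obtain ⟨z, w, y, rfl⟩ := exists_markIdx M a b x
  simp only [elimInv_apply, Pi.smul_apply, smul_eq_mul, map_mul]
  split_ifs <;> simp

/-- The components of `elimHtpy`. -/
def elimHtpyAux (g : (∀ o, (withMark M a b o).ι) → MvPolynomial (Option V) k) (z w : Fin 2)
    (y : ∀ g, (M g).ι) : MvPolynomial (Option V) k :=
  if z = 0 then 0 else divDiff a (g (markIdx M a b 0 w y))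

/-- The homotopy from the identity to the composite of `elimFun` and `elimInv`. -/
def elimHtpy : ((∀ o, (withMark M a b o).ι) → MvPolynomial (Option V) k) →+
    ((∀ o, (withMark M a b o).ι) → MvPolynomial (Option V) k) where
  toFun g x := elimHtpyAux M a b g (x none) (x (some none)) fun i => x (some (some i))
  map_zero' := funext fun x => by
    simp only [elimHtpyAux, Pi.zero_apply]
    split_ifs
    · rfl
    · exact map_zero (divDiffHom a)
  map_add' g g' := funext fun x => by
    simp only [elimHtpyAux, Pi.add_apply]
    split_ifs
    · rw [add_zero]
    · exact divDiff_add a _ _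

theorem elimHtpy_apply (g : (∀ o, (withMark M a b o).ι) → MvPolynomial (Option V) k)
    (z w : Fin 2) (y : ∀ g, (M g).ι) :
    elimHtpy M a b g (markIdx M a b z w y) = if z = 0 then 0
      else divDiff a (g (markIdx M a b 0 w y)) := rfl

theorem elimHtpy_smul (p : MvPolynomial V k)
    (g : (∀ o, (withMark M a b o).ι) → MvPolynomial (Option V) k)
    (x : ∀ o, (withMark M a b o).ι) :
    elimHtpy M a b (fun x => rename some p * g x) x = rename some p * elimHtpy M a b g x := by
  obtain ⟨z, w, y, rfl⟩ := exists_markIdx M a b x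
  simp only [elimHtpy_apply]
  split_ifs
  · rw [mul_zero]
  · exact divDiff_rename_mul a _ _

section Degrees

theorem sum_markIdx (d : ∀ o, (withMark M a b o).ι → ℤ) (z w : Fin 2) (y : ∀ g, (M g).ι) :
    ∑ o, d o (markIdx M a b z w y o) =
      d none z + (d (some none) w + ∑ g, d (some (some g)) (y g)) := by
  rw [Fintype.sum_option, Fintype.sum_option]
  rfl

theorem sum_edgeIdx (d : ∀ o, (withEdge M a b o).ι → ℤ) (w : Fin 2) (y : ∀ g, (M g).ι) :
    ∑ o, d o (edgeIdx M a b w y o) = d none w + ∑ g, d (some g) (y g) := by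
  rw [Fintype.sum_option]
  rfl

/-- Both generators of a Koszul factor have vertical and polynomial degree zero, so `z` and `w`
enter only the horizontal degree. -/
theorem mem_gr_withMark (g : (∀ o, (withMark M a b o).ι) → MvPolynomial (Option V) k)
    (h v q : ℤ) :
    g ∈ (prod (isTournament_optRel (isTournament_optRel hr)) (withMark M a b)).gr h v q ↔
      ∀ (z w : Fin 2) (y : ∀ g, (M g).ι), g (markIdx M a b z w y) = 0 ∨
        h = ![0, -1] z + (![0, -1] w + ∑ g, (M g).hd (y g)) ∧ v = ∑ g, (M g).vd (y g) ∧
        ∃ n : ℕ, (g (markIdx M a b z w y)).IsHomogeneous n ∧ q = ∑ g, (M g).qd (y g) + 2 * n := by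
  have key : ∀ (z w : Fin 2) (y : ∀ g, (M g).ι),
      (![0, -1] z + (![0, -1] w + ∑ g, (M g).hd (y g)) =
        ∑ o, (withMark M a b o).hd (markIdx M a b z w y o)) ∧
      (∑ g, (M g).vd (y g) = ∑ o, (withMark M a b o).vd (markIdx M a b z w y o)) ∧
      (∑ g, (M g).qd (y g) = ∑ o, (withMark M a b o).qd (markIdx M a b z w y o)) := by
    intro z w y
    rw [sum_markIdx M a b (fun o => (withMark M a b o).hd),
      sum_markIdx M a b (fun o => (withMark M a b o).vd),
      sum_markIdx M a b (fun o => (withMark M a b o).qd)]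
    refine ⟨rfl, ?_, ?_⟩ <;> exact ((zero_add _).trans (zero_add _)).symm
  constructor
  · intro H z w y
    obtain ⟨h1, h2, h3⟩ := key z w y
    rw [h1, h2, h3]
    exact H _
  · intro H x
    obtain ⟨z, w, y, rfl⟩ := exists_markIdx M a b x
    obtain ⟨h1, h2, h3⟩ := key z w y
    have := H z w y
    rwa [h1, h2, h3] at this

theorem mem_gr_withEdge (g : (∀ o, (withEdge M a b o).ι) → MvPolynomial V k) (h v q : ℤ) :
    g ∈ (prod (isTournament_optRel hr) (withEdge M a b)).gr h v q ↔
      ∀ (w : Fin 2) (y : ∀ g, (M g).ι), g (edgeIdx M a b w y) = 0 ∨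
        h = ![0, -1] w + ∑ g, (M g).hd (y g) ∧ v = ∑ g, (M g).vd (y g) ∧
        ∃ n : ℕ, (g (edgeIdx M a b w y)).IsHomogeneous n ∧ q = ∑ g, (M g).qd (y g) + 2 * n := by
  have key : ∀ (w : Fin 2) (y : ∀ g, (M g).ι),
      (![0, -1] w + ∑ g, (M g).hd (y g) =
        ∑ o, (withEdge M a b o).hd (edgeIdx M a b w y o)) ∧
      (∑ g, (M g).vd (y g) = ∑ o, (withEdge M a b o).vd (edgeIdx M a b w y o)) ∧
      (∑ g, (M g).qd (y g) = ∑ o, (withEdge M a b o).qd (edgeIdx M a b w y o)) := by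
    intro w y
    rw [sum_edgeIdx M a b (fun o => (withEdge M a b o).hd),
      sum_edgeIdx M a b (fun o => (withEdge M a b o).vd),
      sum_edgeIdx M a b (fun o => (withEdge M a b o).qd)]
    refine ⟨rfl, ?_, ?_⟩ <;> exact (zero_add _).symm
  constructor
  · intro H w y
    obtain ⟨h1, h2, h3⟩ := key w y
    rw [h1, h2, h3]
    exact H _
  · intro H x
    obtain ⟨w, y, rfl⟩ := exists_edgeIdx M a b x
    obtain ⟨h1, h2, h3⟩ := key w y
    have := H w y
    rwa [h1, h2, h3] at this

end Degrees

/-- The matrices of the remaining factors do not contain `t`. Hence substitution commutes with their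
operators, and so do the inclusion of coefficients and the division by `t - a` in the next two
statements. -/
theorem evalAt_rest (s : ∀ f, (M f).ι → ℤ) (A : ∀ f, Matrix (M f).ι (M f).ι (MvPolynomial V k))
    (g : (∀ f, (M f).ι) → MvPolynomial (Option V) k) (y : ∀ f, (M f).ι) :
    evalAt a (tot r s (fun f => (A f).map (rename some)) g y) =
      tot r s A (fun y => evalAt a (g y)) y :=
  tot_comp s _ A (evalAt a).toAddMonoidHom (fun _ _ _ c => by
    change evalAt a (rename some _ * c) = _ * evalAt a c
    rw [map_mul, evalAt_rename]) g y

theorem rename_rest (s : ∀ f, (M f).ι → ℤ) (A : ∀ f, Matrix (M f).ι (M f).ι (MvPolynomial V k))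
    (g : (∀ f, (M f).ι) → MvPolynomial V k) (y : ∀ f, (M f).ι) :
    rename some (tot r s A g y) =
      tot r s (fun f => (A f).map (rename some)) (fun y => rename some (g y)) y :=
  tot_comp s A (fun f => (A f).map (rename some)) (rename some).toAddMonoidHom
    (fun f z w c => map_mul (rename some) _ _) g y

theorem divDiff_rest (s : ∀ f, (M f).ι → ℤ) (A : ∀ f, Matrix (M f).ι (M f).ι (MvPolynomial V k))
    (g : (∀ f, (M f).ι) → MvPolynomial (Option V) k) (y : ∀ f, (M f).ι) :
    divDiff a (tot r s (fun f => (A f).map (rename some)) g y) =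
      tot r s (fun f => (A f).map (rename some)) (fun y => divDiff a (g y)) y :=
  tot_comp s _ (fun f => (A f).map (rename some)) (divDiffHom a)
    (fun f z w c => divDiff_rename_mul a (A f z w) c) g y

/-- The substitution `t = a` kills the term of the first Koszul factor and turns `t - b` into `a -
b`. -/
theorem elimFun_dh (g : (∀ o, (withMark M a b o).ι) → MvPolynomial (Option V) k) :
    elimFun M a b (tot (optRel (optRel r)) (fun f => (withMark M a b f).hs)
      (fun f => (withMark M a b f).A) g) =
    tot (optRel r) (fun f => (withEdge M a b f).hs) (fun f => (withEdge M a b f).A)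
      (elimFun M a b g) := by
  funext x
  obtain ⟨w, y, rfl⟩ := exists_edgeIdx M a b x
  rw [withEdge_dh M a b (elimFun M a b g), elimFun_apply, withMark_dh]
  simp only [elimFun_apply, map_add, map_zsmul, restH, ← evalAt_rest M a]
  fin_cases w <;> simp

theorem elimFun_dv (g : (∀ o, (withMark M a b o).ι) → MvPolynomial (Option V) k) :
    elimFun M a b (tot (optRel (optRel r)) (fun f => (withMark M a b f).vs)
      (fun f => (withMark M a b f).B) g) =
    tot (optRel r) (fun f => (withEdge M a b f).vs) (fun f => (withEdge M a b f).B)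
      (elimFun M a b g) := by
  funext x
  obtain ⟨w, y, rfl⟩ := exists_edgeIdx M a b x
  rw [withEdge_dv M a b (elimFun M a b g), elimFun_apply, withMark_dv]
  exact evalAt_rest M a _ _ _ _

/-- Evaluation of the extra variable as a morphism. -/
def elimHom : Hom ((prod (isTournament_optRel (isTournament_optRel hr))
    (withMark M a b)).restrict some) (prod (isTournament_optRel hr) (withEdge M a b)) where
  toLin :=
    { toFun := elimFun M a b
      map_add' := (elimFun M a b).map_add
      map_smul' := fun c (g : (∀ o, (withMark M a b o).ι) → MvPolynomial (Option V) k) =>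
        funext fun x => by
          change evalAt a (rename some c * _) = c * evalAt a _
          rw [map_mul, evalAt_rename] }
  map_gr {h v q} g hg := by
    refine (mem_gr_withEdge hr M a b _ h v q).2 ?_
    intro w y
    rcases (mem_gr_withMark hr M a b g h v q).1 hg 0 w y with h0 | ⟨h1, h2, n, h3, h4⟩
    · exact Or.inl ((congrArg (evalAt a) h0).trans (map_zero _))
    · exact Or.inr ⟨by simpa using h1, h2, n, evalAt_isHomogeneous a h3, h4⟩
  comm_dh g := elimFun_dh M a b g
  comm_dv g := elimFun_dv M a b g

/-- The generator of the joined edge has to go to the generator of `t - b` minus the generator of `t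
- a`, since `(t - b) - (t - a) = a - b`. This is the origin of the negative component of `elimInv`
at `z = 1`, `w = 0`. -/
theorem elimInv_dh (g : (∀ o, (withEdge M a b o).ι) → MvPolynomial V k) :
    elimInv M a b (tot (optRel r) (fun f => (withEdge M a b f).hs)
      (fun f => (withEdge M a b f).A) g) =
    tot (optRel (optRel r)) (fun f => (withMark M a b f).hs) (fun f => (withMark M a b f).A)
      (elimInv M a b g) := by
  funext x
  obtain ⟨z, w, y, rfl⟩ := exists_markIdx M a b x
  rw [withMark_dh M a b (elimInv M a b g)]
  simp only [elimInv_apply]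
  rw [withEdge_dh, withEdge_dh]
  have h0 := fun w => rename_rest (r := r) M (fun f => (M f).hs) (fun f => (M f).A)
    (fun y => g (edgeIdx M a b w y)) y
  have h2 : ∀ f : (∀ f, (M f).ι) → MvPolynomial (Option V) k,
      restH r M (fun y => -f y) y = -restH r M f y := fun f =>
    congrFun (map_neg (restH r M) f) y
  have h3 : restH r M (fun y => 0) y = 0 := congrFun (map_zero (restH r M)) y
  fin_cases z <;> fin_cases w <;> simp [h0, h2, h3]
  ring

theorem elimInv_dv (g : (∀ o, (withEdge M a b o).ι) → MvPolynomial V k) :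
    elimInv M a b (tot (optRel r) (fun f => (withEdge M a b f).vs)
      (fun f => (withEdge M a b f).B) g) =
    tot (optRel (optRel r)) (fun f => (withMark M a b f).vs) (fun f => (withMark M a b f).B)
      (elimInv M a b g) := by
  funext x
  obtain ⟨z, w, y, rfl⟩ := exists_markIdx M a b x
  rw [withMark_dv M a b (elimInv M a b g)]
  simp only [elimInv_apply]
  rw [withEdge_dv, withEdge_dv, rename_rest, rename_rest]
  split_ifs
  · rfl
  · exact (congrFun (map_neg (restV r M) _) y).symm
  · exact (congrFun (map_zero (restV r M)) y).symm

/-- The homotopy inverse of `elimHom`. -/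
def elimInvHom : Hom (prod (isTournament_optRel hr) (withEdge M a b))
    ((prod (isTournament_optRel (isTournament_optRel hr)) (withMark M a b)).restrict some) where
  toLin :=
    { toFun := elimInv M a b
      map_add' := (elimInv M a b).map_add
      map_smul' := fun c g => funext fun x => elimInv_smul M a b c g x }
  map_gr {h v q} := fun {g : (∀ o, (withEdge M a b o).ι) → MvPolynomial V k} hg => by
    refine (mem_gr_withMark hr M a b _ h v q).2 ?_
    intro z w y
    change elimInv M a b g _ = 0 ∨ _ ∧ _ ∧ ∃ n : ℕ, (elimInv M a b g _).IsHomogeneous n ∧ _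
    simp only [elimInv_apply]
    have H := (mem_gr_withEdge hr M a b g h v q).1 hg
    split_ifs with h0 h1
    · rcases H w y with h2 | ⟨h1, h2, n, h3, h4⟩
      · exact Or.inl (by rw [h2, map_zero])
      · exact Or.inr ⟨by simpa [h0] using h1, h2, n, h3.rename_isHomogeneous, h4⟩
    · rcases H 1 y with h2 | ⟨h3, h2, n, h4, h5⟩
      · exact Or.inl (by rw [h2, map_zero, neg_zero])
      · refine Or.inr ⟨?_, h2, n, h4.rename_isHomogeneous.neg, h5⟩
        obtain rfl : z = 1 := by omega
        simpa [h1] using h3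
    · exact Or.inl rfl
  comm_dh g := elimInv_dh M a b g
  comm_dv g := elimInv_dv M a b g

theorem elimHtpy_dv (g : (∀ o, (withMark M a b o).ι) → MvPolynomial (Option V) k) :
    elimHtpy M a b (tot (optRel (optRel r)) (fun f => (withMark M a b f).vs)
      (fun f => (withMark M a b f).B) g) =
    tot (optRel (optRel r)) (fun f => (withMark M a b f).vs) (fun f => (withMark M a b f).B)
      (elimHtpy M a b g) := by
  funext x
  obtain ⟨z, w, y, rfl⟩ := exists_markIdx M a b x
  rw [withMark_dv M a b (elimHtpy M a b g)]
  simp only [elimHtpy_apply]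
  rw [withMark_dv]
  split_ifs
  · exact (congrFun (map_zero (restV r M)) y).symm
  · exact divDiff_rest M a _ _ _ _

/-- For `z = 0` this is the identity `(t - a) * divDiff a p = p - p(a)`. For `z = 1` division undoes
multiplication by `t - a`, and the interplay of the division with `t - b` produces the correction
term of `elimInv`. -/
theorem elimHtpy_dh (g : (∀ o, (withMark M a b o).ι) → MvPolynomial (Option V) k) :
    g - elimInv M a b (elimFun M a b g) =
      tot (optRel (optRel r)) (fun f => (withMark M a b f).hs) (fun f => (withMark M a b f).A)
        (elimHtpy M a b g) +
      elimHtpy M a b (tot (optRel (optRel r)) (fun f => (withMark M a b f).hs)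
        (fun f => (withMark M a b f).A) g) := by
  funext x
  obtain ⟨z, w, y, rfl⟩ := exists_markIdx M a b x
  rw [Pi.sub_apply, Pi.add_apply, withMark_dh M a b (elimHtpy M a b g)]
  simp only [elimInv_apply, elimHtpy_apply, elimFun_apply]
  rw [withMark_dh]
  have h3 : restH r M (fun y => 0) y = 0 := congrFun (map_zero (restH r M)) y
  have h4 : ∀ p q : MvPolynomial (Option V) k, divDiff a (p + q) = divDiff a p + divDiff a q :=
    divDiff_add a
  have h5 : ∀ p : MvPolynomial (Option V) k, divDiff a (-p) = -divDiff a p :=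
    map_neg (divDiffHom a)
  have h6 : ∀ w, divDiff a (restH r M (fun y => g (markIdx M a b 0 w y)) y) =
      restH r M (fun y => divDiff a (g (markIdx M a b 0 w y))) y := fun w =>
    divDiff_rest (r := r) M a (fun f => (M f).hs) (fun f => (M f).A)
      (fun y => g (markIdx M a b 0 w y)) y
  -- Write `t - b = (t - a) + (a - b)`. The first part is divided out, and the second does not
  -- involve `t`.
  have h7 : divDiff a ((X none - X (some b)) * g (markIdx M a b 0 1 y)) =
      g (markIdx M a b 0 1 y) +
        (X (some a) - X (some b)) * divDiff a (g (markIdx M a b 0 1 y)) := by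
    rw [show (X none - X (some b) : MvPolynomial (Option V) k) =
      (X none - X (some a)) + rename some (X a - X b) by simp, add_mul, h4,
      divDiff_self_mul, divDiff_rename_mul]
    simp
  have h8 := fun w => mul_divDiff a (g (markIdx M a b 0 w y))
  fin_cases z <;> fin_cases w <;>
    simp [h3, h4, h5, h6, h7, h8, divDiff_self_mul]
  -- Only `z = 1`, `w = 0` is left. With `q` the quotient for `w = 1`, the terms `-(t - b) * q + (a
  -- - b) * q` add up to `-(t - a) * q`, which leaves the value at `t = a`.
  linear_combination h8 1

/-- A mark in the interior of an edge can be erased. -/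
theorem htpyEquiv_withEdge :
    HtpyEquiv ((prod (isTournament_optRel (isTournament_optRel hr)) (withMark M a b)).restrict some)
      (prod (isTournament_optRel hr) (withEdge M a b)) := by
  refine (HtpyEquiv.symm ⟨elimInvHom hr M a b, elimHom hr M a b,
    .of_eq fun (c : (∀ o, (withEdge M a b o).ι) → MvPolynomial V k) => ?_, ?_⟩)
  · funext x
    obtain ⟨w, y, rfl⟩ := exists_edgeIdx M a b x
    change evalAt a (elimInv M a b c (markIdx M a b 0 w y)) = _
    rw [elimInv_apply, if_pos rfl, evalAt_rename]
    rfl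
  -- `Homotopic` asks for the composite minus the identity, while `elimHtpy_dh` computes the
  -- identity minus the composite; hence the sign.
  · refine ⟨-
      { toFun := elimHtpy M a b
        map_add' := (elimHtpy M a b).map_add
        map_smul' := fun c g => funext fun x => elimHtpy_smul M a b c g x }, ?_, ?_, ?_⟩
    · intro h v q (g : (∀ o, (withMark M a b o).ι) → MvPolynomial (Option V) k) hg
      refine neg_mem ((mem_gr_withMark hr M a b _ _ _ _).2 ?_)
      intro z w y
      change elimHtpy M a b g _ = 0 ∨ _ ∧ _ ∧ ∃ n : ℕ, (elimHtpy M a b g _).IsHomogeneous n ∧ _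
      simp only [elimHtpy_apply]
      split_ifs with h0
      · exact Or.inl rfl
      · rcases (mem_gr_withMark hr M a b g h v q).1 hg 0 w y with h1 | ⟨h1, h2, n, h3, h4⟩
        · refine Or.inl ?_
          rw [h1]
          exact map_zero (divDiffHom a)
        -- Division lowers the polynomial by one degree, that is `q` by two, while the passage from
        -- `z = 0` to `z = 1` lowers the horizontal degree by one.
        · rcases divDiff_isHomogeneous a h3 with h5 | ⟨m, rfl, h5⟩
          · exact Or.inl h5
          · obtain rfl : z = 1 := by omega
            refine Or.inr ⟨by simp at h1 ⊢; omega, h2, m, h5, by push_cast at h4; omega⟩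
    · intro g
      exact (congrArg Neg.neg (elimHtpy_dv M a b g)).trans (map_neg _ _).symm
    · intro g
      have h := elimHtpy_dh (r := r) M a b g
      have e := map_neg (tot (optRel (optRel r)) (fun f => (withMark M a b f).hs)
        (fun f => (withMark M a b f).A)) (elimHtpy M a b g)
      refine (neg_sub _ _).symm.trans ((congrArg Neg.neg h).trans ((neg_add _ _).trans ?_))
      exact congrArg₂ (· + ·) e.symm rfl

end Elim

end Loc
end
end KRTangle

/-! ### Homogeneous components, and bases over smaller polynomial rings. -/

namespace KRTangle
noncomputable section
open Bicomplex

namespace Bicomplex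

variable {k : Type u} [Field k] {σ τ : Type}

/-- The homogeneous components of elements are well defined. -/
def HasProj (C : Bicomplex k σ) : Prop :=
  ∃ π : ℤ → ℤ → ℤ → C.M →+ C.M, ∀ h v q h' v' q' x, x ∈ C.gr h' v' q' →
    π h v q x = open Classical in if h = h' ∧ v = v' ∧ q = q' then x else 0

theorem exists_sum_gr (C : Bicomplex k σ) (x : C.M) :
    ∃ y : ℤ × ℤ × ℤ →₀ C.M, (∀ d, y d ∈ C.gr d.1 d.2.1 d.2.2) ∧ x = y.sum fun _ m => m := by
  classical
  induction C.span_gr x using AddSubgroup.closure_induction with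
  | mem y hy =>
    obtain ⟨h, v, q, hy⟩ := hy
    refine ⟨Finsupp.single (h, v, q) y, fun d => ?_, by simp⟩
    rw [Finsupp.single_apply]
    split_ifs with hd
    · rw [← hd]; exact hy
    · exact zero_mem _
  | zero => exact ⟨0, fun _ => zero_mem _, by simp⟩
  | add y z _ _ hy hz =>
    obtain ⟨a, ha, rfl⟩ := hy
    obtain ⟨b, hb, rfl⟩ := hz
    exact ⟨a + b, fun d => add_mem (ha d) (hb d),
      (Finsupp.sum_add_index' (fun _ => rfl) fun _ _ _ => rfl).symm⟩
  | neg y _ hy =>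
    obtain ⟨a, ha, rfl⟩ := hy
    exact ⟨-a, fun d => neg_mem (ha d), by simp [Finsupp.sum_neg_index, Finsupp.sum]⟩

/-- A bijective morphism to a bicomplex with homogeneous components is an isomorphism. -/
def Iso.ofHasProj {C D : Bicomplex k σ} (f : Hom C D) (hf : Function.Bijective f.toLin)
    (hD : HasProj D) : Iso C D :=
  Iso.ofBijective f hf (by
    intro h v q x hx
    obtain ⟨π, hπ⟩ := hD
    obtain ⟨y, hy, rfl⟩ := C.exists_sum_gr x
    have h1 := hπ h v q h v q _ hx
    -- If the image of `x` is homogeneous, it equals the image of the part of `x` in that degree,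
    -- and injectivity identifies `x` with this part. Some decomposition of `x` is enough; its
    -- uniqueness has to be known only in the target.
    have h2 : π h v q (f.toLin (y.sum fun _ m => m)) = f.toLin (y (h, v, q)) := by
      classical
      rw [Finsupp.sum, map_sum, map_sum, Finset.sum_eq_single (h, v, q)]
      · rw [hπ h v q h v q _ (f.map_gr (hy (h, v, q)))]
        simp
      · rintro ⟨h', v', q'⟩ - hne
        rw [hπ h v q h' v' q' _ (f.map_gr (hy (h', v', q'))), if_neg]
        rintro ⟨rfl, rfl, rfl⟩
        exact hne rfl
      · intro hn
        rw [Finsupp.notMem_support_iff.1 hn, map_zero, map_zero]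
    rw [h2, if_pos ⟨rfl, rfl, rfl⟩] at h1
    rw [← hf.1 h1]
    exact hy (h, v, q))

/-- At the basis element `i`, degree `q` means polynomial degree `(q - qd i) / 2`. The conditions
`qd i ≤ q` and `2 ∣ q - qd i` exclude the cases in which truncation to a natural number would select
a wrong component. -/
theorem hasProj_freeGr {ι : Type} (hd vd qd : ι → ℤ) :
    ∃ π : ℤ → ℤ → ℤ → (ι → MvPolynomial σ k) →+ (ι → MvPolynomial σ k), ∀ h v q h' v' q' x,
      x ∈ freeGr k σ hd vd qd h' v' q' →
      π h v q x = open Classical in if h = h' ∧ v = v' ∧ q = q' then x else 0 := by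
  classical
  refine ⟨fun h v q =>
    { toFun := fun g i => if h = hd i ∧ v = vd i ∧ qd i ≤ q ∧ 2 ∣ q - qd i then
        homogeneousComponent ((q - qd i) / 2).toNat (g i) else 0
      map_zero' := by funext i; simp
      map_add' := fun g g' => by
        funext i
        simp only [Pi.add_apply, map_add]
        split_ifs <;> simp }, ?_⟩
  intro h v q h' v' q' g hg
  funext i
  change (if h = hd i ∧ v = vd i ∧ qd i ≤ q ∧ 2 ∣ q - qd i then
        homogeneousComponent ((q - qd i) / 2).toNat (g i) else 0) = _
  rcases hg i with h0 | ⟨rfl, rfl, n, h3, h4⟩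
  · rw [h0, map_zero, ite_self]
    split_ifs
    · exact h0.symm
    · rfl
  · by_cases hh : h = hd i ∧ v = vd i
    · obtain ⟨rfl, rfl⟩ := hh
      simp only [true_and]
      by_cases hq : q = q'
      · rw [if_pos hq, if_pos (by omega), show ((q - qd i) / 2).toNat = n by omega,
          homogeneousComponent_of_mem h3, if_pos rfl]
      · rw [if_neg hq]
        split_ifs with h5
        · rw [homogeneousComponent_of_mem h3, if_neg (by omega)]
          rfl
        · rfl
    · rw [if_neg (by tauto), if_neg (by tauto)]
      rfl

end Bicomplex

namespace Loc

variable {k : Type u} [Field k] {σ τ E : Type}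

section Prod

variable {F : Type} [Fintype F] [DecidableEq F] {r : F → F → Prop} (hr : IsTournament r)

theorem hasProj_restrict_prod (φ : σ → τ) (L : F → Loc k τ) :
    HasProj ((prod hr L).restrict φ) := hasProj_freeGr _ _ _

/-- Polynomials in two sets of variables as polynomials in the first set. -/
def sumLinearEquiv (k : Type u) [Field k] (σ E : Type) :
    letI : Module (MvPolynomial σ k) (MvPolynomial (E ⊕ σ) k) :=
      Module.compHom _ (rename (Sum.inr : σ → E ⊕ σ)).toRingHom
    MvPolynomial E (MvPolynomial σ k) ≃ₗ[MvPolynomial σ k] MvPolynomial (E ⊕ σ) k :=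
  letI : Module (MvPolynomial σ k) (MvPolynomial (E ⊕ σ) k) :=
    Module.compHom _ (rename (Sum.inr : σ → E ⊕ σ)).toRingHom
  { (sumRingEquiv k E σ).symm with
    map_smul' := fun c p => by
      have h : (sumRingEquiv k E σ).symm (C c) = rename Sum.inr c := by
        induction c using MvPolynomial.induction_on with
        | C a => simp
        | add p q hp hq => rw [C_add, map_add, hp, hq, map_add]
        | mul_X p i hp => rw [C_mul, map_mul, hp, map_mul]; simp
      change (sumRingEquiv k E σ).symm (c • p) = rename Sum.inr c * (sumRingEquiv k E σ).symm p
      rw [smul_eq_C_mul, map_mul, h] }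

theorem sumLinearEquiv_monomial (m : E →₀ ℕ) :
    sumLinearEquiv k σ E (monomial m 1) = rename Sum.inl (monomial m 1) := by
  have h : ∀ p : MvPolynomial E k, (sumRingEquiv k E σ).symm (MvPolynomial.map C p) =
      rename Sum.inl p := by
    intro p
    induction p using MvPolynomial.induction_on with
    | C a => simp
    | add p q hp hq => rw [map_add, map_add, hp, hq, map_add]
    | mul_X p i hp => rw [map_mul, map_mul, hp, map_mul]; simp
  rw [← h, map_monomial, C_1]
  rfl

open Classical in
/-- The basis of a product over a smaller polynomial ring. -/
def restrictBasis (L : F → Loc k (E ⊕ σ)) :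
    Module.Basis ((∀ f, (L f).ι) × (E →₀ ℕ)) (MvPolynomial σ k)
      ((prod hr L).restrict (Sum.inr : σ → E ⊕ σ)).M :=
  letI : Module (MvPolynomial σ k) (MvPolynomial (E ⊕ σ) k) :=
    Module.compHom _ (rename (Sum.inr : σ → E ⊕ σ)).toRingHom
  let b : Module.Basis (E →₀ ℕ) (MvPolynomial σ k) (MvPolynomial (E ⊕ σ) k) :=
    (basisMonomials E (MvPolynomial σ k)).map (sumLinearEquiv k σ E)
  let e : ((∀ f, (L f).ι) → MvPolynomial (E ⊕ σ) k) ≃ₗ[MvPolynomial σ k]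
      ((prod hr L).restrict (Sum.inr : σ → E ⊕ σ)).M :=
    { toFun := fun g => g
      invFun := fun g => g
      map_add' := fun _ _ => rfl
      map_smul' := fun _ _ => rfl
      left_inv := fun _ => rfl
      right_inv := fun _ => rfl }
  ((Pi.basis fun _ => b).reindex (Equiv.sigmaEquivProd _ _)).map e

-- The basis consists of the monomials in the extra variables `E`, placed at single basis elements.
-- With such explicit bases, bijectivity of the later comparison maps is a matching of bases.
open Classical in
theorem restrictBasis_apply (L : F → Loc k (E ⊕ σ)) (x : ∀ f, (L f).ι) (m : E →₀ ℕ) :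
    restrictBasis hr L (x, m) =
      (Pi.single x (rename Sum.inl (monomial m 1)) : (∀ f, (L f).ι) → MvPolynomial (E ⊕ σ) k) := by
  rw [← sumLinearEquiv_monomial]
  simp only [restrictBasis, Module.Basis.map_apply, Module.Basis.reindex_apply,
    Equiv.sigmaEquivProd_symm_apply, Pi.basis_apply, coe_basisMonomials]
  rfl

end Prod

end Loc
end
end KRTangle

/-! ### Total operators of nested families. -/

namespace KRTangle
noncomputable section
open Bicomplex

section SigmaTot

variable {J : Type} [Fintype J] [LinearOrder J] {F : J → Type} [∀ j, Fintype (F j)]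
  [∀ j, DecidableEq (F j)] {r : ∀ j, F j → F j → Prop}

theorem isTournament_sigmaLex (hr : ∀ j, IsTournament (r j)) :
    IsTournament (Sigma.Lex (fun a b : J => a < b) r) where
  irrefl := by
    rintro ⟨j, f⟩ h
    rcases Sigma.lex_iff.1 h with h | ⟨_, h⟩
    · exact lt_irrefl _ h
    · exact (hr j).irrefl _ h
  total := by
    rintro ⟨j, f⟩ ⟨l, g⟩ hne
    rcases lt_trichotomy j l with h | rfl | h
    · exact iff_of_true (.left _ _ h) fun h' => by
        rcases Sigma.lex_iff.1 h' with h' | ⟨h', _⟩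
        · exact h.not_gt h'
        · exact h.ne' h'
    · have key : ∀ a b : F j, Sigma.Lex (fun a b : J => a < b) r ⟨j, a⟩ ⟨j, b⟩ ↔ r j a b :=
        fun a b => ⟨fun h => by
          rcases Sigma.lex_iff.1 h with h | ⟨_, h⟩
          · exact absurd h (lt_irrefl _)
          · exact h, .right _ _⟩
      rw [key, key]
      exact (hr j).total _ _ fun h => hne (by rw [h])
    · exact iff_of_false (fun h' => by
        rcases Sigma.lex_iff.1 h' with h' | ⟨h', _⟩
        · exact h.not_gt h'
        · exact h.ne' h') fun h' => h' (.left _ _ h)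

variable {ι : ∀ j, F j → Type} [∀ j f, Fintype (ι j f)] {R : J → Type u} [∀ j, CommRing (R j)]
  {S : Type u} [CommRing S]

/-- In the lexicographic order the slots below `(j, f)` are all slots of the lower blocks and those
of the block `j` below `f`. The former give the sign that the tensor product of the blocks
prescribes. -/
theorem sgnBelow_sigma (s : ∀ j f, ι j f → ℤ) (x : ∀ p : Σ j, F j, ι p.1 p.2) (j : J) (f : F j) :
    sgnBelow (Sigma.Lex (fun a b : J => a < b) r) (fun p => s p.1 p.2) ⟨j, f⟩ x =
      (∏ l, if l < j then ∏ g, s l g (x ⟨l, g⟩) else 1) *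
        sgnBelow (r j) (s j) f fun g => x ⟨j, g⟩ := by
  classical
  rw [sgnBelow, Fintype.prod_sigma, ← Finset.mul_prod_erase _ _ (Finset.mem_univ j), mul_comm,
    ← Finset.mul_prod_erase (a := j) _ (fun l => if l < j then ∏ g, s l g (x ⟨l, g⟩) else 1)
      (Finset.mem_univ j), if_neg (lt_irrefl j), one_mul]
  congr 1
  · refine Finset.prod_congr rfl fun l hl => ?_
    have hl := Finset.ne_of_mem_erase hl
    split_ifs with h
    · exact Finset.prod_congr rfl fun g _ => if_pos (.left _ _ h)
    · refine Finset.prod_eq_one fun g _ => if_neg fun h' => ?_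
      rcases Sigma.lex_iff.1 h' with h' | ⟨h', _⟩
      · exact h h'
      · exact hl h'
  · refine Finset.prod_congr rfl fun g _ => ?_
    have key : Sigma.Lex (fun a b : J => a < b) r ⟨j, g⟩ ⟨j, f⟩ ↔ r j g f :=
      ⟨fun h => by
        rcases Sigma.lex_iff.1 h with h | ⟨_, h⟩
        · exact absurd h (lt_irrefl _)
        · exact h, .right _ _⟩
    simp only [key]

theorem update_sigma_self (x : ∀ p : Σ j, F j, ι p.1 p.2) (j : J) (f : F j) (z : ι j f) :
    (fun g => Function.update x ⟨j, f⟩ z ⟨j, g⟩) = Function.update (fun g => x ⟨j, g⟩) f z := by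
  funext g
  by_cases h : g = f
  · subst h; simp
  · rw [Function.update_of_ne h, Function.update_of_ne (by simpa using h)]

theorem update_sigma_of_ne (x : ∀ p : Σ j, F j, ι p.1 p.2) {j l : J} (hl : l ≠ j) (f : F j)
    (z : ι j f) :
    (fun g => Function.update x ⟨j, f⟩ z ⟨l, g⟩) = fun g => x ⟨l, g⟩ := by
  funext g
  rw [Function.update_of_ne (by simp [hl])]

/-- The total operator over a sigma type. -/
theorem tot_sigma (φ : ∀ j, R j →+* S) (s : ∀ j f, ι j f → ℤ)
    (A : ∀ j f, Matrix (ι j f) (ι j f) (R j)) (n : ∀ j, (∀ f, ι j f) → R j)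
    (x : ∀ p : Σ j, F j, ι p.1 p.2) :
    tot (ι := fun p : Σ j, F j => ι p.1 p.2) (Sigma.Lex (fun a b : J => a < b) r)
        (fun p => s p.1 p.2) (fun p => (A p.1 p.2).map (φ p.1))
        (fun x => ∏ j, φ j (n j fun f => x ⟨j, f⟩)) x =
      ∑ j, ∏ l, φ l ((if l < j then fun y => (∏ f, s l f (y f)) • n l y else
        if l = j then tot (r l) (s l) (A l) (n l) else n l) fun f => x ⟨l, f⟩) := by
  classical
  rw [tot_apply, Fintype.sum_sigma]
  refine Finset.sum_congr rfl fun j _ => ?_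
  rw [← Finset.mul_prod_erase _ _ (Finset.mem_univ j), if_neg (lt_irrefl j), if_pos rfl,
    tot_apply, map_sum, Finset.sum_mul]
  refine Finset.sum_congr rfl fun f _ => ?_
  -- Away from the block `j`, lower blocks are only multiplied by their full sign and higher blocks
  -- are untouched, so the signs can be taken out of the product.
  have h1 : ∏ l ∈ Finset.univ.erase j, φ l ((if l < j then fun y => (∏ f, s l f (y f)) • n l y
      else if l = j then tot (r l) (s l) (A l) (n l) else n l) fun f => x ⟨l, f⟩) =
      (∏ l, if l < j then ∏ g, s l g (x ⟨l, g⟩) else 1) •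
        ∏ l ∈ Finset.univ.erase j, φ l (n l fun f => x ⟨l, f⟩) := by
    rw [← Finset.mul_prod_erase (a := j) _ (fun l => if l < j then ∏ g, s l g (x ⟨l, g⟩) else 1)
      (Finset.mem_univ j), if_neg (lt_irrefl j), one_mul, zsmul_eq_mul, Int.cast_prod,
      ← Finset.prod_mul_distrib]
    refine Finset.prod_congr rfl fun l hl => ?_
    have hl := Finset.ne_of_mem_erase hl
    split_ifs with h
    · rw [map_zsmul, zsmul_eq_mul]
    · simp
  rw [h1, sgnBelow_sigma, map_zsmul, map_sum, smul_mul_smul_comm, mul_comm (sgnBelow _ _ _ _)]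
  congr 1
  rw [Finset.sum_mul]
  refine Finset.sum_congr rfl fun z _ => ?_
  rw [← Finset.mul_prod_erase _ _ (Finset.mem_univ j), update_sigma_self, map_mul, ← mul_assoc]
  congr 1
  refine Finset.prod_congr rfl fun l hl => ?_
  rw [update_sigma_of_ne _ (Finset.ne_of_mem_erase hl)]

/-- The total operator over a sigma type. -/
theorem tot_sigma_of_eq (φ : ∀ j, R j → S) (ψ : ∀ j, R j →+* S) (hφ : ∀ j a, φ j a = ψ j a)
    (s : ∀ j f, ι j f → ℤ) (A : ∀ j f, Matrix (ι j f) (ι j f) (R j))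
    (n : ∀ j, (∀ f, ι j f) → R j) (x : ∀ p : Σ j, F j, ι p.1 p.2) :
    tot (ι := fun p : Σ j, F j => ι p.1 p.2) (Sigma.Lex (fun a b : J => a < b) r)
        (fun p => s p.1 p.2) (fun p => (A p.1 p.2).map (φ p.1))
        (fun x => ∏ j, φ j (n j fun f => x ⟨j, f⟩)) x =
      ∑ j, ∏ l, φ l ((if l < j then fun y => (∏ f, s l f (y f)) • n l y else
        if l = j then tot (r l) (s l) (A l) (n l) else n l) fun f => x ⟨l, f⟩) := by
  obtain rfl : φ = fun j a => ψ j a := funext fun j => funext (hφ j)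
  exact tot_sigma ψ s A n x

end SigmaTot
end
end KRTangle

/-! ### A tensor product of products is a product over all factors. -/

namespace KRTangle
noncomputable section
open Bicomplex

namespace Loc

variable {k : Type u} [Field k] {σ τ : Type}

section TensorProd

variable {J : Type} [Fintype J] [LinearOrder J] {E F : J → Type} [∀ j, Fintype (F j)]
  [∀ j, DecidableEq (F j)] {r : ∀ j, F j → F j → Prop} (hr : ∀ j, IsTournament (r j))
  (L : ∀ j, F j → Loc k (E j ⊕ σ))

/-- The inclusion of the variables of one factor. -/
def sumEmb (σ : Type) (E : J → Type) (j : J) : E j ⊕ σ → (Σ j, E j) ⊕ σ := Sum.map (Sigma.mk j) id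

/-- The factors of a tensor product of products. -/
abbrev sigmaLoc (p : Σ j, F j) : Loc k ((Σ j, E j) ⊕ σ) := (L p.1 p.2).map (sumEmb σ E p.1)

/-- The product of functions on the factors. -/
def prodFun (n : ∀ j, (∀ f, (L j f).ι) → MvPolynomial (E j ⊕ σ) k)
    (x : ∀ p : Σ j, F j, (sigmaLoc L p).ι) : MvPolynomial ((Σ j, E j) ⊕ σ) k :=
  ∏ j, rename (sumEmb σ E j) (n j fun f => x ⟨j, f⟩)

theorem prodFun_update [DecidableEq J] (n : ∀ j, (∀ f, (L j f).ι) → MvPolynomial (E j ⊕ σ) k) (j : J)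
    (c : (∀ f, (L j f).ι) → MvPolynomial (E j ⊕ σ) k) (x : ∀ p : Σ j, F j, (sigmaLoc L p).ι) :
    prodFun L (Function.update n j c) x = rename (sumEmb σ E j) (c fun f => x ⟨j, f⟩) *
      ∏ l ∈ Finset.univ.erase j, rename (sumEmb σ E l) (n l fun f => x ⟨l, f⟩) := by
  rw [prodFun, ← Finset.mul_prod_erase _ _ (Finset.mem_univ j), Function.update_self]
  congr 1
  exact Finset.prod_congr rfl fun l hl => by
    rw [Function.update_of_ne (Finset.ne_of_mem_erase hl)]

/-- The product of functions as a multilinear map. -/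
def prodMultilinear : MultilinearMap (MvPolynomial σ k)
    (fun j => ((prod (hr j) (L j)).restrict (Sum.inr : σ → E j ⊕ σ)).M)
    ((prod (isTournament_sigmaLex hr) (sigmaLoc L)).restrict (Sum.inr : σ → (Σ j, E j) ⊕ σ)).M where
  toFun n := prodFun L n
  map_update_add' n j c d := funext fun x => by
    refine (prodFun_update L n j _ x).trans ?_
    refine Eq.trans ?_ (congrArg₂ (· + ·) (prodFun_update L n j c x)
      (prodFun_update L n j d x)).symm
    change rename _ (_ + _) * _ = _
    rw [map_add, add_mul]
  map_update_smul' n j c d := funext fun x => by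
    refine (prodFun_update L n j _ x).trans ?_
    refine Eq.trans ?_ (congrArg (rename Sum.inr c * ·) (prodFun_update L n j d x)).symm
    change rename _ (rename Sum.inr c * _) * _ = _
    rw [map_mul, rename_rename, mul_assoc]
    rfl

/-- The map from a tensor product of products to the product over all factors. -/
def tensorToProd : (Bicomplex.tensor fun j =>
      (prod (hr j) (L j)).restrict (Sum.inr : σ → E j ⊕ σ)).M →ₗ[MvPolynomial σ k]
    ((prod (isTournament_sigmaLex hr) (sigmaLoc L)).restrict (Sum.inr : σ → (Σ j, E j) ⊕ σ)).M :=
  PiTensorProduct.lift (prodMultilinear hr L)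

theorem tensorToProd_tprod (n : ∀ j, ((prod (hr j) (L j)).restrict (Sum.inr : σ → E j ⊕ σ)).M) :
    tensorToProd hr L (PiTensorProduct.tprod (MvPolynomial σ k) n) = prodFun L n :=
  PiTensorProduct.lift.tprod (φ := prodMultilinear hr L) n

/-- Exponents in all the variables. -/
def expEquiv (E : J → Type) : (∀ j, E j →₀ ℕ) ≃ ((Σ j, E j) →₀ ℕ) :=
  Finsupp.sigmaFinsuppEquivPiFinsupp.symm

theorem expEquiv_eq_sum (m : ∀ j, E j →₀ ℕ) :
    expEquiv E m = ∑ j, (m j).mapDomain (Sigma.mk j) := by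
  classical
  ext ⟨j, a⟩
  rw [Finsupp.finsetSum_apply, Finset.sum_eq_single j]
  · rw [Finsupp.mapDomain_apply sigma_mk_injective]
    rfl
  · intro l _ hl
    refine Finsupp.mapDomain_of_notMem_range _ _ ?_
    rintro ⟨b, hb⟩
    exact hl (by cases hb; rfl)
  · simp

/-- Indices of the bases. -/
def idxEquiv : (∀ j, (∀ f, (L j f).ι) × (E j →₀ ℕ)) ≃
    (∀ p : Σ j, F j, (sigmaLoc L p).ι) × ((Σ j, E j) →₀ ℕ) :=
  (Equiv.arrowProdEquivProdArrow _ _ _).trans ((Equiv.piCurry _).symm.prodCongr (expEquiv E))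

-- A product of basis functions is supported at the combined basis element, and monomials in
-- disjoint sets of variables multiply to the monomial with the combined exponent.
open Classical in
theorem prodFun_single (x : ∀ j f, (L j f).ι) (m : ∀ j, E j →₀ ℕ) :
    prodFun L (fun j => Pi.single (x j) (rename Sum.inl (monomial (m j) 1))) =
      (Pi.single (fun p : Σ j, F j => x p.1 p.2) (rename Sum.inl (monomial (expEquiv E m) 1)) :
        (∀ p : Σ j, F j, (sigmaLoc L p).ι) → MvPolynomial ((Σ j, E j) ⊕ σ) k) := by
  funext y
  have hy : (y = fun p : Σ j, F j => x p.1 p.2) ↔ ∀ j, (fun f => y ⟨j, f⟩) = x j :=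
    ⟨fun h j => by rw [h], fun h => funext fun p => congrFun (h p.1) p.2⟩
  rw [Pi.single_apply, prodFun]
  split_ifs with h
  · have h' := hy.1 h
    rw [Finset.prod_congr rfl fun j _ => by
      rw [h' j, Pi.single_eq_same, rename_rename, show (sumEmb σ E j ∘ Sum.inl) =
        Sum.inl ∘ Sigma.mk j from rfl, ← rename_rename, rename_monomial], ← map_prod,
      expEquiv_eq_sum]
    congr 1
    have key : ∀ (t : Finset J) (d : J → (Σ j, E j) →₀ ℕ),
        ∏ j ∈ t, (monomial (d j) (1 : k)) = monomial (∑ j ∈ t, d j) 1 := by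
      intro t d
      rw [monomial_sum_one]
    exact key _ _
  · obtain ⟨j, hj⟩ := not_forall.1 fun h' => h (hy.2 h')
    exact Finset.prod_eq_zero (Finset.mem_univ j) (by rw [Pi.single_eq_of_ne hj, map_zero])

/-- The tensor products of monomial basis elements go to the monomial basis, along the bijection
`idxEquiv` of the indices. -/
theorem tensorToProd_bijective : Function.Bijective (tensorToProd hr L) := by
  let b := Basis.piTensorProduct fun j => restrictBasis (σ := σ) (hr j) (L j)
  let b' := restrictBasis (σ := σ) (isTournament_sigmaLex hr) (sigmaLoc L)
  have key : tensorToProd hr L = (b.equiv b' (idxEquiv L)).toLinearMap := by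
    refine b.ext fun p => ?_
    refine Eq.trans ?_ (b.equiv_apply p b' (idxEquiv L)).symm
    refine (congrArg (tensorToProd hr L) (Basis.piTensorProduct_apply _ p)).trans ?_
    refine (tensorToProd_tprod hr L _).trans ?_
    refine Eq.trans ?_ (restrictBasis_apply _ _ _ _).symm
    refine Eq.trans ?_ (prodFun_single L (fun j => (p j).1) fun j => (p j).2)
    exact congrArg (prodFun L) (funext fun j => restrictBasis_apply (hr j) (L j) (p j).1 (p j).2)
  rw [key]
  exact (b.equiv b' (idxEquiv L)).bijective

theorem prodFun_mem_gr (n : ∀ j, (∀ f, (L j f).ι) → MvPolynomial (E j ⊕ σ) k) (a b c : J → ℤ)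
    (hn : ∀ j, n j ∈ (prod (hr j) (L j)).gr (a j) (b j) (c j)) :
    prodFun L n ∈ (prod (isTournament_sigmaLex hr) (sigmaLoc L)).gr
      (∑ j, a j) (∑ j, b j) (∑ j, c j) := by
  intro x
  by_cases h0 : ∃ j, n j (fun f => x ⟨j, f⟩) = 0
  · obtain ⟨j, hj⟩ := h0
    exact Or.inl (Finset.prod_eq_zero (Finset.mem_univ j) (by rw [hj, map_zero]))
  push Not at h0
  -- No factor vanishes at `x`, so each has definite degrees there, and the degrees of the product
  -- are their sums.
  choose h1 h2 d h3 h4 using fun j => (hn j fun f => x ⟨j, f⟩).resolve_left (h0 j)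
  refine Or.inr ⟨?_, ?_, ∑ j, d j, ?_, ?_⟩
  · exact (Finset.sum_congr rfl fun j _ => h1 j).trans
      (Fintype.sum_sigma fun p : Σ j, F j => (L p.1 p.2).hd (x p)).symm
  · exact (Finset.sum_congr rfl fun j _ => h2 j).trans
      (Fintype.sum_sigma fun p : Σ j, F j => (L p.1 p.2).vd (x p)).symm
  · exact IsHomogeneous.prod _ _ _ fun j _ => (h3 j).rename_isHomogeneous
  · refine Eq.trans ?_ (congrArg (· + 2 * ((∑ j, d j : ℕ) : ℤ))
      (Fintype.sum_sigma fun p : Σ j, F j => (L p.1 p.2).qd (x p)).symm)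
    dsimp only
    rw [Nat.cast_sum, Finset.mul_sum, ← Finset.sum_add_distrib]
    exact Finset.sum_congr rfl fun j _ => h4 j

/-- It suffices to compare on pure tensors, where `H` describes `D`. Arbitrary `s` and `d` are
allowed so that the same argument serves the horizontal and the vertical differential. -/
theorem tensorToProd_diff
    (s d : ∀ j, ((prod (hr j) (L j)).restrict (Sum.inr : σ → E j ⊕ σ)).M →ₗ[MvPolynomial σ k]
      ((prod (hr j) (L j)).restrict (Sum.inr : σ → E j ⊕ σ)).M)
    (D : ((prod (isTournament_sigmaLex hr) (sigmaLoc L)).restrict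
        (Sum.inr : σ → (Σ j, E j) ⊕ σ)).M →ₗ[MvPolynomial σ k]
      ((prod (isTournament_sigmaLex hr) (sigmaLoc L)).restrict (Sum.inr : σ → (Σ j, E j) ⊕ σ)).M)
    (H : ∀ n : ∀ j, ((prod (hr j) (L j)).restrict (Sum.inr : σ → E j ⊕ σ)).M,
      D (prodFun L n) = ∑ j, prodFun L fun l =>
        (if l < j then s l else if l = j then d l else LinearMap.id) (n l))
    (x : (Bicomplex.tensor fun j => (prod (hr j) (L j)).restrict (Sum.inr : σ → E j ⊕ σ)).M) :
    tensorToProd hr L (tensorDiff s d x) = D (tensorToProd hr L x) := by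
  refine LinearMap.congr_fun (tensor_ext (tensorToProd hr L ∘ₗ tensorDiff s d)
    (D ∘ₗ tensorToProd hr L) fun n => ?_) x
  refine Eq.trans ?_ ((congrArg D (tensorToProd_tprod hr L n)).trans (H n)).symm
  refine (congrArg (tensorToProd hr L) (LinearMap.sum_apply _ _ _)).trans ?_
  refine (map_sum (tensorToProd hr L) _ _).trans ?_
  refine Finset.sum_congr rfl fun j _ => ?_
  refine (congrArg (tensorToProd hr L) (PiTensorProduct.map_tprod _ _)).trans ?_
  exact tensorToProd_tprod hr L _

theorem prodFun_diff (s : ∀ j f, (L j f).ι → ℤ)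
    (A : ∀ j f, Matrix (L j f).ι (L j f).ι (MvPolynomial (E j ⊕ σ) k))
    (n : ∀ j, (∀ f, (L j f).ι) → MvPolynomial (E j ⊕ σ) k) :
    tot (ι := fun p : Σ j, F j => (sigmaLoc L p).ι) (Sigma.Lex (fun a b : J => a < b) r)
        (fun p => s p.1 p.2) (fun p => (A p.1 p.2).map (rename (sumEmb σ E p.1))) (prodFun L n) =
      ∑ j, prodFun L fun l => if l < j then fun y => (∏ f, s l f (y f)) • n l y else
        if l = j then tot (ι := fun f => (L l f).ι) (r l) (s l) (A l) (n l) else n l := by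
  funext x
  rw [Finset.sum_apply]
  exact tot_sigma_of_eq (ι := fun j f => (L j f).ι) (fun j => rename (sumEmb σ E j))
    (fun j => (rename (sumEmb σ E j)).toRingHom) (fun _ _ => rfl) s A n x

theorem ite_ite_eq_apply {N M : Type u} {p q : Prop} [Decidable p] [Decidable q] {s d e : N}
    {a b c : M} (φ : N → M) (h1 : a = φ s) (h2 : b = φ d) (h3 : c = φ e) :
    (if p then a else if q then b else c) = φ (if p then s else if q then d else e) := by
  split_ifs <;> assumption

/-- The tensor product of products is the product over all factors. -/
def tensorProd : Iso
    (Bicomplex.tensor fun j => (prod (hr j) (L j)).restrict (Sum.inr : σ → E j ⊕ σ))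
    ((prod (isTournament_sigmaLex hr) (sigmaLoc L)).restrict (Sum.inr : σ → (Σ j, E j) ⊕ σ)) :=
  Iso.ofHasProj
    { toLin := tensorToProd hr L
      map_gr := fun {h v q x} hx => by
        refine mem_of_mem_closure (tensorToProd hr L).toAddMonoidHom (K := (prod
          (isTournament_sigmaLex hr) (sigmaLoc L)).gr h v q) ?_ hx
        rintro _ ⟨n, c, a, b, d, m, hc, hm, rfl, rfl, rfl, rfl⟩
        have h1 : tensorToProd hr L (c • PiTensorProduct.tprod (MvPolynomial σ k) m) =
            c • (show ((prod (isTournament_sigmaLex hr) (sigmaLoc L)).restrict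
              (Sum.inr : σ → (Σ j, E j) ⊕ σ)).M from prodFun L m) :=
          (map_smul _ _ _).trans (congrArg _ (tensorToProd_tprod hr L m))
        refine (congrArg (· ∈ ((prod (isTournament_sigmaLex hr) (sigmaLoc L)).restrict
          (Sum.inr : σ → (Σ j, E j) ⊕ σ)).gr _ _ _) h1).mpr ?_
        exact Bicomplex.smul_gr _ hc (prodFun_mem_gr hr L m a b d hm)
      comm_dh := tensorToProd_diff hr L _ _ _ fun n => by
        refine (prodFun_diff L (fun j f => (L j f).hs) (fun j f => (L j f).A) n).trans ?_
        refine Finset.sum_congr rfl fun j _ => congrArg (prodFun L) (funext fun l => ?_)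
        exact ite_ite_eq_apply (fun φ : ((prod (hr l) (L l)).restrict
          (Sum.inr : σ → E l ⊕ σ)).M →ₗ[MvPolynomial σ k] ((prod (hr l) (L l)).restrict
            (Sum.inr : σ → E l ⊕ σ)).M => φ (n l)) rfl rfl rfl
      comm_dv := tensorToProd_diff hr L _ _ _ fun n => by
        refine (prodFun_diff L (fun j f => (L j f).vs) (fun j f => (L j f).B) n).trans ?_
        refine Finset.sum_congr rfl fun j _ => congrArg (prodFun L) (funext fun l => ?_)
        exact ite_ite_eq_apply (fun φ : ((prod (hr l) (L l)).restrict
          (Sum.inr : σ → E l ⊕ σ)).M →ₗ[MvPolynomial σ k] ((prod (hr l) (L l)).restrict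
            (Sum.inr : σ → E l ⊕ σ)).M => φ (n l)) rfl rfl rfl }
    (tensorToProd_bijective hr L) (hasProj_restrict_prod _ _ _)

end TensorProd
end Loc
end
end KRTangle

/-! ### Single factors and extension of scalars. -/

namespace KRTangle
noncomputable section
open Bicomplex

namespace Loc

variable {k : Type u} [Field k] {σ τ E : Type}

theorem isTournament_of_subsingleton (F : Type) [Subsingleton F] :
    IsTournament (fun _ _ : F => False) :=
  ⟨fun _ h => h, fun _ _ h => (h (Subsingleton.elim _ _)).elim⟩

theorem tot_unit {R : Type u} [CommRing R] {ι : Type} [Fintype ι] (s : ι → ℤ) (A : Matrix ι ι R)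
    (g : ι → R) (x : Unit → ι) :
    tot (F := Unit) (ι := fun _ => ι) (fun _ _ => False) (fun _ => s) (fun _ => A) (fun x => g (x ())) x =
      A.mulVec g (x ()) := by
  rw [tot_apply]
  simp [sgnBelow, Matrix.mulVec, dotProduct]

/-- A free bicomplex as a product with one factor. -/
def single (L : Loc k σ) : Iso L.toBicomplex
    ((prod (isTournament_of_subsingleton Unit) fun _ => L.map Sum.inr).restrict
      (Sum.inr : σ → Empty ⊕ σ)) :=
  have key : ∀ (s : L.ι → ℤ) (A : Matrix L.ι L.ι (MvPolynomial σ k)) (g : L.ι → MvPolynomial σ k)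
      (x : Unit → L.ι), rename (Sum.inr : σ → Empty ⊕ σ) (A.mulVec g (x ())) =
        tot (F := Unit) (ι := fun _ => L.ι) (fun _ _ => False) (fun _ => s)
          (fun _ => A.map (rename Sum.inr)) (fun x => rename Sum.inr (g (x ()))) x := by
    intro s A g x
    refine Eq.trans ?_ (tot_unit s (A.map (rename Sum.inr)) (fun z => rename Sum.inr (g z)) x).symm
    simp [Matrix.mulVec, dotProduct]
  Iso.ofHasProj
    { toLin :=
        { toFun := fun (g : L.ι → MvPolynomial σ k) (x : Unit → L.ι) =>
            rename (Sum.inr : σ → Empty ⊕ σ) (g (x ()))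
          map_add' := fun g g' => funext fun x => map_add _ _ _
          map_smul' := fun c g => funext fun x => map_mul (rename Sum.inr) _ _ }
      map_gr := fun {h v q g} hg x => by
        rcases hg (x ()) with h0 | ⟨h1, h2, n, h3, h4⟩
        · exact Or.inl ((congrArg (rename Sum.inr) h0).trans (map_zero _))
        · exact Or.inr ⟨h1.trans (by simp), h2.trans (by simp), n, h3.rename_isHomogeneous,
            h4.trans (by simp)⟩
      comm_dh := fun g => funext fun x => key L.hs L.A g x
      comm_dv := fun g => funext fun x => key L.vs L.B g x }
    (by
      let e := Equiv.emptySum Empty σ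
      have he : (Sum.inr : σ → Empty ⊕ σ) = e.symm := rfl
      constructor
      · intro g g' h
        funext z
        exact rename_injective _ Sum.inr_injective (congrFun h fun _ => z)
      · intro g
        refine ⟨fun z => rename e
          ((show (Unit → L.ι) → MvPolynomial (Empty ⊕ σ) k from g) fun _ => z), funext fun x => ?_⟩
        change rename Sum.inr (rename e _) = _
        rw [rename_rename, he, Equiv.symm_comp_self, rename_id_apply])
    (hasProj_restrict_prod _ _ _)

section Extend

variable {F : Type} [Fintype F] [DecidableEq F] {r : F → F → Prop} (hr : IsTournament r)
  (L : F → Loc k (E ⊕ σ)) (φ : σ → τ)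

/-- Renaming the coefficients of a product. -/
def renameProd : ((prod hr L).restrict (Sum.inr : σ → E ⊕ σ)).M →ₗ[MvPolynomial σ k]
    (((prod hr fun f => (L f).map (Sum.map id φ)).restrict
      (Sum.inr : τ → E ⊕ τ)).restrict φ).M where
  toFun := fun (g : (∀ f, (L f).ι) → MvPolynomial (E ⊕ σ) k) x => rename (Sum.map id φ) (g x)
  map_add' := fun g g' => funext fun x => map_add _ _ _
  map_smul' := fun s g => funext fun x => by
    change rename (Sum.map id φ) (rename Sum.inr s *
        (show (∀ f, (L f).ι) → MvPolynomial (E ⊕ σ) k from g) x) =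
      rename Sum.inr (rename φ s) * rename (Sum.map id φ)
        ((show (∀ f, (L f).ι) → MvPolynomial (E ⊕ σ) k from g) x)
    rw [map_mul, rename_rename, rename_rename]
    rfl

/-- The canonical map from an extension of scalars. -/
def extendLift {C : Bicomplex k σ} {D : Bicomplex k τ} (φ : σ → τ)
    (f : C.M →ₗ[MvPolynomial σ k] (D.restrict φ).M) : (C.extend φ).M →ₗ[MvPolynomial τ k] D.M :=
  letI := renameAlgebra k φ
  letI : Module (MvPolynomial σ k) D.M := Module.compHom D.M (rename φ).toRingHom
  haveI : IsScalarTower (MvPolynomial σ k) (MvPolynomial τ k) D.M :=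
    ⟨fun a b c => mul_smul (rename φ a) b c⟩
  LinearMap.liftBaseChange (MvPolynomial τ k) (show C.M →ₗ[MvPolynomial σ k] D.M from f)

theorem extendLift_tmul {C : Bicomplex k σ} {D : Bicomplex k τ} (φ : σ → τ)
    (f : C.M →ₗ[MvPolynomial σ k] (D.restrict φ).M) (c : MvPolynomial τ k) (x : C.M) :
    letI := renameAlgebra k φ
    extendLift φ f (show (C.extend φ).M from c ⊗ₜ[MvPolynomial σ k] x) =
      c • (show D.M from f x) := by
  letI := renameAlgebra k φ
  letI : Module (MvPolynomial σ k) D.M := Module.compHom D.M (rename φ).toRingHom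
  haveI : IsScalarTower (MvPolynomial σ k) (MvPolynomial τ k) D.M :=
    ⟨fun a b c => mul_smul (rename φ a) b c⟩
  exact LinearMap.liftBaseChange_tmul (MvPolynomial τ k)
    (show C.M →ₗ[MvPolynomial σ k] D.M from f) c x

/-- The adjoint of a morphism to a restriction of scalars. -/
def extendHom {C : Bicomplex k σ} {D : Bicomplex k τ} (φ : σ → τ) (f : Hom C (D.restrict φ)) :
    Hom (C.extend φ) D where
  toLin := extendLift φ f.toLin
  map_gr {h v q x} hx := by
    refine mem_of_mem_closure (extendLift φ f.toLin).toAddMonoidHom (K := D.gr h v q) ?_ hx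
    rintro _ ⟨n, c, d, y, hc, hy, rfl, rfl⟩
    refine (congrArg (· ∈ D.gr h v _) (extendLift_tmul φ f.toLin c y)).mpr ?_
    exact D.smul_gr hc (f.map_gr hy)
  comm_dh x := by
    letI := renameAlgebra k φ
    induction x using TensorProduct.induction_on with
    | zero =>
      exact (map_zero (extendLift φ f.toLin ∘ₗ (C.extend φ).dh)).trans
        (map_zero (D.dh ∘ₗ extendLift φ f.toLin)).symm
    | add x y hx hy =>
      exact (map_add (extendLift φ f.toLin ∘ₗ (C.extend φ).dh) x y).trans
        ((congrArg₂ (· + ·) hx hy).trans (map_add (D.dh ∘ₗ extendLift φ f.toLin) x y).symm)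
    | tmul c x =>
      refine (extendLift_tmul φ f.toLin c (C.dh x)).trans ?_
      refine Eq.trans ?_ (congrArg D.dh (extendLift_tmul φ f.toLin c x)).symm
      rw [map_smul, f.comm_dh]
      rfl
  comm_dv x := by
    letI := renameAlgebra k φ
    induction x using TensorProduct.induction_on with
    | zero =>
      exact (map_zero (extendLift φ f.toLin ∘ₗ (C.extend φ).dv)).trans
        (map_zero (D.dv ∘ₗ extendLift φ f.toLin)).symm
    | add x y hx hy =>
      exact (map_add (extendLift φ f.toLin ∘ₗ (C.extend φ).dv) x y).trans
        ((congrArg₂ (· + ·) hx hy).trans (map_add (D.dv ∘ₗ extendLift φ f.toLin) x y).symm)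
    | tmul c x =>
      refine (extendLift_tmul φ f.toLin c (C.dv x)).trans ?_
      refine Eq.trans ?_ (congrArg D.dv (extendLift_tmul φ f.toLin c x)).symm
      rw [map_smul, f.comm_dv]
      rfl

/-- Renaming the coefficients of a product, as a morphism. -/
def renameProdHom : Hom ((prod hr L).restrict (Sum.inr : σ → E ⊕ σ))
    (((prod hr fun f => (L f).map (Sum.map id φ)).restrict
      (Sum.inr : τ → E ⊕ τ)).restrict φ) where
  toLin := renameProd hr L φ
  map_gr := fun {h v q g} hg x => by
    rcases hg x with h0 | ⟨h1, h2, n, h3, h4⟩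
    · exact Or.inl ((congrArg (rename _) h0).trans (map_zero _))
    · exact Or.inr ⟨h1, h2, n, h3.rename_isHomogeneous, h4⟩
  comm_dh := fun g => funext fun x =>
    tot_comp _ (fun f => (L f).A) (fun f => ((L f).map (Sum.map id φ)).A)
      (rename (Sum.map id φ)).toAddMonoidHom (fun f z w c => map_mul (rename _) _ _) g x
  comm_dv := fun g => funext fun x =>
    tot_comp _ (fun f => (L f).B) (fun f => ((L f).map (Sum.map id φ)).B)
      (rename (Sum.map id φ)).toAddMonoidHom (fun f z w c => map_mul (rename _) _ _) g x

/-- A basis over `k[σ]` remains a basis after base change to `k[τ]`. Both sides have the monomials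
in `E` at single basis elements as a basis, with the same indices, because renaming along `φ` does
not touch `E`. -/
theorem extendHom_bijective :
    Function.Bijective (extendHom φ (renameProdHom hr L φ)).toLin := by
  classical
  letI := renameAlgebra k φ
  let b := restrictBasis (σ := σ) hr L
  let b1 : Module.Basis _ (MvPolynomial τ k)
    (((prod hr L).restrict (Sum.inr : σ → E ⊕ σ)).extend φ).M :=
      Algebra.TensorProduct.basis (MvPolynomial τ k) b
  let b' := restrictBasis (σ := τ) hr fun f => (L f).map (Sum.map id φ)
  have key : (extendHom φ (renameProdHom hr L φ)).toLin =
      (b1.equiv b' (Equiv.refl _)).toLinearMap := by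
    refine b1.ext fun p => ?_
    refine Eq.trans ?_ (b1.equiv_apply p b' (Equiv.refl _)).symm
    refine (congrArg _ (Algebra.TensorProduct.basis_apply b p)).trans ?_
    refine (extendLift_tmul φ (renameProd hr L φ) 1 (b p)).trans ?_
    refine (one_smul _ _).trans ?_
    refine (congrArg (renameProd hr L φ) (restrictBasis_apply hr L p.1 p.2)).trans ?_
    refine Eq.trans ?_ (restrictBasis_apply (σ := τ) hr (fun f => (L f).map (Sum.map id φ)) p.1 p.2).symm
    funext x
    change rename (Sum.map id φ) ((Pi.single p.1 (rename Sum.inl (monomial p.2 1)) :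
      (∀ f, (L f).ι) → MvPolynomial (E ⊕ σ) k) x) = (Pi.single p.1
        (rename Sum.inl (monomial p.2 1)) : (∀ f, (L f).ι) → MvPolynomial (E ⊕ τ) k) x
    by_cases h : x = p.1
    · subst h
      rw [Pi.single_eq_same, Pi.single_eq_same, rename_rename]
      rfl
    · rw [Pi.single_eq_of_ne h, Pi.single_eq_of_ne h, map_zero]
  rw [key]
  exact (b1.equiv b' (Equiv.refl _)).bijective

/-- The extension of scalars of a product. -/
def extendProd : Iso (((prod hr L).restrict (Sum.inr : σ → E ⊕ σ)).extend φ)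
    ((prod hr fun f => (L f).map (Sum.map id φ)).restrict (Sum.inr : τ → E ⊕ τ)) :=
  Iso.ofHasProj (extendHom φ (renameProdHom hr L φ)) (extendHom_bijective hr L φ)
    (hasProj_restrict_prod _ _ _)

end Extend

end Loc
end
end KRTangle

/-! ### Comparison of the factors: Koszul complexes and crossings after renaming. -/

namespace KRTangle
noncomputable section
open Bicomplex

namespace Loc

variable {k : Type u} [Field k] {V W U : Type}

/-- Isomorphisms of products given by bijections of the variables and of the factors. -/
def prodIso {F F' σ : Type} [Fintype F] [DecidableEq F] [Fintype F'] [DecidableEq F']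
    {r : F → F → Prop} {r' : F' → F' → Prop} (hr : IsTournament r) (hr' : IsTournament r')
    (L : F → Loc k V) (L' : F' → Loc k W) (ε : V ≃ W) (θ : F ≃ F')
    (I : ∀ f, Sim ((L f).map ε) (L' (θ f))) (ψ : σ → V) (ψ' : σ → W) (hψ : ∀ s, ε (ψ s) = ψ' s) :
    Iso ((prod hr L).restrict ψ) ((prod hr' L').restrict ψ') := by
  obtain rfl : ε ∘ ψ = ψ' := funext hψ
  exact (prodRename hr L ε ψ).trans
    ((prodReindex hr hr' (fun f => (L f).map ε) L' θ I).restrict (ε ∘ ψ))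

/-- The form that the matrix conditions of `Sim` take when all signs are `1`. -/
theorem eq_one_mul_one_smul {R : Type u} [CommRing R] {x y : R} (h : y = x) :
    x = ((1 : ℤ) * 1) • y := by
  rw [h, mul_one, one_smul]

/-- Renaming the variables in a Koszul complex. -/
def koszulSim (φ : V → W) (x : MvPolynomial V k) (hx : x.IsHomogeneous 1) (y : MvPolynomial W k)
    (hy : y.IsHomogeneous 1) (h : rename φ x = y) : Sim ((koszul x hx).map φ) (koszul y hy) where
  e := Equiv.refl (Fin 2)
  u _ := 1
  hu _ := rfl
  hd _ := rfl
  vd _ := rfl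
  qd _ := rfl
  A z w := by
    subst h
    revert z w
    change ∀ z w : Fin 2, !![0, rename φ x; 0, 0] z w =
      ((1 : ℤ) * 1) • rename φ ((!![0, x; 0, 0] : Matrix (Fin 2) (Fin 2) (MvPolynomial V k)) z w)
    intro z w
    fin_cases z <;> fin_cases w <;> simp
  B z w := eq_one_mul_one_smul (map_zero (rename φ))

/-- Renaming the variables in a Koszul complex and changing the sign. -/
def koszulNegSim (φ : V → W) (x : MvPolynomial V k) (hx : x.IsHomogeneous 1) (y : MvPolynomial W k)
    (hy : y.IsHomogeneous 1) (h : rename φ x = -y) :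
    Sim ((koszul x hx).map φ) (koszul y hy) where
  e := Equiv.refl (Fin 2)
  u := ![1, -1]
  hu z := by
    revert z
    change ∀ z : Fin 2, _
    intro z
    fin_cases z <;> rfl
  hd _ := rfl
  vd _ := rfl
  qd _ := rfl
  A z w := by
    obtain rfl : y = -rename φ x := by rw [h, neg_neg]
    revert z w
    change ∀ z w : Fin 2, !![0, -rename φ x; 0, 0] z w =
      ((![1, -1] : Fin 2 → ℤ) z * (![1, -1] : Fin 2 → ℤ) w) •
        rename φ ((!![0, x; 0, 0] : Matrix (Fin 2) (Fin 2) (MvPolynomial V k)) z w)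
    intro z w
    fin_cases z <;> fin_cases w <;> simp
  B z w := (smul_eq_zero_of_right _ (map_zero (rename φ))).symm

/-- Renaming the variables in two steps. -/
def mapMapSim (L : Loc k V) (φ : V → W) (ψ : W → U) (χ : V → U) (h : ψ ∘ φ = χ) :
    Sim ((L.map φ).map ψ) (L.map χ) where
  e := Equiv.refl _
  u _ := 1
  hu _ := rfl
  hd _ := rfl
  vd _ := rfl
  qd _ := rfl
  A z w := by subst h; simp [rename_rename]
  B z w := by subst h; simp [rename_rename]

/-- The local data of a positive crossing. -/
def posCrossing (μ : k) (i j k' l : V) : Loc k V :=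
  { ι := Fin 4 ⊕ Fin 4
    hd := Sum.elim koszulDeg koszulDeg
    vd := Sum.elim (fun _ => -1) (fun _ => 0)
    qd := Sum.elim ![0, 0, 2, 2] 0
    A := Matrix.fromBlocks (singularMatrix i j k' l) 0 0 (smoothMatrix i j k' l)
    B := Matrix.fromBlocks 0 0 (rhoPos μ i j k' l) 0
    hA := by
      rintro (a | a) (b | b)
      · rcases singularMatrix_deg (k := k) 0 i j k' l a b with h | ⟨h1, n, h2, h3⟩
        · exact Or.inl h
        · exact Or.inr ⟨h1, by simp, n, h2, by simpa using h3⟩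
      · exact Or.inl rfl
      · exact Or.inl rfl
      · rcases smoothMatrix_deg (k := k) i j k' l a b with h | ⟨h1, n, h2, h3⟩
        · exact Or.inl h
        · exact Or.inr ⟨h1, by simp, n, h2, h3⟩
    hB := by
      rintro (a | a) (b | b)
      · exact Or.inl rfl
      · exact Or.inl rfl
      · rcases rhoPos_deg μ i j k' l a b with h | ⟨h1, n, h2, h3⟩
        · exact Or.inl h
        · exact Or.inr ⟨by simp [h1], by simp, n, h2, h3⟩
      · exact Or.inl rfl
    hAA := by simp [Matrix.fromBlocks_multiply, singularMatrix, smoothMatrix, koszulMatrix_sq]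
    hBB := by simp [Matrix.fromBlocks_multiply]
    hAB := by simp [Matrix.fromBlocks_multiply, rhoPos_comm] }

/-- The local data of a negative crossing. -/
def negCrossing (ν : k) (i j k' l : V) : Loc k V where
  ι := Fin 4 ⊕ Fin 4
  hd := Sum.elim koszulDeg koszulDeg
  vd := Sum.elim (fun _ => 0) (fun _ => 1)
  qd := Sum.elim 0 ![-2, -2, 0, 0]
  A := Matrix.fromBlocks (smoothMatrix i j k' l) 0 0 (singularMatrix i j k' l)
  B := Matrix.fromBlocks 0 0 (rhoNeg ν i j k' l) 0
  hA := by
    rintro (a | a) (b | b)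
    · rcases smoothMatrix_deg (k := k) i j k' l a b with h | ⟨h1, n, h2, h3⟩
      · exact Or.inl h
      · exact Or.inr ⟨h1, by simp, n, h2, h3⟩
    · exact Or.inl rfl
    · exact Or.inl rfl
    · rcases singularMatrix_deg (k := k) (-2) i j k' l a b with h | ⟨h1, n, h2, h3⟩
      · exact Or.inl h
      · exact Or.inr ⟨h1, by simp, n, h2, by simpa using h3⟩
  hB := by
    rintro (a | a) (b | b)
    · exact Or.inl rfl
    · exact Or.inl rfl
    · rcases rhoNeg_deg ν i j k' l a b with h | ⟨h1, n, h2, h3⟩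
      · exact Or.inl h
      · exact Or.inr ⟨by simp [h1], by simp, n, h2, h3⟩
    · exact Or.inl rfl
  hAA := by simp [Matrix.fromBlocks_multiply, singularMatrix, smoothMatrix, koszulMatrix_sq]
  hBB := by simp [Matrix.fromBlocks_multiply]
  hAB := by simp [Matrix.fromBlocks_multiply, rhoNeg_comm]

/-- The local data of a crossing. -/
def crossing (μ ν : k) (s : ℤˣ) (i j k' l : V) : Loc k V :=
  if s = 1 then posCrossing μ i j k' l else negCrossing ν i j k' l

theorem singularMatrix_map (φ : V → W) (i j k' l : V) (a b : Fin 4) :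
    rename φ (singularMatrix i j k' l a b : MvPolynomial V k) =
      singularMatrix (φ i) (φ j) (φ k') (φ l) a b := by
  fin_cases a <;> fin_cases b <;> simp [singularMatrix, koszulMatrix]

theorem smoothMatrix_map (φ : V → W) (i j k' l : V) (a b : Fin 4) :
    rename φ (smoothMatrix i j k' l a b : MvPolynomial V k) =
      smoothMatrix (φ i) (φ j) (φ k') (φ l) a b := by
  fin_cases a <;> fin_cases b <;> simp [smoothMatrix, koszulMatrix]

theorem rhoPos_map (μ : k) (φ : V → W) (i j k' l : V) (a b : Fin 4) :
    rename φ (rhoPos μ i j k' l a b) = rhoPos μ (φ i) (φ j) (φ k') (φ l) a b := by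
  fin_cases a <;> fin_cases b <;> simp [rhoPos]

theorem rhoNeg_map (ν : k) (φ : V → W) (i j k' l : V) (a b : Fin 4) :
    rename φ (rhoNeg ν i j k' l a b) = rhoNeg ν (φ i) (φ j) (φ k') (φ l) a b := by
  fin_cases a <;> fin_cases b <;> simp [rhoNeg]

/-- Renaming the variables in a crossing. -/
def crossingSim (μ ν : k) (s : ℤˣ) (φ : V → W) (i j k' l : V) {i' j' k'' l' : W} (hi : φ i = i')
    (hj : φ j = j') (hk : φ k' = k'') (hl : φ l = l') :
    Sim ((crossing μ ν s i j k' l).map φ) (crossing μ ν s i' j' k'' l') := by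
  subst hi hj hk hl
  unfold crossing
  split_ifs
  · refine ⟨Equiv.refl (Fin 4 ⊕ Fin 4), fun _ => 1, fun _ => rfl, fun _ => rfl, fun _ => rfl,
      fun _ => rfl, ?_, ?_⟩
    · rintro (a | a) (b | b)
      · exact eq_one_mul_one_smul (singularMatrix_map φ i j k' l a b)
      · exact eq_one_mul_one_smul (map_zero (rename φ))
      · exact eq_one_mul_one_smul (map_zero (rename φ))
      · exact eq_one_mul_one_smul (smoothMatrix_map φ i j k' l a b)
    · rintro (a | a) (b | b)
      · exact eq_one_mul_one_smul (map_zero (rename φ))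
      · exact eq_one_mul_one_smul (map_zero (rename φ))
      · exact eq_one_mul_one_smul (rhoPos_map μ φ i j k' l a b)
      · exact eq_one_mul_one_smul (map_zero (rename φ))
  · refine ⟨Equiv.refl (Fin 4 ⊕ Fin 4), fun _ => 1, fun _ => rfl, fun _ => rfl, fun _ => rfl,
      fun _ => rfl, ?_, ?_⟩
    · rintro (a | a) (b | b)
      · exact eq_one_mul_one_smul (smoothMatrix_map φ i j k' l a b)
      · exact eq_one_mul_one_smul (map_zero (rename φ))
      · exact eq_one_mul_one_smul (map_zero (rename φ))
      · exact eq_one_mul_one_smul (singularMatrix_map φ i j k' l a b)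
    · rintro (a | a) (b | b)
      · exact eq_one_mul_one_smul (map_zero (rename φ))
      · exact eq_one_mul_one_smul (map_zero (rename φ))
      · exact eq_one_mul_one_smul (rhoNeg_map ν φ i j k' l a b)
      · exact eq_one_mul_one_smul (map_zero (rename φ))

/-- Composition of isomorphisms of local data. -/
def Sim.trans {L L' L'' : Loc k V} (I : Sim L L') (I' : Sim L' L'') : Sim L L'' where
  e := I.e.trans I'.e
  u z := I.u z * I'.u (I.e z)
  hu z := by linear_combination I.u z * I.u z * I'.hu (I.e z) + I.hu z
  hd z := (I'.hd _).trans (I.hd z)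
  vd z := (I'.vd _).trans (I.vd z)
  qd z := (I'.qd _).trans (I.qd z)
  A z w := by
    refine (I'.A _ _).trans ?_
    rw [I.A, smul_smul]
    congr 1
    ring
  B z w := by
    refine (I'.B _ _).trans ?_
    rw [I.B, smul_smul]
    congr 1
    ring

/-- Inverses of isomorphisms of local data. -/
def Sim.symm {L L' : Loc k V} (I : Sim L L') : Sim L' L where
  e := I.e.symm
  u z := I.u (I.e.symm z)
  hu z := I.hu _
  hd z := by rw [← I.hd, Equiv.apply_symm_apply]
  vd z := by rw [← I.vd, Equiv.apply_symm_apply]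
  qd z := by rw [← I.qd, Equiv.apply_symm_apply]
  A z w := by
    have h := I.A (I.e.symm z) (I.e.symm w)
    rw [Equiv.apply_symm_apply, Equiv.apply_symm_apply] at h
    rw [h, smul_smul, mul_mul_mul_comm, I.hu, I.hu, mul_one, one_smul]
  B z w := by
    have h := I.B (I.e.symm z) (I.e.symm w)
    rw [Equiv.apply_symm_apply, Equiv.apply_symm_apply] at h
    rw [h, smul_smul, mul_mul_mul_comm, I.hu, I.hu, mul_one, one_smul]

/-- Renaming the variables in isomorphisms of local data. -/
def Sim.mapSim {L L' : Loc k V} (I : Sim L L') (φ : V → W) : Sim (L.map φ) (L'.map φ) where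
  e := I.e
  u := I.u
  hu := I.hu
  hd := I.hd
  vd := I.vd
  qd := I.qd
  A z w := by simp only [Matrix.map_apply, I.A, map_zsmul]
  B z w := by simp only [Matrix.map_apply, I.B, map_zsmul]

/-! ### Diagrams with marks -/

section Diagram

variable {A B Γ : Type} (M : Γ → Loc k (A ⊕ B)) (Z N : Type)

/-- The variables of a diagram with the sources `A`, the targets `B`, the circles `Z` and the
marks `N`. -/
abbrev DiagVar (A B Z N : Type) : Type := (A ⊕ B) ⊕ (Z ⊕ N)

/-- The variable of a source. -/
def srcVar (B Z : Type) {A N : Type} : A ⊕ N → DiagVar A B Z N := Sum.map Sum.inl Sum.inr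

/-- The variable of a target. -/
def tgtVar (A Z : Type) {B N : Type} : B ⊕ N → DiagVar A B Z N := Sum.map Sum.inr Sum.inr

/-- The factors of the complex of a diagram with marks. -/
def diagLoc {N : Type} (e : A ⊕ N ≃ B ⊕ N) : Z ⊕ (A ⊕ N) ⊕ Γ → Loc k (DiagVar A B Z N)
  | .inl _ => koszul 0 (isHomogeneous_zero _ _ _)
  | .inr (.inl s) => koszul (X (srcVar B Z s) - X (tgtVar A Z (e s))) (hom_sub _ _)
  | .inr (.inr c) => (M c).map Sum.inl

theorem diagLoc_circle (e : A ⊕ N ≃ B ⊕ N) (z : Z) :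
    diagLoc M Z e (.inl z) = koszul 0 (isHomogeneous_zero _ _ _) := rfl

theorem diagLoc_edge (e : A ⊕ N ≃ B ⊕ N) (s : A ⊕ N) : diagLoc M Z e (.inr (.inl s)) =
    koszul (X (srcVar B Z s) - X (tgtVar A Z (e s))) (hom_sub _ _) := rfl

theorem diagLoc_crossing (e : A ⊕ N ≃ B ⊕ N) (c : Γ) :
    diagLoc M Z e (.inr (.inr c)) = (M c).map Sum.inl := rfl

variable [Fintype A] [Fintype Γ] [Fintype Z] [DecidableEq A] [DecidableEq Γ] [DecidableEq Z]

/-- Renaming the circles and the marks of a diagram. -/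
def diagIso {N N' Z' : Type} [Fintype N] [DecidableEq N] [Fintype N'] [DecidableEq N']
    [Fintype Z'] [DecidableEq Z'] (e : A ⊕ N ≃ B ⊕ N) (e' : A ⊕ N' ≃ B ⊕ N') (ν : N ≃ N')
    (ζ : Z ≃ Z')
    (h : ∀ s, e' (Sum.map id ν s) = Sum.map id ν (e s)) {r : _ → _ → Prop} {r' : _ → _ → Prop}
    (hr : IsTournament r) (hr' : IsTournament r') :
    Iso ((prod hr (diagLoc M Z e)).restrict Sum.inl) ((prod hr' (diagLoc M Z' e')).restrict Sum.inl) :=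
  have hs : ∀ s, Sum.map id (Sum.map ζ ν) (srcVar B Z s) =
      srcVar B Z' (Sum.map id ν s : A ⊕ N') := by rintro (s | s) <;> rfl
  have ht : ∀ s, Sum.map id (Sum.map ζ ν) (tgtVar A Z s) =
      tgtVar A Z' (Sum.map id ν s : B ⊕ N') := by rintro (s | s) <;> rfl
  prodIso hr hr' _ _ ((Equiv.refl _).sumCongr (ζ.sumCongr ν))
    (ζ.sumCongr (((Equiv.refl _).sumCongr ν).sumCongr (Equiv.refl _)))
    (fun f => match f with
      | .inl _ => koszulSim _ 0 (isHomogeneous_zero _ _ _) 0 (isHomogeneous_zero _ _ _) (map_zero _)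
      | .inr (.inl s) => koszulSim _ (X (srcVar B Z s) - X (tgtVar A Z (e s))) (hom_sub _ _)
          (X (srcVar B Z' (Sum.map id ν s : A ⊕ N')) -
            X (tgtVar A Z' (e' (Sum.map id ν s : A ⊕ N')))) (hom_sub _ _) (by
          rw [map_sub, rename_X, rename_X]
          exact congrArg₂ (fun a b => X a - X b) (hs s)
            ((ht (e s)).trans (congrArg _ (h s).symm)))
      | .inr (.inr c) => mapMapSim (M c) Sum.inl _ Sum.inl rfl)
    Sum.inl Sum.inl fun _ => rfl

/-- Moving an extra element into the second summand. -/
def optionSumMid (X Y W : Type) : Option (X ⊕ Y ⊕ W) ≃ X ⊕ Option Y ⊕ W where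
  toFun
    | none => .inr (.inl none)
    | some (.inl x) => .inl x
    | some (.inr (.inl y)) => .inr (.inl (some y))
    | some (.inr (.inr w)) => .inr (.inr w)
  invFun
    | .inl x => some (.inl x)
    | .inr (.inl none) => none
    | .inr (.inl (some y)) => some (.inr (.inl y))
    | .inr (.inr w) => some (.inr (.inr w))
  left_inv := by rintro (_ | x | y | w) <;> rfl
  right_inv := by rintro (x | (_ | y) | w) <;> rfl

/-- Adding the first mark to the variables. -/
def markVar (A B Z : Type) (n : ℕ) : Option (DiagVar A B Z (Fin n)) ≃ DiagVar A B Z (Fin (n + 1)) where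
  toFun
    | none => .inr (.inr 0)
    | some (.inl x) => .inl x
    | some (.inr (.inl z)) => .inr (.inl z)
    | some (.inr (.inr i)) => .inr (.inr i.succ)
  invFun
    | .inl x => some (.inl x)
    | .inr (.inl z) => some (.inr (.inl z))
    | .inr (.inr i) => (finSuccEquiv n i).map fun i => .inr (.inr i)
  left_inv := by rintro (_ | x | z | i) <;> rfl
  right_inv := by
    rintro (x | z | i)
    · rfl
    · rfl
    · cases i using Fin.cases <;> rfl

theorem markVar_src (n : ℕ) (s : A ⊕ Fin n) :
    markVar A B Z n (some (srcVar B Z s)) = srcVar B Z ((splitMark A n).symm (some s)) := by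
  rcases s with s | s <;> rfl

theorem markVar_tgt (n : ℕ) (s : B ⊕ Fin n) :
    markVar A B Z n (some (tgtVar A Z s)) = tgtVar A Z ((splitMark B n).symm (some s)) := by
  rcases s with s | s <;> rfl

/-- The edges after singling out the first mark. -/
def splitEdges {n : ℕ} (e : A ⊕ Fin (n + 1) ≃ B ⊕ Fin (n + 1)) :
    Option (A ⊕ Fin n) ≃ Option (B ⊕ Fin n) :=
  ((splitMark A n).symm.trans e).trans (splitMark B n)

theorem apply_splitMark_symm {n : ℕ} (e : A ⊕ Fin (n + 1) ≃ B ⊕ Fin (n + 1))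
    (s : Option (A ⊕ Fin n)) :
    e ((splitMark A n).symm s) = (splitMark B n).symm (splitEdges e s) := by
  simp [splitEdges]

end Diagram

end Loc
end
end KRTangle

/-! ### Erasing one mark: closed edges and joined edges. -/

namespace KRTangle
noncomputable section
open Bicomplex

namespace Loc

section Diagram

variable {k : Type u} [Field k] {A B Γ : Type} (M : Γ → Loc k (A ⊕ B)) (Z : Type) {n : ℕ}

section Circle

/-- The first mark as a circle, on variables. -/
def circleVar (A B Z : Type) (n : ℕ) :
    DiagVar A B (Option Z) (Fin n) ≃ DiagVar A B Z (Fin (n + 1)) where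
  toFun
    | .inl x => .inl x
    | .inr (.inl none) => .inr (.inr 0)
    | .inr (.inl (some z)) => .inr (.inl z)
    | .inr (.inr i) => .inr (.inr i.succ)
  invFun
    | .inl x => .inl x
    | .inr (.inl z) => .inr (.inl (some z))
    | .inr (.inr i) => (finSuccEquiv n i).elim (.inr (.inl none)) fun i => .inr (.inr i)
  left_inv := by rintro (x | (_ | z) | i) <;> rfl
  right_inv := by
    rintro (x | z | i)
    · rfl
    · rfl
    · cases i using Fin.cases <;> rfl

/-- The first mark as a circle, on factors. -/
def circleFactor (A Γ Z : Type) (n : ℕ) :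
    Option Z ⊕ (A ⊕ Fin n) ⊕ Γ ≃ Z ⊕ (A ⊕ Fin (n + 1)) ⊕ Γ where
  toFun
    | .inl none => .inr (.inl (.inr 0))
    | .inl (some z) => .inl z
    | .inr (.inl s) => .inr (.inl ((splitMark A n).symm (some s)))
    | .inr (.inr c) => .inr (.inr c)
  invFun
    | .inl z => .inl (some z)
    | .inr (.inl s) => (splitMark A n s).elim (.inl none) fun s => .inr (.inl s)
    | .inr (.inr c) => .inr (.inr c)
  left_inv := by rintro ((_ | z) | (s | s) | c) <;> rfl
  right_inv := by
    rintro (z | (s | s) | c)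
    · rfl
    · rfl
    · cases s using Fin.cases <;> rfl
    · rfl

theorem circleVar_src (s : A ⊕ Fin n) :
    circleVar A B Z n (srcVar B (Option Z) s) = srcVar B Z ((splitMark A n).symm (some s)) := by
  rcases s with s | s <;> rfl

theorem circleVar_tgt (s : B ⊕ Fin n) :
    circleVar A B Z n (tgtVar A (Option Z) s) = tgtVar A Z ((splitMark B n).symm (some s)) := by
  rcases s with s | s <;> rfl

variable [Fintype A] [Fintype Γ] [Fintype Z] [DecidableEq A] [DecidableEq Γ] [DecidableEq Z]

/-- `removeNone` reroutes only the edge that ends at the mark. If this edge also starts there, all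
other edges stay as they are. -/
theorem apply_splitMark_symm_of_none (e : A ⊕ Fin (n + 1) ≃ B ⊕ Fin (n + 1))
    (h : splitEdges e none = none) (s : A ⊕ Fin n) :
    e ((splitMark A n).symm (some s)) =
      (splitMark B n).symm (some ((splitEdges e).removeNone s)) := by
  rw [apply_splitMark_symm]
  congr 1
  refine (Equiv.removeNone_some _ (Option.ne_none_iff_exists'.1 fun h' => ?_)).symm
  exact Option.some_ne_none _ ((splitEdges e).injective (h'.trans h.symm))

/-- Erasing a mark whose edge is closed creates a circle. -/
def circleIso (e : A ⊕ Fin (n + 1) ≃ B ⊕ Fin (n + 1)) (h : splitEdges e none = none)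
    {r : _ → _ → Prop} {r' : _ → _ → Prop} (hr : IsTournament r) (hr' : IsTournament r') :
    Iso ((prod hr (diagLoc M (Option Z) (splitEdges e).removeNone)).restrict Sum.inl)
      ((prod hr' (diagLoc M Z e)).restrict Sum.inl) :=
  prodIso hr hr' _ _ (circleVar A B Z n) (circleFactor A Γ Z n)
    (fun f => match f with
      -- The closed edge has the differential `t - t = 0`, which is that of a circle, and the
      -- variable of the mark becomes the variable of the circle.
      | .inl none => koszulSim _ 0 (isHomogeneous_zero _ _ _)
          (X (srcVar B Z (.inr 0)) - X (tgtVar A Z (e (.inr 0)))) (hom_sub _ _) (by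
          rw [show e (.inr 0) = .inr 0 from (apply_splitMark_symm e none).trans
            (congrArg _ h), map_zero]
          exact (sub_self _).symm)
      | .inl (some _) => koszulSim _ 0 (isHomogeneous_zero _ _ _) 0 (isHomogeneous_zero _ _ _)
          (map_zero _)
      | .inr (.inl s) => koszulSim _
          (X (srcVar B (Option Z) s) - X (tgtVar A (Option Z) ((splitEdges e).removeNone s)))
          (hom_sub _ _)
          (X (srcVar B Z ((splitMark A n).symm (some s))) -
            X (tgtVar A Z (e ((splitMark A n).symm (some s))))) (hom_sub _ _) (by
          rw [map_sub, rename_X, rename_X, circleVar_src, circleVar_tgt,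
            apply_splitMark_symm_of_none e h])
      | .inr (.inr c) => mapMapSim (M c) Sum.inl _ Sum.inl rfl)
    Sum.inl Sum.inl fun _ => rfl

end Circle

section Join

variable [Fintype A] [Fintype Γ] [Fintype Z] [DecidableEq A] [DecidableEq Γ] [DecidableEq Z]

/-- The factors of a diagram apart from one edge. -/
def restLoc (e : A ⊕ Fin n ≃ B ⊕ Fin n) (v : A ⊕ Fin n) (g : Z ⊕ {s // s ≠ v} ⊕ Γ) :
    Loc k (DiagVar A B Z (Fin n)) := diagLoc M Z e (g.map id (Sum.map Subtype.val id))

/-- Adding the edge that was left out. -/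
def edgeFactor (Γ Z : Type) (v : A ⊕ Fin n) :
    Option (Z ⊕ {s : A ⊕ Fin n // s ≠ v} ⊕ Γ) ≃ Z ⊕ (A ⊕ Fin n) ⊕ Γ :=
  (optionSumMid _ _ _).trans
    ((Equiv.refl _).sumCongr ((Equiv.optionSubtypeNe v).sumCongr (Equiv.refl _)))

/-- The edge factors after singling out a mark. -/
def markFactor (Γ Z : Type) (v : A ⊕ Fin n) :
    Option (Option (Z ⊕ {s : A ⊕ Fin n // s ≠ v} ⊕ Γ)) ≃ Z ⊕ (A ⊕ Fin (n + 1)) ⊕ Γ :=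
  ((Equiv.optionCongr (edgeFactor Γ Z v)).trans (optionSumMid _ _ _)).trans
    ((Equiv.refl _).sumCongr ((splitMark A n).symm.sumCongr (Equiv.refl _)))

/-- The diagram with the joined edge. -/
def withEdgeIso (e : A ⊕ Fin n ≃ B ⊕ Fin n) (v : A ⊕ Fin n)
    {r : _ → _ → Prop} {r' : _ → _ → Prop} (hr : IsTournament r) (hr' : IsTournament r') :
    Iso ((prod hr (withEdge (restLoc M Z e v) (tgtVar A Z (e v)) (srcVar B Z v))).restrict Sum.inl)
      ((prod hr' (diagLoc M Z e)).restrict Sum.inl) :=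
  prodIso hr hr' _ _ (Equiv.refl _) (edgeFactor Γ Z v)
    (fun f => match f with
      -- In `withEdge` the joined edge appears as target minus source, in a diagram as source minus
      -- target; a sign on one generator makes up for it.
      | none => koszulNegSim _ (X (tgtVar A Z (e v)) - X (srcVar B Z v)) (hom_sub _ _)
          (X (srcVar B Z v) - X (tgtVar A Z (e v))) (hom_sub _ _) (by
            rw [map_sub, rename_X, rename_X, neg_sub]
            rfl)
      | some (.inl _) => koszulSim _ 0 (isHomogeneous_zero _ _ _) 0 (isHomogeneous_zero _ _ _)
          (map_zero _)
      | some (.inr (.inl s)) => koszulSim _ (X (srcVar B Z s.1) - X (tgtVar A Z (e s.1)))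
          (hom_sub _ _) (X (srcVar B Z s.1) - X (tgtVar A Z (e s.1))) (hom_sub _ _) (by
            rw [map_sub, rename_X, rename_X]
            rfl)
      | some (.inr (.inr c)) => mapMapSim (M c) Sum.inl _ Sum.inl rfl)
    Sum.inl Sum.inl fun _ => rfl

set_option synthInstance.maxSize 1000 in
set_option synthInstance.maxHeartbeats 200000 in
/-- The diagram with the mark on the edge. -/
def withMarkIso (e : A ⊕ Fin (n + 1) ≃ B ⊕ Fin (n + 1)) (v : A ⊕ Fin n)
    (hv : splitEdges e (some v) = none)
    {r : _ → _ → Prop} {r' : _ → _ → Prop} (hr : IsTournament r) (hr' : IsTournament r') :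
    Iso ((prod hr (withMark (restLoc M Z (splitEdges e).removeNone v)
        (tgtVar A Z ((splitEdges e).removeNone v)) (srcVar B Z v))).restrict (some ∘ Sum.inl))
      ((prod hr' (diagLoc M Z e)).restrict Sum.inl) :=
  prodIso hr hr' _ _ (markVar A B Z n) (markFactor Γ Z v)
    (fun f => match f with
      -- The edge that starts at the mark. It ends where the joined edge from `v` ends, because the
      -- edge from `v` runs to the mark.
      | none => koszulSim (markVar A B Z n) (X none - X (some (tgtVar A Z ((splitEdges e).removeNone v))))
          (hom_sub _ _) (X (srcVar B Z (.inr 0)) - X (tgtVar A Z (e (.inr 0)))) (hom_sub _ _) (by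
            rw [map_sub, rename_X, rename_X, markVar_tgt, Equiv.removeNone_none _ hv,
              ← apply_splitMark_symm]
            rfl)
      -- The edge from `v` to the mark, for which the mark is the target; hence the opposite sign.
      | some none => koszulNegSim (markVar A B Z n) (X none - X (some (srcVar B Z v))) (hom_sub _ _)
          (X (srcVar B Z ((splitMark A n).symm (some v))) -
            X (tgtVar A Z (e ((splitMark A n).symm (some v))))) (hom_sub _ _) (by
            rw [map_sub, rename_X, rename_X, neg_sub, markVar_src, apply_splitMark_symm, hv]
            rfl)
      | some (some (.inl _)) => ((koszulSim some 0 (isHomogeneous_zero _ _ _) 0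
          (isHomogeneous_zero _ _ _) (map_zero _)).mapSim (markVar A B Z n)).trans
          (koszulSim _ 0 (isHomogeneous_zero _ _ _) 0 (isHomogeneous_zero _ _ _) (map_zero _))
      | some (some (.inr (.inl s))) => ((koszulSim some
          (X (srcVar B Z s.1) - X (tgtVar A Z ((splitEdges e).removeNone s.1))) (hom_sub _ _)
          (X (some (srcVar B Z s.1)) - X (some (tgtVar A Z ((splitEdges e).removeNone s.1))))
          (hom_sub _ _) (by rw [map_sub, rename_X, rename_X])).mapSim (markVar A B Z n)).trans
          (koszulSim (markVar A B Z n)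
          (X (some (srcVar B Z s.1)) - X (some (tgtVar A Z ((splitEdges e).removeNone s.1))))
          (hom_sub _ _) (X (srcVar B Z ((splitMark A n).symm (some s.1))) -
            X (tgtVar A Z (e ((splitMark A n).symm (some s.1))))) (hom_sub _ _) (by
            rw [map_sub, rename_X, rename_X, markVar_src, markVar_tgt, Equiv.removeNone_some,
              apply_splitMark_symm]
            refine Option.ne_none_iff_exists'.1 fun h' => s.2 ?_
            exact Option.some_injective _ ((splitEdges e).injective (h'.trans hv.symm))))
      | some (some (.inr (.inr c))) => ((mapMapSim (M c) Sum.inl some (some ∘ Sum.inl) rfl).mapSim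
          (markVar A B Z n)).trans (mapMapSim (M c) (some ∘ Sum.inl) (markVar A B Z n) Sum.inl rfl))
    (some ∘ Sum.inl) Sum.inl fun _ => rfl

end Join

end Diagram

end Loc
end
end KRTangle

/-! ### Erasing all marks. -/

namespace KRTangle
noncomputable section
open Bicomplex

theorem exists_isTournament (F : Type) [Fintype F] [DecidableEq F] :
    ∃ r : F → F → Prop, IsTournament r := by
  exact ⟨_, Loc.isTournament_comp (isTournament_lt _) (Fintype.equivFin F)⟩

namespace Loc

variable {k : Type u} [Field k] {A B Γ : Type} (M : Γ → Loc k (A ⊕ B)) [Fintype A] [Fintype Γ]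
  [DecidableEq A] [DecidableEq Γ]

set_option synthInstance.maxSize 1000 in
set_option synthInstance.maxHeartbeats 200000 in
/-- Erasing a mark that joins two edges. -/
theorem htpyEquiv_splitEdges (Z : Type) [Fintype Z] [DecidableEq Z] {n : ℕ}
    (e : A ⊕ Fin (n + 1) ≃ B ⊕ Fin (n + 1)) (h : splitEdges e none ≠ none)
    {r : _ → _ → Prop} {r' : _ → _ → Prop} (hr : IsTournament r) (hr' : IsTournament r') :
    HtpyEquiv ((prod hr (diagLoc M Z e)).restrict Sum.inl)
      ((prod hr' (diagLoc M Z (splitEdges e).removeNone)).restrict Sum.inl) := by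
  -- `v` is the source of the edge that ends at the mark; by `h` it is not the mark itself.
  obtain ⟨v, hv⟩ : ∃ v, splitEdges e (some v) = none := by
    obtain ⟨v, hv⟩ := (splitEdges e).surjective none
    cases v with
    | none => exact absurd hv h
    | some v => exact ⟨v, hv⟩
  obtain ⟨r₀, hr₀⟩ := exists_isTournament (Z ⊕ {s : A ⊕ Fin n // s ≠ v} ⊕ Γ)
  have h1 := (withMarkIso M Z e v hv (isTournament_optRel (isTournament_optRel hr₀))
    hr).htpyEquiv.symm
  have h2 := (htpyEquiv_withEdge hr₀ (restLoc M Z (splitEdges e).removeNone v)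
    (tgtVar A Z ((splitEdges e).removeNone v)) (srcVar B Z v)).restrict
      (Sum.inl : A ⊕ B → DiagVar A B Z (Fin n))
  have h3 := (withEdgeIso M Z (splitEdges e).removeNone v (isTournament_optRel hr₀) hr').htpyEquiv
  exact (h1.trans (restrictRestrict _ _ _).htpyEquiv.symm).trans (h2.trans h3)

/-- Erasing all marks. -/
theorem htpyEquiv_eraseMarks : ∀ (n : ℕ) (Z Z' : Type) [Fintype Z] [Fintype Z'] [DecidableEq Z]
    [DecidableEq Z'] (e : A ⊕ Fin n ≃ B ⊕ Fin n) (_ : Z' ≃ Z ⊕ Fin (eraseMarks n e).2)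
    {r : _ → _ → Prop} {r' : _ → _ → Prop} (hr : IsTournament r) (hr' : IsTournament r'),
    HtpyEquiv ((prod hr (diagLoc M Z e)).restrict Sum.inl)
      ((prod hr' (diagLoc M Z' ((eraseMarks n e).1.sumCongr (Equiv.refl (Fin 0))))).restrict
        Sum.inl) := by
  intro n
  induction n with
  | zero =>
    intro Z Z' _ _ _ _ e ζ r r' hr hr'
    refine (diagIso M Z e _ (Equiv.refl _) (ζ.trans (Equiv.sumEmpty Z (Fin 0))).symm ?_ hr
      hr').htpyEquiv
    rintro (s | s)
    · change Sum.inl _ = _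
      rcases hs : e (.inl s) with t | t
      · simp [eraseMarks, hs]
      · exact t.elim0
    · exact s.elim0
  | succ n ih =>
    intro Z Z' _ _ _ _ e ζ r r' hr hr'
    by_cases h : splitEdges e none = none
    · have h2 : (eraseMarks (n + 1) e).2 = (eraseMarks n (splitEdges e).removeNone).2 + 1 := by
        change _ + (if (splitEdges e none).isNone then 1 else 0) = _
        rw [h]
        rfl
      obtain ⟨r₀, hr₀⟩ := exists_isTournament (Option Z ⊕ (A ⊕ Fin n) ⊕ Γ)
      refine (circleIso M Z e h hr₀ hr).htpyEquiv.symm.trans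
        (ih (Option Z) Z' (splitEdges e).removeNone (ζ.trans ?_) hr₀ hr')
      rw [h2]
      -- All circles have the same factor, so only their number matters and any bijection will do.
      -- The erased mark accounts for one more circle.
      refine Fintype.equivOfCardEq ?_
      simp only [Fintype.card_sum, Fintype.card_fin, Fintype.card_option]
      ring
    · have h2 : (eraseMarks (n + 1) e).2 = (eraseMarks n (splitEdges e).removeNone).2 := by
        change _ + (if (splitEdges e none).isNone then 1 else 0) = _
        rw [if_neg (by simpa using h)]
        rfl
      obtain ⟨r₀, hr₀⟩ := exists_isTournament (Z ⊕ (A ⊕ Fin n) ⊕ Γ)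
      refine (htpyEquiv_splitEdges M Z e h hr hr₀).trans
        (ih Z Z' (splitEdges e).removeNone (ζ.trans (Equiv.cast ?_)) hr₀ hr')
      rw [h2]

end Loc
end
end KRTangle

/-! ### The Khovanov-Rozansky complex in coordinates. -/

namespace KRTangle
noncomputable section
open Bicomplex

namespace Loc

variable {k : Type u} [Field k] {σ ρ : Type}

/-- Renaming the variables by the identity. -/
def mapIdSim (L : Loc k σ) (φ : σ → σ) (h : φ = id) : Sim (L.map φ) L where
  e := Equiv.refl _
  u _ := 1
  hu _ := rfl
  hd _ := rfl
  vd _ := rfl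
  qd _ := rfl
  A z w := by subst h; simp
  B z w := by subst h; simp

/-- The tensor product of free bicomplexes. -/
def tensorFree {J : Type} [Fintype J] [LinearOrder J] (L : J → Loc k σ) (ψ : ρ → σ) :
    Iso ((Bicomplex.tensor fun j => (L j).toBicomplex).restrict ψ)
      ((prod (isTournament_lt J) L).restrict ψ) :=
  -- Every factor is regarded as a block with one slot and no extra variables, so that flattening of
  -- nested products applies.
  have hr : ∀ _ : J, IsTournament fun _ _ : Unit => False :=
    fun _ => isTournament_of_subsingleton Unit
  haveI : IsEmpty (Σ _ : J, Empty) := ⟨fun x => x.2.elim⟩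
  let ε : (Σ _ : J, Empty) ⊕ σ ≃ σ := Equiv.emptySum _ σ
  (((Iso.tensor fun j => (L j).single).trans
    (tensorProd hr fun j _ => (L j).map (Sum.inr : σ → Empty ⊕ σ))).restrict ψ).trans
    ((restrictRestrict ψ Sum.inr _).trans
      (prodIso (isTournament_sigmaLex hr) (isTournament_lt J) _ L ε
        (Equiv.sigmaUnique J fun _ => Unit)
        (fun p => (mapMapSim ((L p.1).map Sum.inr) (sumEmb σ (fun _ : J => Empty) p.1) ε _ rfl).trans
          ((mapMapSim (L p.1) Sum.inr _ id rfl).trans (mapIdSim (L p.1) id rfl)))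
        (Sum.inr ∘ ψ) ψ fun _ => rfl))

end Loc

namespace Tangle

variable {k : Type u} [Field k] (μ ν : k) {P : SignedPoints} (T : Tangle P)

/-- The local data of the factors of the Khovanov-Rozansky complex. -/
def loc : T.Factor → Loc k T.Var
  | .inl _ => Loc.koszul 0 (isHomogeneous_zero _ _ _)
  | .inr (.inl s) => Loc.koszul (X (T.src s) - X (T.tgt (T.next s))) (hom_sub _ _)
  | .inr (.inr c) => Loc.crossing μ ν (T.sign c) (T.src (.inl (c, 0))) (T.src (.inl (c, 1)))
      (T.tgt (.inl (c, 0))) (T.tgt (.inl (c, 1)))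

theorem factor_eq : T.factor μ ν = fun f => (T.loc μ ν f).toBicomplex := by
  funext f
  rcases f with z | s | c
  · rfl
  · rfl
  · change (if T.sign c = 1 then _ else _) = Loc.toBicomplex (Loc.crossing _ _ _ _ _ _ _)
    rw [Loc.crossing]
    split_ifs <;> rfl

/-- The Khovanov-Rozansky complex as a free bicomplex. -/
def isoProd : Iso (T.KR₀ μ ν) ((Loc.prod (isTournament_lt T.Factor) (T.loc μ ν)).restrict T.endVar) := by
  unfold KR₀
  rw [factor_eq]
  exact Loc.tensorFree (T.loc μ ν) T.endVar

/-- The crossings of a diagram, over the variables of the flags. -/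
def crossingLoc (c : T.Crossing) : Loc k (Source T.Crossing P ⊕ Target T.Crossing P) :=
  Loc.crossing μ ν (T.sign c) (.inl (.inl (c, 0))) (.inl (.inl (c, 1)))
    (.inr (.inl (c, 0))) (.inr (.inl (c, 1)))

end Tangle

/-- The flag of an endpoint. -/
def endFlag (Γ : Type) (P : SignedPoints) (x : Fin P.n) : Source Γ P ⊕ Target Γ P :=
  if h : P.sign x = 1 then .inr (.inr ⟨x, h⟩) else .inl (.inr ⟨x, h⟩)

namespace Tangle

variable {k : Type u} [Field k] (μ ν : k) {P : SignedPoints} (T : Tangle P)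

/-- The variables of a tangle diagram as the variables of a diagram without marks. -/
def varEquiv : T.Var ≃
    Loc.DiagVar (Source T.Crossing P) (Target T.Crossing P) (Fin T.circles) (Fin 0) :=
  (Equiv.sumAssoc _ _ _).symm.trans ((Equiv.refl _).sumCongr (Equiv.sumEmpty _ (Fin 0)).symm)

theorem varEquiv_endVar (x : Fin P.n) : T.varEquiv (T.endVar x) = .inl (endFlag T.Crossing P x) := by
  unfold endVar endFlag
  split_ifs <;> rfl

theorem loc_circle (z : Fin T.circles) :
    T.loc μ ν (.inl z) = Loc.koszul 0 (isHomogeneous_zero _ _ _) := rfl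

theorem loc_edge (s : Source T.Crossing P) : T.loc μ ν (.inr (.inl s)) =
    Loc.koszul (X (T.src s) - X (T.tgt (T.next s))) (hom_sub _ _) := rfl

theorem loc_crossing (c : T.Crossing) : T.loc μ ν (.inr (.inr c)) =
    Loc.crossing μ ν (T.sign c) (T.src (.inl (c, 0))) (T.src (.inl (c, 1)))
      (T.tgt (.inl (c, 0))) (T.tgt (.inl (c, 1))) := rfl

theorem varEquiv_src (s : Source T.Crossing P) : T.varEquiv (T.src s) = .inl (.inl s) := rfl

theorem varEquiv_tgt (s : Target T.Crossing P) : T.varEquiv (T.tgt s) = .inl (.inr s) := rfl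

/-- The factors of a diagram without marks. -/
def factorEquiv : T.Factor ≃ Fin T.circles ⊕ (Source T.Crossing P ⊕ Fin 0) ⊕ T.Crossing :=
  (Equiv.refl _).sumCongr ((Equiv.sumEmpty _ (Fin 0)).symm.sumCongr (Equiv.refl _))

/-- The factors of a tangle diagram are those of a diagram without marks. -/
def locSim : ∀ f : T.Factor, Loc.Sim ((T.loc μ ν f).map T.varEquiv)
    (Loc.diagLoc (T.crossingLoc μ ν) (Fin T.circles) (T.next.sumCongr (Equiv.refl (Fin 0)))
      (T.factorEquiv f))
  | .inl z => by
    change Loc.Sim _ (Loc.diagLoc _ _ _ (.inl z))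
    rw [loc_circle, Loc.diagLoc_circle]
    exact Loc.koszulSim _ 0 (isHomogeneous_zero _ _ _) 0 (isHomogeneous_zero _ _ _) (map_zero _)
  | .inr (.inl s) => by
    change Loc.Sim _ (Loc.diagLoc _ _ _ (.inr (.inl (.inl s))))
    rw [loc_edge, Loc.diagLoc_edge]
    refine Loc.koszulSim _ _ _ _ _ ?_
    rw [map_sub, rename_X, rename_X, varEquiv_src, varEquiv_tgt]
    exact congrArg₂ (fun a b => X a - X b) rfl rfl
  | .inr (.inr c) => by
    change Loc.Sim _ (Loc.diagLoc _ _ _ (.inr (.inr c)))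
    rw [loc_crossing, Loc.diagLoc_crossing]
    exact (Loc.crossingSim μ ν (T.sign c) T.varEquiv _ _ _ _ (T.varEquiv_src _) (T.varEquiv_src _)
      (T.varEquiv_tgt _) (T.varEquiv_tgt _)).trans
        (Loc.crossingSim μ ν (T.sign c) Sum.inl _ _ _ _ rfl rfl rfl rfl).symm

/-- The Khovanov-Rozansky complex as the complex of a diagram without marks. -/
def isoDiag [iF : Fintype (Fin T.circles ⊕ (Source T.Crossing P ⊕ Fin 0) ⊕ T.Crossing)]
    [iD : DecidableEq (Fin T.circles ⊕ (Source T.Crossing P ⊕ Fin 0) ⊕ T.Crossing)]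
    {r : _ → _ → Prop} (hr : IsTournament r) :
    Iso (T.KR₀ μ ν) (((Loc.prod hr (Loc.diagLoc (T.crossingLoc μ ν) (Fin T.circles)
      (T.next.sumCongr (Equiv.refl (Fin 0))))).restrict Sum.inl).restrict
        (endFlag T.Crossing P)) :=
  ((T.isoProd μ ν).trans (Loc.prodIso (isTournament_lt T.Factor) hr (T.loc μ ν)
    (Loc.diagLoc (T.crossingLoc μ ν) (Fin T.circles) (T.next.sumCongr (Equiv.refl (Fin 0))))
    T.varEquiv T.factorEquiv (T.locSim μ ν)
    T.endVar (Sum.inl ∘ endFlag T.Crossing P) T.varEquiv_endVar)).trans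
    (restrictRestrict _ _ _).symm

/-- The variables that do not belong to the endpoints. -/
abbrev InnerVar : Type := (T.Crossing × Fin 2) ⊕ (T.Crossing × Fin 2) ⊕ Fin T.circles

/-- The variables of the endpoints and the others. -/
def splitVar : T.Var ≃ T.InnerVar ⊕ Fin P.n where
  toFun
    | .inl (.inl c) => .inl (.inl c)
    | .inl (.inr x) => .inr x.1
    | .inr (.inl (.inl c)) => .inl (.inr (.inl c))
    | .inr (.inl (.inr x)) => .inr x.1
    | .inr (.inr z) => .inl (.inr (.inr z))
  invFun
    | .inl (.inl c) => .inl (.inl c)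
    | .inl (.inr (.inl c)) => .inr (.inl (.inl c))
    | .inl (.inr (.inr z)) => .inr (.inr z)
    | .inr x => T.endVar x
  left_inv := by
    rintro ((c | x) | (c | x) | z)
    · rfl
    · exact dif_neg x.2
    · rfl
    · exact dif_pos x.2
    · rfl
  right_inv := by
    rintro ((c | c | z) | x)
    · rfl
    · rfl
    · rfl
    · dsimp only [endVar]
      split_ifs <;> rfl

/-- The variables of the endpoints become the coefficient variables of the product, so that
extension of scalars amounts to renaming them by `extendProd`. -/
theorem splitVar_endVar (x : Fin P.n) : T.splitVar (T.endVar x) = .inr x :=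
  T.splitVar.apply_symm_apply (.inr x)

/-- The local data of a tangle diagram over a ring with the variables of its endpoints. -/
def extLoc {τ : Type} (φ : Fin P.n → τ) (f : T.Factor) : Loc k (T.InnerVar ⊕ τ) :=
  ((T.loc μ ν f).map T.splitVar).map (Sum.map id φ)

/-- The extension of scalars of a Khovanov-Rozansky complex. -/
def extendIso {τ : Type} (φ : Fin P.n → τ) : Iso ((T.KR₀ μ ν).extend φ)
    ((Loc.prod (isTournament_lt T.Factor) (T.extLoc μ ν φ)).restrict Sum.inr) :=
  (((T.isoProd μ ν).trans (Loc.prodIso (isTournament_lt T.Factor) (isTournament_lt T.Factor)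
    (T.loc μ ν) (fun f => (T.loc μ ν f).map T.splitVar) T.splitVar (Equiv.refl _)
    (fun _ => Loc.Sim.ofEq rfl) T.endVar Sum.inr T.splitVar_endVar)).extend φ).trans
    (Loc.extendProd (isTournament_lt T.Factor) (fun f => (T.loc μ ν f).map T.splitVar) φ)

end Tangle

end
end KRTangle

/-! ### The action of an arc diagram as the pasted diagram with marks. -/

namespace KRTangle
noncomputable section
open Bicomplex

/-- Families of local data over a ring with additional variables. -/
structure Loc.Pack (k : Type u) [Field k] (σ : Type) : Type (u + 1) where
  E : Type
  F : Type
  [fintype : Fintype F]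
  [decidableEq : DecidableEq F]
  r : F → F → Prop
  hr : IsTournament r
  L : F → Loc k (E ⊕ σ)

attribute [instance] Loc.Pack.fintype Loc.Pack.decidableEq

/-- The product of a family of local data over a ring with additional variables. -/
def Loc.Pack.toBicomplex {k : Type u} [Field k] {σ : Type} (p : Loc.Pack k σ) : Bicomplex k σ :=
  (Loc.prod p.hr p.L).restrict Sum.inr

namespace ArcDiagram

variable {k : Type u} [Field k] (μ ν : k) {m : ℕ} {P₀ : SignedPoints} {P : Fin m → SignedPoints}
  (η : ArcDiagram P₀ P) (T : ∀ i, Tangle (P i))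

/-- The local data of an arc. -/
def arcPack (a : Tail P₀ P) : Loc.Pack k (Var P₀ P) where
  E := Empty
  F := Unit
  r := fun _ _ => False
  hr := Loc.isTournament_of_subsingleton Unit
  L := fun _ => (Loc.koszul (X (headVar (η.arc a)) - X (tailVar a)) (hom_sub _ _)).map Sum.inr

/-- The local data of a tangle diagram in a hole. -/
def holePack (i : Fin m) : Loc.Pack k (Var P₀ P) where
  E := (T i).InnerVar
  F := (T i).Factor
  r := fun a b => a < b
  hr := isTournament_lt (T i).Factor
  L := (T i).extLoc μ ν fun x => .inr ⟨i, x⟩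

/-- The local data of the factors in the action of an arc diagram. -/
def pack : Factor P₀ P → Loc.Pack k (Var P₀ P)
  | .inl a => η.arcPack a
  | .inr i => holePack μ ν T i

theorem factor_arc (C : ∀ i, Bicomplex k (Fin (P i).n)) (a : Tail P₀ P) : η.factor C (.inl a) =
    (Loc.koszul (X (headVar (η.arc a)) - X (tailVar a)) (hom_sub _ _)).toBicomplex := rfl

theorem factor_hole (C : ∀ i, Bicomplex k (Fin (P i).n)) (i : Fin m) : η.factor C (.inr i) =
    (C i).extend fun x => .inr ⟨i, x⟩ := rfl

theorem pack_arc (a : Tail P₀ P) : η.pack μ ν T (.inl a) = η.arcPack a := rfl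

theorem pack_hole (i : Fin m) : η.pack μ ν T (.inr i) = holePack μ ν T i := rfl

theorem holePack_toBicomplex (i : Fin m) : (holePack (P₀ := P₀) μ ν T i).toBicomplex =
    Bicomplex.restrict Sum.inr (Loc.prod (isTournament_lt (T i).Factor)
      ((T i).extLoc μ ν fun x => (Sum.inr ⟨i, x⟩ : Var P₀ P))) := rfl

theorem arcPack_toBicomplex (a : Tail P₀ P) : (η.arcPack (k := k) a).toBicomplex =
    Bicomplex.restrict (Sum.inr : _ → Empty ⊕ Var P₀ P)
      (Loc.prod (Loc.isTournament_of_subsingleton Unit) fun _ =>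
      (Loc.koszul (X (headVar (η.arc a)) - X (tailVar a)) (hom_sub _ _)).map Sum.inr) := rfl

/-- Each factor in the action of an arc diagram is a product. -/
def factorIso : ∀ j : Factor P₀ P, Iso (η.factor (fun i => (T i).KR₀ μ ν) j)
    (η.pack μ ν T j).toBicomplex
  | .inl a => by
    rw [factor_arc, pack_arc, arcPack_toBicomplex]
    exact (Loc.koszul (X (headVar (η.arc a)) - X (tailVar a)) (hom_sub _ _)).single
  | .inr i => by
    rw [factor_hole, pack_hole, holePack_toBicomplex]
    exact (T i).extendIso μ ν fun x => (Sum.inr ⟨i, x⟩ : Var P₀ P)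

/-- The additional variables of the factors in the action of an arc diagram. -/
abbrev ExtraVar (j : Factor P₀ P) : Type := (η.pack μ ν T j).E

/-- The factors of the factors in the action of an arc diagram. -/
abbrev SubFactor (j : Factor P₀ P) : Type := (η.pack μ ν T j).F

/-- The local data of the factors. -/
abbrev subLoc (j : Factor P₀ P) : SubFactor μ ν η T j → Loc k (ExtraVar μ ν η T j ⊕ Var P₀ P) :=
  (η.pack μ ν T j).L

/-- The action of an arc diagram on Khovanov-Rozansky complexes as a product. -/
def actIso : Iso (η.act fun i => (T i).KR₀ μ ν)
    ((Loc.prod (isTournament_sigmaLex fun j => (η.pack μ ν T j).hr)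
      (Loc.sigmaLoc (subLoc μ ν η T))).restrict (Sum.inr ∘ Sum.inl)) :=
  (((Iso.tensor (η.factorIso μ ν T)).trans
    (Loc.tensorProd (fun j => (η.pack μ ν T j).hr) (subLoc μ ν η T))).restrict Sum.inl).trans
    (restrictRestrict _ _ _)

/-- The sources of the glued diagram. -/
abbrev GlueSource : Type := ((Σ i, (T i).Crossing) × Fin 2) ⊕ P₀.Neg

/-- The targets of the glued diagram. -/
abbrev GlueTarget : Type := ((Σ i, (T i).Crossing) × Fin 2) ⊕ P₀.Pos

/-- The variables of the glued diagram with marks. -/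
abbrev GlueVar : Type :=
  Loc.DiagVar (GlueSource (P₀ := P₀) T) (GlueTarget (P₀ := P₀) T) (Σ i, Fin (T i).circles) (Mark P)

/-- The mark given by a point. -/
def markOf (P : Fin m → SignedPoints) (x : Σ i, Fin (P i).n) : Mark P :=
  if h : (P x.1).sign x.2 = 1 then .inl ⟨x.1, x.2, h⟩ else .inr ⟨x.1, x.2, h⟩

/-- The flag of an outer endpoint. -/
def outerFlag (x : Fin P₀.n) : GlueSource (P₀ := P₀) T ⊕ GlueTarget (P₀ := P₀) T :=
  if h : P₀.sign x = 1 then .inr (.inr ⟨x, h⟩) else .inl (.inr ⟨x, h⟩)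

/-- The variables of the factors as the variables of the glued diagram. -/
def glueVar : (Σ j : Factor P₀ P, ExtraVar μ ν η T j) ⊕ Var P₀ P ≃ GlueVar (P₀ := P₀) T where
  toFun
    | .inl ⟨.inr i, .inl (c, b)⟩ => .inl (.inl (.inl (⟨i, c⟩, b)))
    | .inl ⟨.inr i, .inr (.inl (c, b))⟩ => .inl (.inr (.inl (⟨i, c⟩, b)))
    | .inl ⟨.inr i, .inr (.inr z)⟩ => .inr (.inl ⟨i, z⟩)
    | .inr (.inl x) => .inl (outerFlag T x)
    | .inr (.inr x) => .inr (.inr (markOf P x))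
  invFun
    | .inl (.inl (.inl (⟨i, c⟩, b))) => .inl ⟨.inr i, .inl (c, b)⟩
    | .inl (.inr (.inl (⟨i, c⟩, b))) => .inl ⟨.inr i, .inr (.inl (c, b))⟩
    | .inr (.inl ⟨i, z⟩) => .inl ⟨.inr i, .inr (.inr z)⟩
    | .inl (.inl (.inr x)) => .inr (.inl x.1)
    | .inl (.inr (.inr x)) => .inr (.inl x.1)
    | .inr (.inr (.inl ⟨i, x⟩)) => .inr (.inr ⟨i, x.1⟩)
    | .inr (.inr (.inr ⟨i, x⟩)) => .inr (.inr ⟨i, x.1⟩)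
  left_inv := by
    rintro (⟨_ | i, e⟩ | x | x)
    · exact e.elim
    · rcases e with ⟨c, b⟩ | ⟨c, b⟩ | z <;> rfl
    · dsimp only [outerFlag]
      split_ifs <;> rfl
    · dsimp only [markOf]
      split_ifs <;> rfl
  right_inv := by
    rintro (((⟨⟨i, c⟩, b⟩ | x) | (⟨⟨i, c⟩, b⟩ | x)) | (⟨i, z⟩ | (⟨i, x⟩ | ⟨i, x⟩)))
    · rfl
    · exact congrArg Sum.inl (dif_neg x.2)
    · rfl
    · exact congrArg Sum.inl (dif_pos x.2)
    · rfl
    · exact congrArg (Sum.inr ∘ Sum.inr) (dif_pos x.2)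
    · exact congrArg (Sum.inr ∘ Sum.inr) (dif_neg x.2)

/-- The factors of the factors as factors of the glued diagram. -/
def glueFactor : (Σ j : Factor P₀ P, SubFactor μ ν η T j) ≃
    (Σ i, Fin (T i).circles) ⊕ (GlueSource (P₀ := P₀) T ⊕ Mark P) ⊕ (Σ i, (T i).Crossing) where
  toFun
    | ⟨.inl (.inl x), _⟩ => .inr (.inl (.inl (.inr x)))
    | ⟨.inl (.inr x), _⟩ => .inr (.inl (.inr (.inl x)))
    | ⟨.inr i, .inl z⟩ => .inl ⟨i, z⟩
    | ⟨.inr i, .inr (.inl (.inl (c, b)))⟩ => .inr (.inl (.inl (.inl (⟨i, c⟩, b))))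
    | ⟨.inr i, .inr (.inl (.inr x))⟩ => .inr (.inl (.inr (.inr ⟨i, x⟩)))
    | ⟨.inr i, .inr (.inr c)⟩ => .inr (.inr ⟨i, c⟩)
  invFun
    | .inr (.inl (.inl (.inr x))) => ⟨.inl (.inl x), ()⟩
    | .inr (.inl (.inr (.inl x))) => ⟨.inl (.inr x), ()⟩
    | .inl ⟨i, z⟩ => ⟨.inr i, .inl z⟩
    | .inr (.inl (.inl (.inl (⟨i, c⟩, b)))) => ⟨.inr i, .inr (.inl (.inl (c, b)))⟩
    | .inr (.inl (.inr (.inr ⟨i, x⟩))) => ⟨.inr i, .inr (.inl (.inr x))⟩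
    | .inr (.inr ⟨i, c⟩) => ⟨.inr i, .inr (.inr c)⟩
  left_inv := by
    rintro ⟨(x | x) | i, f⟩
    · rfl
    · rfl
    · rcases f with z | (⟨c, b⟩ | x) | c <;> rfl
  right_inv := by
    rintro (⟨i, z⟩ | ((⟨⟨i, c⟩, b⟩ | x) | (x | ⟨i, x⟩)) | ⟨i, c⟩) <;> rfl

/-- The crossings of the glued diagram. -/
def glueCrossing (c : Σ i, (T i).Crossing) :
    Loc k (GlueSource (P₀ := P₀) T ⊕ GlueTarget (P₀ := P₀) T) :=
  Loc.crossing μ ν ((T c.1).sign c.2) (.inl (.inl (c, 0))) (.inl (.inl (c, 1)))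
    (.inr (.inl (c, 0))) (.inr (.inl (c, 1)))

/-- A source of one of the diagrams as a source of the glued diagram. -/
def holeSource (i : Fin m) : Source (T i).Crossing (P i) → GlueSource (P₀ := P₀) T ⊕ Mark P
  | .inl (c, b) => .inl (.inl (⟨i, c⟩, b))
  | .inr x => .inr (.inr ⟨i, x⟩)

/-- A target of one of the diagrams as a target of the glued diagram. -/
def holeTarget (i : Fin m) : Target (T i).Crossing (P i) → GlueTarget (P₀ := P₀) T ⊕ Mark P
  | .inl (c, b) => .inl (.inl (⟨i, c⟩, b))
  | .inr x => .inr (.inl ⟨i, x⟩)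

/-- The tail of an arc as a source of the glued diagram. -/
def tailSource : Tail P₀ P → GlueSource (P₀ := P₀) T ⊕ Mark P
  | .inl x => .inl (.inr x)
  | .inr x => .inr (.inl x)

/-- The head of an arc as a target of the glued diagram. -/
def headTarget : Head P₀ P → GlueTarget (P₀ := P₀) T ⊕ Mark P
  | .inl x => .inl (.inr x)
  | .inr x => .inr (.inr x)

theorem markedEdges_holeSource (i : Fin m) (s : Source (T i).Crossing (P i)) :
    η.markedEdges T (holeSource T i s) = holeTarget T i ((T i).next s) := by
  -- The kind of flag at which the edge from `s` ends is not known, so the regrouping is evaluated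
  -- for all targets beforehand.
  have h : ∀ t : Target (T i).Crossing (P i), ((Equiv.refl _).sumCongr (Equiv.sumComm _ _))
      ((regroup (fun i => (T i).Crossing) (fun i => (P i).Neg) (fun i => (P i).Pos) P₀.Pos).symm
        (.inl ⟨i, t⟩)) = holeTarget T i t := by
    rintro (⟨c, b⟩ | x) <;> rfl
  rw [← h]
  rcases s with ⟨c, b⟩ | x <;> rfl

theorem markedEdges_tailSource (a : Tail P₀ P) :
    η.markedEdges T (tailSource T a) = headTarget T (η.arc a) := by
  have h : ∀ t : Head P₀ P, ((Equiv.refl _).sumCongr (Equiv.sumComm _ _))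
      ((regroup (fun i => (T i).Crossing) (fun i => (P i).Neg) (fun i => (P i).Pos) P₀.Pos).symm
        (.inr t)) = headTarget T t := by
    rintro (x | x) <;> rfl
  rw [← h]
  rcases a with x | x <;> rfl

/-- A variable of one of the diagrams in the glued diagram. -/
def holeVar (i : Fin m) (x : (T i).Var) : GlueVar (P₀ := P₀) T :=
  glueVar μ ν η T (Loc.sumEmb (Var P₀ P) (ExtraVar μ ν η T) (.inr i)
    (Sum.map id (fun x => .inr ⟨i, x⟩) ((T i).splitVar x)))

/-- An endpoint of sign `-1` is a source of `T i` and a mark of the pasted diagram. After the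
extension of scalars its variable is the one shared with the arc at that point, namely the variable
of the mark. -/
theorem holeVar_src (i : Fin m) (s : Source (T i).Crossing (P i)) :
    holeVar μ ν η T i ((T i).src s) = Loc.srcVar (GlueTarget (P₀ := P₀) T) _ (holeSource T i s) := by
  rcases s with ⟨c, b⟩ | x
  · rfl
  · exact congrArg (Sum.inr ∘ Sum.inr) (dif_neg x.2)

theorem holeVar_tgt (i : Fin m) (s : Target (T i).Crossing (P i)) :
    holeVar μ ν η T i ((T i).tgt s) = Loc.tgtVar (GlueSource (P₀ := P₀) T) _ (holeTarget T i s) := by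
  rcases s with ⟨c, b⟩ | x
  · rfl
  · exact congrArg (Sum.inr ∘ Sum.inr) (dif_pos x.2)

theorem glueVar_tailVar (a : Tail P₀ P) : glueVar μ ν η T (.inr (tailVar a)) =
    Loc.srcVar (GlueTarget (P₀ := P₀) T) _ (tailSource T a) := by
  rcases a with x | ⟨i, x⟩
  · exact congrArg Sum.inl (dif_neg x.2)
  · exact congrArg (Sum.inr ∘ Sum.inr) (dif_pos x.2)

theorem glueVar_headVar (a : Head P₀ P) : glueVar μ ν η T (.inr (headVar a)) =
    Loc.tgtVar (GlueSource (P₀ := P₀) T) _ (headTarget T a) := by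
  rcases a with x | ⟨i, x⟩
  · exact congrArg Sum.inl (dif_pos x.2)
  · exact congrArg (Sum.inr ∘ Sum.inr) (dif_neg x.2)

theorem glueFactor_arc (a : Tail P₀ P) (f : SubFactor μ ν η T (.inl a)) :
    glueFactor μ ν η T ⟨.inl a, f⟩ = .inr (.inl (tailSource T a)) := by
  rcases a with x | ⟨i, x⟩ <;> rfl

theorem glueFactor_edge (i : Fin m) (s : Source (T i).Crossing (P i)) :
    glueFactor μ ν η T ⟨.inr i, .inr (.inl s)⟩ = .inr (.inl (holeSource T i s)) := by
  rcases s with ⟨c, b⟩ | x <;> rfl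

theorem subLoc_arc (a : Tail P₀ P) (f : SubFactor μ ν η T (.inl a)) : subLoc μ ν η T (.inl a) f =
    (Loc.koszul (X (headVar (η.arc a)) - X (tailVar a)) (hom_sub _ _)).map Sum.inr := rfl

theorem subLoc_hole (i : Fin m) (f : (T i).Factor) : subLoc μ ν η T (.inr i) f =
    (((T i).loc μ ν f).map (T i).splitVar).map
      (Sum.map id fun x => (Sum.inr ⟨i, x⟩ : Var P₀ P)) := rfl

/-- The local data of the arcs in the glued diagram. -/
def glueSimArc (a : Tail P₀ P) (f : SubFactor μ ν η T (.inl a)) :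
    Loc.Sim ((Loc.sigmaLoc (subLoc μ ν η T) ⟨.inl a, f⟩).map (glueVar μ ν η T))
      (Loc.diagLoc (glueCrossing μ ν T) (Σ i, Fin (T i).circles) (η.markedEdges T)
        (glueFactor μ ν η T ⟨.inl a, f⟩)) := by
  rw [glueFactor_arc, Loc.diagLoc_edge]
  change Loc.Sim (((subLoc μ ν η T (.inl a) f).map _).map _) _
  rw [subLoc_arc]
  refine ((Loc.mapMapSim _ Sum.inr _ Sum.inr rfl).mapSim _).trans
    ((Loc.mapMapSim _ Sum.inr _ (fun x => glueVar μ ν η T (.inr x)) rfl).trans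
      -- An arc has the differential head minus tail, an edge of a diagram source minus target. As
      -- the tail is the source, a sign is needed.
      (Loc.koszulNegSim _ _ _ _ _ ?_))
  rw [map_sub, rename_X, rename_X, glueVar_headVar, glueVar_tailVar, markedEdges_tailSource,
    neg_sub]

/-- The local data of the holes in the glued diagram. -/
def glueSimHole (i : Fin m) (f : (T i).Factor) :
    Loc.Sim ((Loc.sigmaLoc (subLoc μ ν η T) ⟨.inr i, f⟩).map (glueVar μ ν η T))
      (((T i).loc μ ν f).map (holeVar μ ν η T i)) := by
  change Loc.Sim (((subLoc μ ν η T (.inr i) f).map _).map _) _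
  rw [subLoc_hole]
  exact (((Loc.mapMapSim _ _ _ _ rfl).mapSim _).mapSim _).trans
    (((Loc.mapMapSim _ _ _ _ rfl).mapSim _).trans (Loc.mapMapSim _ _ _ (holeVar μ ν η T i) rfl))

/-- The local data of a diagram in the glued diagram. -/
def holeSim (i : Fin m) : ∀ f : (T i).Factor, Loc.Sim (((T i).loc μ ν f).map (holeVar μ ν η T i))
    (Loc.diagLoc (glueCrossing μ ν T) (Σ i, Fin (T i).circles) (η.markedEdges T)
      (glueFactor μ ν η T ⟨.inr i, f⟩))
  | .inl z => by
    change Loc.Sim _ (Loc.diagLoc _ _ _ (.inl ⟨i, z⟩))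
    rw [Tangle.loc_circle, Loc.diagLoc_circle]
    exact Loc.koszulSim _ 0 (isHomogeneous_zero _ _ _) 0 (isHomogeneous_zero _ _ _) (map_zero _)
  | .inr (.inl s) => by
    rw [glueFactor_edge, Loc.diagLoc_edge, Tangle.loc_edge]
    refine Loc.koszulSim _ _ _ _ _ ?_
    rw [map_sub, rename_X, rename_X, holeVar_src, holeVar_tgt, markedEdges_holeSource]
  | .inr (.inr c) => by
    change Loc.Sim _ (Loc.diagLoc (glueCrossing μ ν T) _ (η.markedEdges T)
      (.inr (.inr (⟨i, c⟩ : Σ i, (T i).Crossing))))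
    rw [Tangle.loc_crossing, Loc.diagLoc_crossing]
    exact (Loc.crossingSim μ ν ((T i).sign c) (holeVar μ ν η T i) _ _ _ _ (holeVar_src μ ν η T i _)
      (holeVar_src μ ν η T i _) (holeVar_tgt μ ν η T i _) (holeVar_tgt μ ν η T i _)).trans
        (Loc.crossingSim μ ν ((T i).sign c) Sum.inl _ _ _ _ rfl rfl rfl rfl).symm

/-- The local data in the action of an arc diagram are those of the glued diagram with marks. -/
def glueSim : ∀ f : Σ j : Factor P₀ P, SubFactor μ ν η T j,
    Loc.Sim ((Loc.sigmaLoc (subLoc μ ν η T) f).map (glueVar μ ν η T))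
      (Loc.diagLoc (glueCrossing μ ν T) (Σ i, Fin (T i).circles) (η.markedEdges T)
        (glueFactor μ ν η T f))
  | ⟨.inl a, f⟩ => glueSimArc μ ν η T a f
  | ⟨.inr i, f⟩ => (glueSimHole μ ν η T i f).trans (holeSim μ ν η T i f)

end ArcDiagram

end
end KRTangle

/-! ### The first claim: pasting corresponds to the action up to homotopy equivalence. -/

namespace KRTangle
noncomputable section
open Bicomplex

namespace ArcDiagram

variable {k : Type u} [Field k] (μ ν : k) {m : ℕ} {P₀ : SignedPoints} {P : Fin m → SignedPoints}
  (η : ArcDiagram P₀ P) (T : ∀ i, Tangle (P i))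

theorem glueVar_outer (x : Fin P₀.n) :
    glueVar μ ν η T (.inr (.inl x)) = .inl (outerFlag T x) := rfl

set_option synthInstance.maxSize 1000 in
/-- The action of an arc diagram as the complex of the glued diagram with marks. -/
def actDiagIso {r : _ → _ → Prop} (hr : IsTournament r) : Iso (η.act fun i => (T i).KR₀ μ ν)
    (((Loc.prod hr (Loc.diagLoc (glueCrossing μ ν T) (Σ i, Fin (T i).circles)
      (η.markedEdges T))).restrict Sum.inl).restrict (outerFlag T)) :=
  ((η.actIso μ ν T).trans (Loc.prodIso _ hr _ _ (glueVar μ ν η T) (glueFactor μ ν η T)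
    (glueSim μ ν η T) (Sum.inr ∘ Sum.inl) (Sum.inl ∘ outerFlag T)
    (glueVar_outer μ ν η T))).trans (restrictRestrict _ _ _).symm

/-- The edges of the glued diagram, with numbered marks. -/
def numberedEdges : GlueSource (P₀ := P₀) T ⊕ Fin (Fintype.card (Mark P)) ≃
    GlueTarget (P₀ := P₀) T ⊕ Fin (Fintype.card (Mark P)) :=
  (((Equiv.refl _).sumCongr (Fintype.equivFin (Mark P)).symm).trans (η.markedEdges T)).trans
    ((Equiv.refl _).sumCongr (Fintype.equivFin (Mark P)))

set_option synthInstance.maxSize 1000 in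
/-- The complex of the pasted diagram as the complex of a diagram without marks. -/
theorem htpyEquiv_glue_diag {r : _ → _ → Prop} (hr : IsTournament r) :
    HtpyEquiv ((η.glue T).KR₀ μ ν)
      (((Loc.prod hr (Loc.diagLoc (glueCrossing μ ν T) (Fin (η.glue T).circles)
        ((eraseMarks _ (η.numberedEdges T)).1.sumCongr (Equiv.refl (Fin 0))))).restrict
          Sum.inl).restrict (outerFlag T)) :=
  -- Sources and crossings of the pasted diagram agree with those on the right only after unfolding,
  -- so the finiteness and the decidable equality of the unfolded types are supplied.
  ((η.glue T).isoDiag μ ν (iF := inferInstanceAs (Fintype (Fin (η.glue T).circles ⊕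
      (GlueSource (P₀ := P₀) T ⊕ Fin 0) ⊕ (Σ i, (T i).Crossing))))
    (iD := inferInstanceAs (DecidableEq (Fin (η.glue T).circles ⊕
      (GlueSource (P₀ := P₀) T ⊕ Fin 0) ⊕ (Σ i, (T i).Crossing)))) hr).htpyEquiv

set_option synthInstance.maxSize 1000 in
/-- The canopolis action is compatible with pasting. -/
theorem htpyEquiv_glue : HtpyEquiv ((η.glue T).KR₀ μ ν) (η.act fun i => (T i).KR₀ μ ν) := by
  classical
  -- The orders of the factors may be arbitrary, since the products do not depend on them up to
  -- isomorphism.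
  obtain ⟨r₀, h₀⟩ := exists_isTournament (Fin (η.glue T).circles ⊕
      (GlueSource (P₀ := P₀) T ⊕ Fin 0) ⊕ (Σ i, (T i).Crossing))
  obtain ⟨r₁, h₁⟩ := exists_isTournament ((Σ i, Fin (T i).circles) ⊕
      (GlueSource (P₀ := P₀) T ⊕ Fin (Fintype.card (Mark P))) ⊕ (Σ i, (T i).Crossing))
  obtain ⟨r₂, h₂⟩ := exists_isTournament ((Σ i, Fin (T i).circles) ⊕
      (GlueSource (P₀ := P₀) T ⊕ Mark P) ⊕ (Σ i, (T i).Crossing))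
  have e₁ := (Loc.htpyEquiv_eraseMarks (glueCrossing (P₀ := P₀) μ ν T) _ (Σ i, Fin (T i).circles)
    (Fin (η.glue T).circles) (η.numberedEdges T) (Fintype.equivOfCardEq (by
      simp only [Fintype.card_sum, Fintype.card_fin, Fintype.card_sigma]
      rfl)) h₁ h₀).restrict (outerFlag T)
  -- Pasting numbers the marks, the action does not. The numbering only renames variables and
  -- factors.
  have e₂ := ((Loc.diagIso (glueCrossing (P₀ := P₀) μ ν T) (Σ i, Fin (T i).circles)
    (η.numberedEdges T) (η.markedEdges T) (Fintype.equivFin (Mark P)).symm (Equiv.refl _) (by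
      intro s
      have h : ∀ t, Sum.map id (Fintype.equivFin (Mark P)).symm
          (((Equiv.refl (GlueTarget (P₀ := P₀) T)).sumCongr (Fintype.equivFin (Mark P))) t) = t := by
        rintro (t | t)
        · rfl
        · simp
      exact (h _).symm) h₁ h₂).htpyEquiv).restrict (outerFlag T)
  exact (η.htpyEquiv_glue_diag μ ν T h₀).trans (e₁.symm.trans
    (e₂.trans (η.actDiagIso μ ν T h₂).htpyEquiv.symm))

end ArcDiagram
end
end KRTangle

/-! ### Exactness of mapping cones. -/

namespace KRTangle
noncomputable section

/-- The mapping cone of `G` is exact, where `G` is a map from a group with a differential `dA` to a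
group with a differential `dB`. -/
def ConeExact {A B : Type*} [AddCommGroup A] [AddCommGroup B] (dA : A → A) (dB : B → B)
    (G : A → B) : Prop :=
  ∀ a b, dA a = 0 → G a = dB b → ∃ a' b', dA a' = a ∧ G a' + dB b' = b

namespace ConeExact

section Group

variable {A B C A' B' : Type*} [AddCommGroup A] [AddCommGroup B] [AddCommGroup C]
  [AddCommGroup A'] [AddCommGroup B']

/-- The cone condition for `G'` is solved first. Its solution `b` has boundary `G a`, which poses
the problem `(a, b)` for `G`. -/
theorem comp {dA : A → A} {dB : B →+ B} {dC : C →+ C} {G : A →+ B} {G' : B →+ C}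
    (h : ConeExact dA dB G) (h' : ConeExact dB dC G')
    (hG : ∀ a, G (dA a) = dB (G a)) (hG' : ∀ b, G' (dB b) = dC (G' b)) :
    ConeExact dA dC (G' ∘ G) := by
  intro a c ha hc
  obtain ⟨b, c', hb, hc'⟩ := h' (G a) c (by rw [← hG, ha, map_zero]) hc
  obtain ⟨a', b', ha', hb'⟩ := h a b ha hb.symm
  refine ⟨a', G' b' + c', ha', ?_⟩
  rw [← hc', ← hb', Function.comp_apply, map_add, map_add, hG', add_assoc]

theorem of_equiv {dA : A → A} {dB : B → B} {G : A → B} {dA' : A' → A'} {dB' : B' → B'}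
    {G' : A' → B'} (h : ConeExact dA dB G) (eA : A' ≃+ A) (eB : B' ≃+ B)
    (hA : ∀ a, eA (dA' a) = dA (eA a)) (hB : ∀ b, eB (dB' b) = dB (eB b))
    (hG : ∀ a, eB (G' a) = G (eA a)) : ConeExact dA' dB' G' := by
  intro a b ha hab
  obtain ⟨a', b', h1, h2⟩ := h (eA a) (eB b) (by rw [← hA, ha, map_zero])
    (by rw [← hG, hab, hB])
  refine ⟨eA.symm a', eB.symm b', eA.injective ?_, eB.injective ?_⟩
  · rw [hA, eA.apply_symm_apply, h1]
  · rw [map_add, hG, hB, eA.apply_symm_apply, eB.apply_symm_apply, h2]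

theorem of_bijective {dA : A → A} {dB : B → B} {G : A →+ B} (hB : dB 0 = 0)
    (hG : Function.Bijective G) (hc : ∀ a, G (dA a) = dB (G a)) :
    ConeExact dA dB G := by
  intro a b ha hab
  obtain ⟨c, rfl⟩ := hG.2 b
  exact ⟨c, 0, hG.1 (by rw [hc, hab]), by rw [hB, add_zero]⟩

/-- Twisting the differentials by commuting involutions. -/
theorem twist {dA : A → A} {dB : B → B} {G : A → B} (h : ConeExact dA dB G) (sA : A →+ A)
    (sB : B →+ B) (hA : ∀ a, sA (sA a) = a) (hB : ∀ b, sB (sB b) = b)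
    (hdA : ∀ a, sA (dA a) = dA (sA a)) (hdB : ∀ b, sB (dB b) = dB (sB b))
    (hG : ∀ a, G (sA a) = sB (G a)) : ConeExact (sA ∘ dA) (sB ∘ dB) G := by
  intro a b ha hab
  obtain ⟨a', b', h1, h2⟩ := h a (sB b) (by
    rw [← hA (dA a), show sA (dA a) = 0 from ha, map_zero]) (by rw [hab, ← hdB]; rfl)
  refine ⟨sA a', b', ?_, ?_⟩
  · rw [Function.comp_apply, ← hdA, hA, h1]
  · rw [Function.comp_apply, hG, ← map_add, h2, hB]

/-- A differential `D + δ` is exact if `D` is exact and preserves a finite grading while `δ` raises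
the degree by one. -/
theorem _root_.KRTangle.exact_add_of_graded {E : Type*} [AddCommGroup E] (D δ : E →+ E)
    (p : ℤ → E →+ E) (S : Finset ℤ) (hS : ∀ n ∉ S, p n = 0) (hsum : ∀ x, ∑ n ∈ S, p n x = x)
    (hp : ∀ m n x, p m (p n x) = if m = n then p n x else 0)
    (hD : ∀ n x, p n (D x) = D (p n x)) (hδ : ∀ n x, p (n + 1) (δ x) = δ (p n x))
    (hsq : ∀ x, D (D x) + D (δ x) + (δ (D x) + δ (δ x)) = 0)
    (hex : ∀ x, D x = 0 → ∃ y, D y = x) (x : E) (hx : D x + δ x = 0) :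
    ∃ y, D y + δ y = x := by
  obtain ⟨lo, hlo⟩ : ∃ lo : ℤ, ∀ n ∈ S, lo ≤ n := S.bddBelow
  obtain ⟨hi, hhi⟩ : ∃ hi : ℤ, ∀ n ∈ S, n ≤ hi := S.bddAbove
  have key : ∀ (N : ℕ) (n : ℤ), hi < n + N → ∀ x, D x + δ x = 0 → (∀ m < n, p m x = 0) →
      ∃ y, D y + δ y = x := by
    intro N
    induction N with
    | zero =>
      intro n hn x _ hx
      refine ⟨0, ?_⟩
      rw [← hsum x, Finset.sum_eq_zero fun m hm => hx m ?_]
      · simp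
      · have := hhi m hm
        push_cast at hn
        omega
    | succ N ih =>
      intro n hn x hx hlow
      -- In degree `n` the equation `D x + δ x = 0` has no contribution from `δ`, which would come
      -- from degree `n - 1`. So the lowest component is closed for `D` alone.
      have h1 : D (p n x) = 0 := by
        have := congrArg (p n) hx
        rw [map_add, map_zero, hD, ← sub_add_cancel n 1, hδ, hlow (n - 1) (by omega), map_zero,
          add_zero] at this
        rwa [sub_add_cancel] at this
      obtain ⟨y, hy⟩ := hex _ h1
      -- Only the part of `y` in degree `n` is used. Its boundary cancels the component of `x` in
      -- degree `n` and otherwise affects only degree `n + 1`.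
      obtain ⟨z, hz⟩ := ih (n + 1) (by push_cast at hn; omega) (x - (D (p n y) + δ (p n y)))
        (by
          have h2 := hsq (p n y)
          rw [map_sub, map_sub, map_add, map_add, sub_add_sub_comm, hx, h2, sub_zero])
        (by
          intro m hm
          have h3 : p m (D (p n y)) = if m = n then p n x else 0 := by
            rw [hD, hp]
            split_ifs with h
            · have := congrArg (p n) hy
              rw [hD, hp, if_pos rfl] at this
              exact this
            · exact map_zero _
          have h4 : p m (δ (p n y)) = 0 := by
            rw [← sub_add_cancel m 1, hδ, hp, if_neg (by omega), map_zero]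
          rw [map_sub, map_add, h3, h4, add_zero]
          split_ifs with h
          · rw [h, sub_self]
          · rw [hlow m (by omega), sub_zero])
      exact ⟨z + p n y, by rw [map_add, map_add, add_add_add_comm, hz, sub_add_cancel]⟩
  -- After `hi + 1 - lo` steps, starting at `lo`, the lowest possible degree exceeds `hi` and
  -- nothing is left.
  refine key (hi + 1 - lo).toNat lo (by omega) x hx fun m hm => ?_
  rw [hS m fun h => absurd (hlo m h) (by omega)]
  rfl

/-- The graded criterion for cones. -/
theorem add_of_graded {dA δA : A →+ A} {dB δB : B →+ B} {G : A →+ B} (h : ConeExact dA dB G)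
    (pA : ℤ → A →+ A) (pB : ℤ → B →+ B) (S S' : Finset ℤ)
    (hS : ∀ n ∉ S, pA n = 0) (hS' : ∀ n ∉ S', pB n = 0)
    (hsA : ∀ x, ∑ n ∈ S, pA n x = x) (hsB : ∀ x, ∑ n ∈ S', pB n x = x)
    (hpA : ∀ m n x, pA m (pA n x) = if m = n then pA n x else 0)
    (hpB : ∀ m n x, pB m (pB n x) = if m = n then pB n x else 0)
    (hdA : ∀ n x, pA n (dA x) = dA (pA n x)) (hdB : ∀ n x, pB n (dB x) = dB (pB n x))
    (hδA : ∀ n x, pA (n + 1) (δA x) = δA (pA n x)) (hδB : ∀ n x, pB (n + 1) (δB x) = δB (pB n x))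
    (hGp : ∀ n x, pB n (G x) = G (pA n x))
    (hGd : ∀ x, G (dA x) = dB (G x)) (hGδ : ∀ x, G (δA x) = δB (G x))
    (hA : ∀ x, dA (dA x) + dA (δA x) + (δA (dA x) + δA (δA x)) = 0)
    (hB : ∀ x, dB (dB x) + dB (δB x) + (δB (dB x) + δB (δB x)) = 0) :
    ConeExact (fun x => dA x + δA x) (fun x => dB x + δB x) G := by
  -- The cone as a single group, with the differential `(a, b) ↦ (d a, G a - d b)` split into the
  -- part that preserves the degree and the part that raises it. The sign at `d b` makes the square
  -- vanish.
  let D : A × B →+ A × B :=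
    (dA.comp (AddMonoidHom.fst A B)).prod
      (G.comp (AddMonoidHom.fst A B) - dB.comp (AddMonoidHom.snd A B))
  let δ : A × B →+ A × B :=
    (δA.comp (AddMonoidHom.fst A B)).prod (-δB.comp (AddMonoidHom.snd A B))
  have hD : ∀ x, D x = (dA x.1, G x.1 - dB x.2) := fun _ => rfl
  have hδ : ∀ x, δ x = (δA x.1, -δB x.2) := fun _ => rfl
  intro a b ha hab
  obtain ⟨⟨a', b'⟩, hy⟩ := exact_add_of_graded D δ
    (fun n => (pA n).prodMap (pB n)) (S ∪ S')
    (fun n hn => by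
      rw [hS n fun h => hn (Finset.mem_union_left _ h),
        hS' n fun h => hn (Finset.mem_union_right _ h)]
      rfl)
    (fun x => by
      refine Prod.ext ?_ ?_
      · rw [Prod.fst_sum]
        refine Eq.trans (Finset.sum_subset Finset.subset_union_left fun n _ hn => ?_).symm (hsA x.1)
        rw [AddMonoidHom.prodMap_def]
        exact DFunLike.congr_fun (hS n hn) x.1
      · rw [Prod.snd_sum]
        refine Eq.trans (Finset.sum_subset Finset.subset_union_right fun n _ hn => ?_).symm
          (hsB x.2)
        exact DFunLike.congr_fun (hS' n hn) x.2)
    (fun m n x => by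
      refine (show (pA m (pA n x.1), pB m (pB n x.2)) =
        (if m = n then pA n x.1 else 0, if m = n then pB n x.2 else 0) from
        Prod.ext (hpA m n x.1) (hpB m n x.2)).trans ?_
      split_ifs <;> rfl)
    (fun n x => by
      refine Prod.ext (hdA n x.1) ?_
      change pB n (G x.1 - dB x.2) = G (pA n x.1) - dB (pB n x.2)
      rw [map_sub, hGp, hdB])
    (fun n x => by
      refine Prod.ext (hδA n x.1) ?_
      change pB (n + 1) (-δB x.2) = -δB (pB n x.2)
      rw [map_neg, hδB])
    (fun x => by
      simp only [hD, hδ]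
      refine Prod.ext (hA x.1) ?_
      change G (dA x.1) - dB (G x.1 - dB x.2) + (G (δA x.1) - dB (-δB x.2)) +
        (-δB (G x.1 - dB x.2) + -δB (-δB x.2)) = 0
      rw [← hB x.2]
      simp only [map_sub, map_neg, hGd, hGδ]
      abel)
    (fun x hx => by
      rw [hD] at hx
      obtain ⟨a', b', h1, h2⟩ := h x.1 x.2 (congrArg Prod.fst hx)
        (sub_eq_zero.1 (congrArg Prod.snd hx))
      exact ⟨(a', -b'), Prod.ext h1 (by simpa [hD] using h2)⟩)
    (a, b) (by
      rw [hD, hδ]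
      refine Prod.ext ha ?_
      change G a - dB b + -δB b = 0
      rw [show G a = dB b + δB b from hab]
      abel)
  refine ⟨a', -b', congrArg Prod.fst hy, ?_⟩
  rw [← show G a' - dB b' + -δB b' = b from congrArg Prod.snd hy]
  simp only [map_neg]
  abel

end Group

/-- Tensoring with a flat module. -/
theorem lTensor {R A B : Type u} [CommRing R] [AddCommGroup A] [AddCommGroup B] [Module R A]
    [Module R B] {dA : A →ₗ[R] A} {dB : B →ₗ[R] B} {G : A →ₗ[R] B} (h : ConeExact dA dB G)
    (hA : ∀ a, dA (dA a) = 0) (hB : ∀ b, dB (dB b) = 0) (hG : ∀ a, G (dA a) = dB (G a))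
    (W : Type u) [AddCommGroup W] [Module R W] [Module.Flat R W] :
    ConeExact (dA.lTensor W) (dB.lTensor W) (G.lTensor W) := by
  let D : A × B →ₗ[R] A × B :=
    (dA ∘ₗ LinearMap.fst R A B).prod (G ∘ₗ LinearMap.fst R A B - dB ∘ₗ LinearMap.snd R A B)
  -- Exactness of the cone as equality of kernel and image, the form that flat modules preserve.
  -- Here `b'` enters with the opposite sign.
  have hex : Function.Exact D D := by
    rintro ⟨a, b⟩
    constructor
    · intro hx
      obtain ⟨a', b', h1, h2⟩ := h a b (congrArg Prod.fst hx)
        (sub_eq_zero.1 (congrArg Prod.snd hx))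
      refine ⟨(a', -b'), Prod.ext h1 ?_⟩
      change G a' - dB (-b') = b
      rw [map_neg, sub_neg_eq_add, h2]
    · rintro ⟨⟨a', b'⟩, hx⟩
      rw [← hx]
      refine Prod.ext (hA a') ?_
      change G (dA a') - dB (G a' - dB b') = 0
      rw [hG, map_sub, hB, sub_zero, sub_self]
  have hW := Module.Flat.lTensor_exact W hex
  -- These four identities give the blocks of `D`; by them `D` tensored with `W` is recognised as
  -- the cone of the tensored map.
  have e1 : D ∘ₗ LinearMap.inl R A B = LinearMap.inl R A B ∘ₗ dA + LinearMap.inr R A B ∘ₗ G := by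
    ext x <;> simp [D]
  have e2 : D ∘ₗ LinearMap.inr R A B = -(LinearMap.inr R A B ∘ₗ dB) := by
    ext x <;> simp [D]
  have e3 : LinearMap.fst R A B ∘ₗ D = dA ∘ₗ LinearMap.fst R A B := rfl
  have e4 : LinearMap.snd R A B ∘ₗ D =
      G ∘ₗ LinearMap.fst R A B - dB ∘ₗ LinearMap.snd R A B := rfl
  intro a b ha hab
  obtain ⟨z, hz⟩ := (hW ((LinearMap.inl R A B).lTensor W a + (LinearMap.inr R A B).lTensor W b)).1
    (by
      rw [map_add, ← LinearMap.lTensor_comp_apply, ← LinearMap.lTensor_comp_apply, e1, e2,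
        LinearMap.lTensor_add, LinearMap.lTensor_neg, LinearMap.lTensor_comp, LinearMap.lTensor_comp,
        LinearMap.lTensor_comp]
      simp only [LinearMap.add_apply, LinearMap.neg_apply, LinearMap.comp_apply]
      rw [ha, hab, map_zero, zero_add, add_neg_cancel])
  refine ⟨(LinearMap.fst R A B).lTensor W z, -(LinearMap.snd R A B).lTensor W z, ?_, ?_⟩
  · rw [← LinearMap.lTensor_comp_apply, ← e3, LinearMap.lTensor_comp_apply, hz, map_add,
      ← LinearMap.lTensor_comp_apply, ← LinearMap.lTensor_comp_apply, LinearMap.fst_comp_inl,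
      LinearMap.fst_comp_inr, LinearMap.lTensor_id, LinearMap.lTensor_zero]
    simp
  · rw [map_neg, ← sub_eq_add_neg, ← LinearMap.lTensor_comp_apply, ← LinearMap.lTensor_comp_apply,
      ← LinearMap.sub_apply, ← LinearMap.lTensor_sub, ← e4, LinearMap.lTensor_comp_apply, hz,
      map_add, ← LinearMap.lTensor_comp_apply, ← LinearMap.lTensor_comp_apply,
      LinearMap.snd_comp_inl, LinearMap.snd_comp_inr, LinearMap.lTensor_id, LinearMap.lTensor_zero]
    simp

/-- The cone of an identity is contractible, whatever `W` is. -/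
theorem lTensor_id {R A : Type u} [CommRing R] [AddCommGroup A] [Module R A] (dA : A →ₗ[R] A)
    (W : Type u) [AddCommGroup W] [Module R W] :
    ConeExact (dA.lTensor W) (dA.lTensor W) ((LinearMap.id : A →ₗ[R] A).lTensor W) := by
  intro a b _ hab
  rw [LinearMap.lTensor_id_apply] at hab
  exact ⟨b, 0, hab.symm, by rw [LinearMap.lTensor_id_apply, map_zero, add_zero]⟩

end ConeExact

end
end KRTangle

/-! ### Extended modules and flatness. -/

namespace KRTangle
noncomputable section

section Extended

variable {K S R : Type u} [CommRing K] [CommRing S] [CommRing R] [Algebra S R]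

/-- `Z` is isomorphic to the extension of scalars of an `S`-module. -/
def IsExtended (S R : Type u) [CommRing S] [CommRing R] [Algebra S R] (Z : Type u) [AddCommGroup Z]
    [Module R Z] : Prop :=
  ∃ (Y : Type u) (_ : AddCommGroup Y) (_ : Module S Y), Nonempty (Z ≃ₗ[R] R ⊗[S] Y)

namespace IsExtended

theorem of_equiv {Z Z' : Type u} [AddCommGroup Z] [Module R Z] [AddCommGroup Z'] [Module R Z']
    (e : Z ≃ₗ[R] Z') (h : IsExtended S R Z') : IsExtended S R Z := by
  obtain ⟨Y, _, _, ⟨f⟩⟩ := h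
  exact ⟨Y, _, _, ⟨e.trans f⟩⟩

/-- Base change commutes with tensor products. -/
theorem tensor {Z Z' : Type u} [AddCommGroup Z] [Module R Z] [AddCommGroup Z'] [Module R Z']
    (h : IsExtended S R Z) (h' : IsExtended S R Z') : IsExtended S R (Z ⊗[R] Z') := by
  obtain ⟨Y, _, _, ⟨f⟩⟩ := h
  obtain ⟨Y', _, _, ⟨f'⟩⟩ := h'
  exact ⟨Y ⊗[S] Y', _, _, ⟨(TensorProduct.congr f f').trans
    (TensorProduct.AlgebraTensorModule.distribBaseChange S R Y Y').symm⟩⟩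

theorem self : IsExtended S R R := ⟨S, _, _, ⟨(TensorProduct.AlgebraTensorModule.rid S R R).symm⟩⟩

theorem pi (ι : Type) [Finite ι] : IsExtended S R (ι → R) := by
  classical
  have := Fintype.ofFinite ι
  exact ⟨ι → S, _, _, ⟨(TensorProduct.piScalarRight S R R ι).symm⟩⟩

/-- Base change from `K` to `R` passes through `S`. -/
theorem baseChange [Algebra K S] [Algebra K R] [IsScalarTower K S R] (X : Type u) [AddCommGroup X]
    [Module K X] : IsExtended S R (R ⊗[K] X) :=
  ⟨S ⊗[K] X, _, _, ⟨(TensorProduct.AlgebraTensorModule.cancelBaseChange K S R R X).symm⟩⟩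

/-- Induction on the number of factors: one factor is split off, and the empty tensor product is `R`
itself. -/
theorem piTensor {J : Type} [Finite J] {Z : J → Type u} [∀ j, AddCommGroup (Z j)]
    [∀ j, Module R (Z j)] (h : ∀ j, IsExtended S R (Z j)) : IsExtended S R (⨂[R] j, Z j) := by
  classical
  obtain ⟨n, hn⟩ : ∃ n, Nat.card J = n := ⟨_, rfl⟩
  induction n generalizing J with
  | zero =>
    have : IsEmpty J := (Nat.card_eq_zero.1 hn).resolve_right (by simpa using ‹Finite J›)
    exact self.of_equiv (PiTensorProduct.isEmptyEquiv J)
  | succ n ih =>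
    obtain ⟨j⟩ : Nonempty J := ((Nat.card_pos_iff (α := J)).1 (by omega)).1
    refine IsExtended.of_equiv (PiTensorProduct.equivPiTensorComplSingletonTensor R Z j)
      (tensor (ih (fun _ => h _) ?_) (h j))
    have := Set.ncard_compl_of_ncard_eq_add (s := ({j} : Set J)) (n := n) (by simp [hn])
    exact this

/-- Modules extended from `S` are flat over `K` when `R = K ⊗ S` over a field. -/
theorem flat {k : Type u} [Field k] [Algebra k K] [Algebra k S] [Algebra k R] [Algebra K R]
    [IsScalarTower k S R] [IsScalarTower k K R] [Algebra.IsPushout k K S R]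
    {Z : Type u} [AddCommGroup Z] [Module R Z] [Module K Z] [IsScalarTower K R Z]
    (h : IsExtended S R Z) : Module.Flat K Z := by
  obtain ⟨Y, _, _, ⟨f⟩⟩ := h
  letI : Module k Y := Module.compHom Y (algebraMap k S)
  haveI : IsScalarTower k S Y := ⟨fun a b y => by
    rw [Algebra.smul_def, mul_smul]
    rfl⟩
  -- `Z` is `R ⊗[S] Y`, which is `K ⊗[k] Y` by the pushout property, and every module over the field
  -- `k` is flat.
  exact Module.Flat.of_linearEquiv
    ((f.restrictScalars K).trans (Algebra.IsPushout.cancelBaseChange k K S R Y))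

end IsExtended

/-- If `W` is flat over `K`, then tensoring over `R` with `W` preserves the exactness of cones that
are extended from `K`. -/
theorem ConeExact.lTensor_baseChange [Algebra K R] {A B : Type u} [AddCommGroup A] [AddCommGroup B]
    [Module K A] [Module K B] {dA : A →ₗ[K] A} {dB : B →ₗ[K] B} {G : A →ₗ[K] B}
    (h : ConeExact dA dB G)
    (hA : ∀ a, dA (dA a) = 0) (hB : ∀ b, dB (dB b) = 0) (hG : ∀ a, G (dA a) = dB (G a))
    (W : Type u) [AddCommGroup W] [Module R W] [Module K W] [IsScalarTower K R W]
    [Module.Flat K W] :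
    ConeExact ((dA.baseChange R).lTensor W) ((dB.baseChange R).lTensor W)
      ((G.baseChange R).lTensor W) := by
  -- `W ⊗[R] (R ⊗[K] X)` is naturally `W ⊗[K] X`, so only flatness of `W` over the small ring `K`
  -- matters.
  have key : ∀ {X Y : Type u} [AddCommGroup X] [AddCommGroup Y] [Module K X] [Module K Y]
      (f : X →ₗ[K] Y) (z : W ⊗[R] (R ⊗[K] X)),
      TensorProduct.AlgebraTensorModule.cancelBaseChange K R R W Y ((f.baseChange R).lTensor W z) =
        f.lTensor W (TensorProduct.AlgebraTensorModule.cancelBaseChange K R R W X z) := by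
    intro X Y _ _ _ _ f z
    induction z using TensorProduct.induction_on with
    | zero => simp
    | add x y hx hy => simp only [map_add, hx, hy]
    | tmul w z =>
      induction z using TensorProduct.induction_on with
      | zero => simp
      | add x y hx hy => simp only [TensorProduct.tmul_add, map_add, hx, hy]
      | tmul r x => simp
  exact (h.lTensor hA hB hG W).of_equiv
    (TensorProduct.AlgebraTensorModule.cancelBaseChange K R R W A).toAddEquiv
    (TensorProduct.AlgebraTensorModule.cancelBaseChange K R R W B).toAddEquiv
    (key dA) (key dB) (key G)

end Extended

/-- Polynomials in two sets of variables are a tensor product. -/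
theorem isPushout_rename (k : Type u) [Field k] {H E V : Type} (φ : H → V) (ψ : E → V)
    (h : Function.Bijective (Sum.elim ψ φ)) :
    letI := Bicomplex.renameAlgebra k φ
    letI := Bicomplex.renameAlgebra k ψ
    Algebra.IsPushout k (MvPolynomial H k) (MvPolynomial E k) (MvPolynomial V k) := by
  letI := Bicomplex.renameAlgebra k φ
  letI := Bicomplex.renameAlgebra k ψ
  haveI : IsScalarTower k (MvPolynomial H k) (MvPolynomial V k) :=
    .of_algebraMap_eq fun a => by
      change C a = rename φ (C a)
      rw [rename_C]
  haveI : IsScalarTower k (MvPolynomial E k) (MvPolynomial V k) :=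
    .of_algebraMap_eq fun a => by
      change C a = rename ψ (C a)
      rw [rename_C]
  let e₀ : MvPolynomial E (MvPolynomial H k) ≃+* MvPolynomial V k :=
    (sumRingEquiv k E H).symm.trans (renameEquiv k (Equiv.ofBijective _ h)).toRingEquiv
  have h1 : ∀ c, e₀ (C c) = rename φ c := by
    intro c
    induction c using MvPolynomial.induction_on with
    | C a => simp [e₀]
    | add p q hp hq => rw [C_add, map_add, hp, hq, map_add]
    | mul_X p i hp => rw [C_mul, map_mul, hp, map_mul]; simp [e₀]
  have h2 : ∀ p : MvPolynomial E k, e₀ (MvPolynomial.map C p) = rename ψ p := by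
    intro p
    induction p using MvPolynomial.induction_on with
    | C a => simp [e₀]
    | add p q hp hq => rw [map_add, map_add, hp, hq, map_add]
    | mul_X p i hp => rw [map_mul, map_mul, hp, map_mul]; simp [e₀]
  letI := MvPolynomial.algebraMvPolynomial (σ := E) (R := k) (S := MvPolynomial H k)
  refine Algebra.IsPushout.of_equiv (R := k) (R' := MvPolynomial H k) (S := MvPolynomial E k)
    (S' := MvPolynomial E (MvPolynomial H k)) (AlgEquiv.ofRingEquiv (f := e₀) h1) ?_
  exact RingHom.ext h2

end
end KRTangle

/-! ### Exact cones and cohomology in single bidegrees. -/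

namespace KRTangle
noncomputable section
namespace Bicomplex

variable {k : Type u} [Field k] {σ τ : Type}

/-- `p d` is the linear projection to the component of bidegree `d`, which vanishes for `d` outside
of the finite set `S`. -/
structure IsBiProj (C : Bicomplex k σ) (p : ℤ × ℤ → C.M →ₗ[MvPolynomial σ k] C.M)
    (S : Finset (ℤ × ℤ)) : Prop where
  eq_zero : ∀ d ∉ S, p d = 0
  apply : ∀ d {h v q x}, x ∈ C.gr h v q → p d x = if (h, v) = d then x else 0

/-- A bicomplex with only finitely many nonzero bidegrees, the sum of which is direct. -/
def HasBiProj (C : Bicomplex k σ) : Prop := ∃ p S, IsBiProj C p S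

theorem linearMap_ext {C : Bicomplex k σ} {N : Type u} [AddCommGroup N]
    [Module (MvPolynomial σ k) N] {f g : C.M →ₗ[MvPolynomial σ k] N}
    (H : ∀ h v q, ∀ x ∈ C.gr h v q, f x = g x) : f = g :=
  LinearMap.ext (C.eq_of_gr f.toAddMonoidHom g.toAddMonoidHom H)

namespace IsBiProj

variable {C D : Bicomplex k σ} {p : ℤ × ℤ → C.M →ₗ[MvPolynomial σ k] C.M} {S : Finset (ℤ × ℤ)}
  {p' : ℤ × ℤ → D.M →ₗ[MvPolynomial σ k] D.M} {S' : Finset (ℤ × ℤ)}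

theorem sum_apply (hp : IsBiProj C p S) (x : C.M) : ∑ d ∈ S, p d x = x := by
  refine (LinearMap.sum_apply S p x).symm.trans
    (LinearMap.congr_fun (linearMap_ext (g := LinearMap.id) ?_) x)
  intro h v q x hx
  rw [LinearMap.sum_apply, Finset.sum_eq_single (h, v)]
  · rw [hp.apply _ hx, if_pos rfl]; rfl
  · intro d _ hd
    rw [hp.apply _ hx, if_neg hd.symm]
  · intro hd
    rw [hp.eq_zero _ hd]; rfl

theorem apply_dh (hp : IsBiProj C p S) (h v : ℤ) (x : C.M) :
    p (h + 1, v) (C.dh x) = C.dh (p (h, v) x) := by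
  refine LinearMap.congr_fun (f := p (h + 1, v) ∘ₗ C.dh) (g := C.dh ∘ₗ p (h, v))
    (linearMap_ext ?_) x
  intro h' v' q x hx
  rw [LinearMap.comp_apply, LinearMap.comp_apply, hp.apply _ hx, hp.apply _ (C.dh_gr hx)]
  simp only [Prod.mk.injEq, add_left_inj]
  split_ifs
  · rfl
  · rw [map_zero]

theorem map_apply (hp : IsBiProj C p S) (hp' : IsBiProj D p' S') (f : Hom C D) (d : ℤ × ℤ)
    (x : C.M) : f.toLin (p d x) = p' d (f.toLin x) := by
  refine LinearMap.congr_fun (f := f.toLin ∘ₗ p d) (g := p' d ∘ₗ f.toLin) (linearMap_ext ?_) x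
  intro h v q x hx
  rw [LinearMap.comp_apply, LinearMap.comp_apply, hp.apply _ hx, hp'.apply _ (f.map_gr hx)]
  split_ifs
  · rfl
  · rw [map_zero]

theorem apply_mem (hp : IsBiProj C p S) (h v : ℤ) (x : C.M) : p (h, v) x ∈ ⨆ q, C.gr h v q := by
  refine mem_of_mem_closure (p (h, v)).toAddMonoidHom ?_ (C.span_gr x)
  rintro y ⟨h', v', q, hy⟩
  change p (h, v) y ∈ _
  rw [hp.apply _ hy]
  split_ifs with hd
  · obtain ⟨rfl, rfl⟩ := Prod.mk.inj hd
    exact AddSubgroup.mem_iSup_of_mem q hy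
  · exact zero_mem _

theorem apply_of_mem (hp : IsBiProj C p S) {h v : ℤ} {x : C.M} (hx : x ∈ ⨆ q, C.gr h v q) :
    p (h, v) x = x := by
  have : (⨆ q, C.gr h v q) ≤
      ((p (h, v)).toAddMonoidHom - AddMonoidHom.id C.M).ker := iSup_le fun q y hy => by
    rw [AddMonoidHom.mem_ker, AddMonoidHom.sub_apply]
    exact sub_eq_zero.2 ((hp.apply _ hy).trans (if_pos rfl))
  exact sub_eq_zero.1 (this hx)

end IsBiProj

variable {C D : Bicomplex k σ}

/-- Everything splits into finitely many bidegrees. Injectivity on cohomology yields a primitive of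
`a`; the error it leaves in `b` is a cocycle, which surjectivity removes without disturbing the
primitive. -/
theorem Hom.IsTermwiseQuasiIso.coneExact {f : Hom C D} (hf : f.IsTermwiseQuasiIso)
    (hC : HasBiProj C) (hD : HasBiProj D) : ConeExact C.dh D.dh f.toLin := by
  obtain ⟨p, S, hp⟩ := hC
  obtain ⟨p', S', hp'⟩ := hD
  have surj : ∀ y, D.dh y = 0 → ∃ x z, C.dh x = 0 ∧ f.toLin x + D.dh z = y := by
    intro y hy
    have h1 : ∀ d : ℤ × ℤ, ∃ x z, C.dh x = 0 ∧ f.toLin x + D.dh z = p' d y := by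
      rintro ⟨h, v⟩
      obtain ⟨x, hx, z, hz, hxz⟩ := (hf h v).2 (p' (h, v) y)
        ⟨hp'.apply_mem h v y, by
          change D.dh (p' (h, v) y) = 0
          rw [← hp'.apply_dh, hy, map_zero]⟩
      exact ⟨x, z, hx.2, by
        rw [show D.dh z = p' (h, v) y - f.toLin x from hxz, add_sub_cancel]⟩
    choose x z hx hz using h1
    refine ⟨∑ d ∈ S', x d, ∑ d ∈ S', z d, ?_, ?_⟩
    · rw [map_sum]
      exact Finset.sum_eq_zero fun d _ => hx d
    · rw [map_sum, map_sum, ← Finset.sum_add_distrib, Finset.sum_congr rfl fun d _ => hz d,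
        hp'.sum_apply]
  intro a b ha hab
  have h1 : ∀ d : ℤ × ℤ, ∃ a', C.dh a' = p d a := by
    rintro ⟨h, v⟩
    obtain ⟨a', _, ha'⟩ := (hf h v).1 (p (h, v) a)
      ⟨hp.apply_mem h v a, by
        change C.dh (p (h, v) a) = 0
        rw [← hp.apply_dh, ha, map_zero]⟩
      ⟨p' (h - 1, v) b, hp'.apply_mem _ _ _, by
        change D.dh (p' (h - 1, v) b) = _
        rw [hp.map_apply hp', hab, ← hp'.apply_dh, sub_add_cancel]⟩
    exact ⟨a', ha'⟩
  choose a' ha' using h1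
  have h2 : C.dh (∑ d ∈ S, a' d) = a := by
    rw [map_sum, Finset.sum_congr rfl fun d _ => ha' d, hp.sum_apply]
  obtain ⟨x, z, hx, hz⟩ := surj (b - f.toLin (∑ d ∈ S, a' d)) (by
    rw [map_sub, ← f.comm_dh, h2, hab, sub_self])
  refine ⟨∑ d ∈ S, a' d + x, z, by rw [map_add, h2, hx, add_zero], ?_⟩
  rw [map_add, add_assoc, hz, add_sub_cancel]

/-- Injectivity is the cone condition for a cocycle whose image is a coboundary, surjectivity is the
condition for `a = 0`. The solutions are then projected to the required bidegree. -/
theorem Hom.isTermwiseQuasiIso_of_coneExact {f : Hom C D}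
    (hf : ConeExact C.dh D.dh f.toLin) (hC : HasBiProj C) (hD : HasBiProj D) :
    f.IsTermwiseQuasiIso := by
  obtain ⟨p, S, hp⟩ := hC
  obtain ⟨p', S', hp'⟩ := hD
  refine fun h v => ⟨?_, ?_⟩
  · rintro x ⟨hx, hx0⟩ ⟨b, -, hb⟩
    obtain ⟨a', -, ha', -⟩ := hf x b hx0 hb.symm
    refine ⟨p (h - 1, v) a', hp.apply_mem _ _ _, ?_⟩
    change C.dh (p (h - 1, v) a') = x
    rw [← hp.apply_dh, sub_add_cancel, ha', hp.apply_of_mem hx]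
  · rintro y ⟨hy, hy0⟩
    obtain ⟨a, b, ha, hab⟩ := hf 0 y (map_zero _) ((map_zero _).trans hy0.symm)
    refine ⟨p (h, v) a, ⟨hp.apply_mem h v a, ?_⟩, p' (h - 1, v) b, hp'.apply_mem _ _ _, ?_⟩
    · change C.dh (p (h, v) a) = 0
      rw [← hp.apply_dh, ha, map_zero]
    · change D.dh (p' (h - 1, v) b) = _
      rw [← hp'.apply_dh, sub_add_cancel, hp.map_apply hp', eq_sub_iff_add_eq, add_comm, ← map_add,
        hab, hp'.apply_of_mem hy]

/-- By the first homotopy, `g b - H a` is a primitive of `a`. The error `y` that remains in `b` is a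
cocycle, and the second homotopy writes it as `f (g y) - d (K y)`. -/
theorem Hom.IsHomotopyEquiv.coneExact {f : Hom C D} (hf : f.IsHomotopyEquiv) :
    ConeExact C.dh D.dh f.toLin := by
  obtain ⟨g, ⟨H, -, -, hH⟩, ⟨K, -, -, hK⟩⟩ := hf
  intro a b ha hab
  have h1 : g.toLin (f.toLin a) - a = C.dh (H a) + H (C.dh a) := hH a
  have h2 : C.dh (g.toLin b - H a) = a := by
    rw [ha, map_zero, add_zero] at h1
    rw [map_sub, ← g.comm_dh, ← hab, ← h1, sub_sub_cancel]
  have h3 : ∀ y, D.dh y = 0 → f.toLin (g.toLin y) + D.dh (-K y) = y := by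
    intro y hy
    have h4 : f.toLin (g.toLin y) - y = D.dh (K y) + K (D.dh y) := hK y
    rw [hy, map_zero, add_zero] at h4
    rw [map_neg, ← h4]
    abel
  have h5 := h3 (b - f.toLin (g.toLin b - H a)) (by
    rw [map_sub, ← f.comm_dh, h2, hab, sub_self])
  refine ⟨g.toLin b - H a + g.toLin (b - f.toLin (g.toLin b - H a)),
    -K (b - f.toLin (g.toLin b - H a)), ?_, ?_⟩
  · rw [map_add, h2, ← g.comm_dh, map_sub, ← f.comm_dh, h2, hab, sub_self, map_zero, add_zero]
  · rw [map_add f.toLin, add_assoc, h5, add_sub_cancel]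

end Bicomplex
end
end KRTangle

/-! ### Bidegree projections for tensor products, extensions and naive complexes. -/

namespace KRTangle
noncomputable section
namespace Bicomplex

variable {k : Type u} [Field k] {σ τ : Type}

section Tensor

variable {ι : Type} [Fintype ι] [LinearOrder ι]

/-- Linear maps on a tensor product that agree on the products of homogeneous elements. -/
theorem tensor_linearMap_ext (C : ι → Bicomplex k σ) {N : Type u} [AddCommGroup N]
    [Module (MvPolynomial σ k) N] (f g : (⨂[MvPolynomial σ k] i, (C i).M) →ₗ[MvPolynomial σ k] N)
    (H : ∀ (a b c : ι → ℤ) (m : ∀ i, (C i).M), (∀ i, m i ∈ (C i).gr (a i) (b i) (c i)) →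
      f (PiTensorProduct.tprod _ m) = g (PiTensorProduct.tprod _ m)) : f = g := by
  refine linearMap_ext (C := tensor C) (f := f) (g := g) fun h v q x hx => ?_
  have hle : tensorGr C h v q ≤ (f.toAddMonoidHom - g.toAddMonoidHom).ker := by
    refine (AddSubgroup.closure_le _).2 ?_
    rintro _ ⟨n, r, a, b, c, m, -, hm, -, -, -, rfl⟩
    change f (r • _) - g (r • _) = 0
    rw [map_smul, map_smul, H a b c m hm, sub_self]
  exact sub_eq_zero.1 (hle hx)

/-- The projections of a tensor product for a degree that is a sum of functions of the degrees of
the factors. -/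
theorem exists_tensorProj (C : ι → Bicomplex k σ) (hC : ∀ i, HasBiProj (C i)) {G : Type}
    [AddCommMonoid G] [DecidableEq G] (w : ι → ℤ × ℤ → G) :
    ∃ (P : G → (⨂[MvPolynomial σ k] i, (C i).M) →ₗ[MvPolynomial σ k]
      ⨂[MvPolynomial σ k] i, (C i).M) (S : Finset G), (∀ d ∉ S, P d = 0) ∧
      ∀ (d : G) (a b c : ι → ℤ) (m : ∀ i, (C i).M), (∀ i, m i ∈ (C i).gr (a i) (b i) (c i)) →
        P d (PiTensorProduct.tprod _ m) =
          if ∑ i, w i (a i, b i) = d then PiTensorProduct.tprod _ m else 0 := by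
  choose p S hp using hC
  -- The projection is the sum of the tensor products of projections over the finitely many tuples
  -- of bidegrees with total weight `d`.
  refine ⟨fun d => ∑ e ∈ Fintype.piFinset S,
    if ∑ i, w i (e i) = d then PiTensorProduct.map fun i => p i (e i) else 0,
    (Fintype.piFinset S).image fun e => ∑ i, w i (e i), fun d hd => ?_, fun d a b c m hm => ?_⟩
  · refine Finset.sum_eq_zero fun e he => if_neg fun h => hd ?_
    exact Finset.mem_image.2 ⟨e, he, h⟩
  · rw [LinearMap.sum_apply, Finset.sum_eq_single fun i => (a i, b i)]
    · split_ifs with h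
      · rw [PiTensorProduct.map_tprod]
        congr 1
        funext i
        rw [(hp i).apply _ (hm i), if_pos rfl]
      · rfl
    · intro e _ he
      obtain ⟨i, hi⟩ := Function.ne_iff.1 he
      split_ifs with h
      · rw [PiTensorProduct.map_tprod]
        refine MultilinearMap.map_coord_zero _ i ?_
        rw [(hp i).apply _ (hm i), if_neg hi.symm]
      · rfl
    · intro he
      obtain ⟨i, hi⟩ := not_forall.1 fun h => he (Fintype.mem_piFinset.2 h)
      -- A homogeneous element whose bidegree is not in the finite set is zero, because the
      -- projection that fixes it vanishes.
      have h0 : m i = 0 := by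
        have := (hp i).apply (a i, b i) (hm i)
        rw [(hp i).eq_zero _ hi, if_pos rfl] at this
        exact this.symm
      have h1 : PiTensorProduct.tprod (MvPolynomial σ k) m = 0 :=
        MultilinearMap.map_coord_zero _ i h0
      rw [h1, map_zero]

theorem HasBiProj.tensor {C : ι → Bicomplex k σ} (hC : ∀ i, HasBiProj (C i)) :
    HasBiProj (tensor C) := by
  obtain ⟨P, S, hS, hP⟩ := exists_tensorProj C hC fun _ d => d
  refine ⟨P, S, hS, fun d h v q x hx => ?_⟩
  have hle : tensorGr C h v q ≤ ((P d).toAddMonoidHom -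
      (if (h, v) = d then AddMonoidHom.id _ else 0)).ker := by
    refine (AddSubgroup.closure_le _).2 ?_
    rintro _ ⟨n, r, a, b, c, m, -, hm, rfl, rfl, -, rfl⟩
    change P d (r • _) - (if _ then AddMonoidHom.id _ else 0 :
      (⨂[MvPolynomial σ k] i, (C i).M) →+ ⨂[MvPolynomial σ k] i, (C i).M) (r • _) = 0
    have h1 : ∑ i, (a i, b i) = (∑ i, a i, ∑ i, b i) :=
      Prod.ext (Prod.fst_sum ..) (Prod.snd_sum ..)
    rw [map_smul, hP d a b c m hm, h1]
    split_ifs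
    · exact sub_self _
    · rw [smul_zero]; exact sub_self _
  have h2 := sub_eq_zero.1 (hle hx)
  refine (show P d x = _ from h2).trans ?_
  split_ifs <;> rfl

end Tensor

theorem HasBiProj.restrict {C : Bicomplex k τ} (hC : HasBiProj C) (φ : σ → τ) :
    HasBiProj (C.restrict φ) := by
  obtain ⟨p, S, hp⟩ := hC
  refine ⟨fun d =>
    { toFun := p d
      map_add' := (p d).map_add
      map_smul' := fun r (x : C.M) => (p d).map_smul (rename φ r) x }, S, fun d hd => ?_,
    fun d h v q x hx => hp.apply d hx⟩
  refine LinearMap.ext fun x => ?_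
  exact LinearMap.congr_fun (hp.eq_zero d hd) x

theorem HasBiProj.extend {C : Bicomplex k σ} (hC : HasBiProj C) (φ : σ → τ) :
    HasBiProj (C.extend φ) := by
  letI := renameAlgebra k φ
  obtain ⟨p, S, hp⟩ := hC
  refine ⟨fun d => (p d).baseChange (MvPolynomial τ k), S, fun d hd => ?_,
    fun d h v q x hx => ?_⟩
  · rw [hp.eq_zero d hd]
    exact LinearMap.baseChange_zero
  · have hle : (C.extend φ).gr h v q ≤ (((p d).baseChange (MvPolynomial τ k)).toAddMonoidHom -
        (if (h, v) = d then AddMonoidHom.id (MvPolynomial τ k ⊗[MvPolynomial σ k] C.M)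
          else 0)).ker := by
      refine (AddSubgroup.closure_le _).2 ?_
      rintro _ ⟨n, r, c, y, -, hy, -, rfl⟩
      refine sub_eq_zero.2 ((LinearMap.baseChange_tmul ..).trans ?_)
      rw [hp.apply d hy]
      split_ifs
      · rfl
      · exact TensorProduct.tmul_zero _ _
    refine (sub_eq_zero.1 (hle hx)).trans ?_
    split_ifs <;> rfl

theorem hasBiProj_free {ι : Type} [Fintype ι] (hd vd qd : ι → ℤ)
    (A B : Matrix ι ι (MvPolynomial σ k)) (hA hB hAA hBB hAB) :
    HasBiProj (free hd vd qd A B hA hB hAA hBB hAB) := by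
  classical
  refine ⟨fun d => LinearMap.pi fun i => if (hd i, vd i) = d then LinearMap.proj i else 0,
    Finset.univ.image fun i => (hd i, vd i), fun d hn => ?_, fun d h v q x hx => ?_⟩
  · refine LinearMap.ext fun x => funext fun i => ?_
    change (if _ then LinearMap.proj i else 0 :
      (ι → MvPolynomial σ k) →ₗ[MvPolynomial σ k] MvPolynomial σ k) x = 0
    rw [if_neg fun h => hn (Finset.mem_image.2 ⟨i, Finset.mem_univ i, h⟩)]
    rfl
  · funext i
    change (if _ then LinearMap.proj i else 0 :
      (ι → MvPolynomial σ k) →ₗ[MvPolynomial σ k] MvPolynomial σ k) x = _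
    rcases hx i with h0 | ⟨rfl, rfl, -⟩
    · split_ifs
      · rfl
      · exact h0
      · exact h0.symm
      · rfl
    · split_ifs <;> rfl

/-- The projections to horizontal degree `0` descend to the quotient: they send coboundaries to
coboundaries, since projections commute with `dh` up to the shift of degree, and they kill all other
horizontal degrees. For nonzero horizontal degree the projection is zero. -/
theorem HasBiProj.naive {C : Bicomplex k σ} (hC : HasBiProj C) : HasBiProj C.naive := by
  obtain ⟨p, S, hp⟩ := hC
  have hle : ∀ v, C.naiveKer ≤ C.naiveKer.comap (p (0, v)) := by
    intro v
    refine sup_le ?_ (Submodule.span_le.2 ?_)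
    · rintro _ ⟨x, rfl⟩
      refine Submodule.mem_sup_left ⟨p (-1, v) x, ?_⟩
      rw [← hp.apply_dh]
      rfl
    · rintro x ⟨h, v', q, hh, hx⟩
      change p (0, v) x ∈ C.naiveKer
      rw [hp.apply _ hx, if_neg fun h0 => hh (Prod.mk.inj h0).1]
      exact zero_mem _
  have hP : ∀ d : ℤ × ℤ, ∃ P : C.naive.M →ₗ[MvPolynomial σ k] C.naive.M, (d.1 ≠ 0 → P = 0) ∧
      ∀ y, d.1 = 0 → P (C.toNaive.toLin y) = C.toNaive.toLin (p d y) := by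
    rintro ⟨h, v⟩
    by_cases h0 : h = 0
    · subst h0
      exact ⟨C.naiveKer.mapQ C.naiveKer (p (0, v)) (hle v), fun h => absurd rfl h, fun _ _ => rfl⟩
    · exact ⟨0, fun _ => rfl, fun _ h => absurd h h0⟩
  choose P hP0 hP using hP
  refine ⟨P, S, fun d hd => ?_, fun d h v q x hx => ?_⟩
  · by_cases h0 : d.1 = 0
    · refine LinearMap.ext fun x => ?_
      obtain ⟨x, rfl⟩ := C.naiveKer.mkQ_surjective x
      refine (hP d x h0).trans ?_
      rw [hp.eq_zero _ hd]
      exact map_zero _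
    · exact hP0 d h0
  · change x ∈ if h = 0 then (C.gr 0 v q).map C.naiveKer.mkQ.toAddMonoidHom else ⊥ at hx
    by_cases hh : h = 0
    · subst hh
      rw [if_pos rfl] at hx
      obtain ⟨y, hy, rfl⟩ := hx
      by_cases h0 : d.1 = 0
      · refine (hP d y h0).trans ?_
        rw [hp.apply _ hy]
        by_cases hd : (0, v) = d
        · rw [if_pos hd]
          exact (if_pos hd).symm
        · rw [if_neg hd]
          exact (map_zero _).trans (if_neg hd).symm
      · rw [hP0 d h0]
        exact (if_neg fun h : (0, v) = d => h0 (congrArg Prod.fst h).symm).symm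
    · rw [if_neg hh] at hx
      obtain rfl : x = 0 := hx
      rw [map_zero, ite_self]

end Bicomplex
end
end KRTangle

/-! ### Exchanging the factors of a tensor product one at a time. -/

namespace KRTangle
noncomputable section
namespace Bicomplex

variable {k : Type u} [Field k] {σ : Type} {ι : Type} [Fintype ι] [LinearOrder ι]

/-- The summand of the horizontal differential of a tensor product that differentiates the factor
`i`. -/
def slotDiff (Z : ι → Bicomplex k σ) (i : ι) :
    (⨂[MvPolynomial σ k] j, (Z j).M) →ₗ[MvPolynomial σ k] ⨂[MvPolynomial σ k] j, (Z j).M :=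
  PiTensorProduct.map fun j => if j < i then (Z j).sh else if j = i then (Z j).dh else LinearMap.id

theorem tensor_dh_eq (Z : ι → Bicomplex k σ) (i : ι) :
    (tensor Z).dh = slotDiff Z i + ∑ j ∈ Finset.univ.erase i, slotDiff Z j :=
  (Finset.add_sum_erase Finset.univ (slotDiff Z) (Finset.mem_univ i)).symm

theorem map_slotDiff {Z Z' : ι → Bicomplex k σ} (g : ∀ j, Hom (Z j) (Z' j)) (i : ι)
    (x : ⨂[MvPolynomial σ k] j, (Z j).M) :
    PiTensorProduct.map (fun j => (g j).toLin) (slotDiff Z i x) =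
      slotDiff Z' i (PiTensorProduct.map (fun j => (g j).toLin) x) := by
  refine LinearMap.congr_fun (f := PiTensorProduct.map (fun j => (g j).toLin) ∘ₗ slotDiff Z i)
    (g := slotDiff Z' i ∘ₗ PiTensorProduct.map (fun j => (g j).toLin))
    (tensor_ext _ _ fun m => ?_) x
  simp only [LinearMap.comp_apply, slotDiff, PiTensorProduct.map_tprod]
  congr 1
  funext j
  split_ifs
  · exact (g j).comm_sh _
  · exact (g j).comm_dh _
  · rfl

/-- The grading of a tensor product by the horizontal degree in the factors other than `i`. -/
theorem exists_slotProj {Z : ι → Bicomplex k σ} (hZ : ∀ j, HasBiProj (Z j)) (i : ι) :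
    ∃ (P : ℤ → (⨂[MvPolynomial σ k] j, (Z j).M) →ₗ[MvPolynomial σ k]
      ⨂[MvPolynomial σ k] j, (Z j).M) (S : Finset ℤ), (∀ n ∉ S, P n = 0) ∧
      (∀ x, ∑ n ∈ S, P n x = x) ∧ (∀ m n x, P m (P n x) = if m = n then P n x else 0) ∧
      (∀ n x, P n (slotDiff Z i x) = slotDiff Z i (P n x)) ∧
      (∀ n, ∀ j ≠ i, ∀ x, P (n + 1) (slotDiff Z j x) = slotDiff Z j (P n x)) ∧
      ∀ (n : ℤ) (a b c : ι → ℤ) (m : ∀ j, (Z j).M), (∀ j, m j ∈ (Z j).gr (a j) (b j) (c j)) →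
        P n (PiTensorProduct.tprod _ m) =
          if (∑ j, if j = i then 0 else a j) = n then PiTensorProduct.tprod _ m else 0 := by
  -- The weight ignores the factor `i`. So `slotDiff Z i` preserves it, while every other summand of
  -- the differential raises it by one.
  obtain ⟨P, S, hS, hP⟩ := exists_tensorProj Z hZ fun j d => if j = i then 0 else d.1
  have hd : ∀ (n : ℤ) (l : ι) (a b c : ι → ℤ) (m : ∀ j, (Z j).M),
      (∀ j, m j ∈ (Z j).gr (a j) (b j) (c j)) →
      P n (slotDiff Z l (PiTensorProduct.tprod _ m)) =
        if (∑ j, if j = i then 0 else a j) + (if l = i then 0 else 1) = n then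
          slotDiff Z l (PiTensorProduct.tprod _ m) else 0 := by
    intro n l a b c m hm
    rw [slotDiff, PiTensorProduct.map_tprod,
      hP n (fun j => a j + if j = l then 1 else 0) b (fun j => c j + if j = l then 2 else 0)]
    · have : (∑ j, if j = i then 0 else a j + if j = l then 1 else 0) =
          (∑ j, if j = i then 0 else a j) + if l = i then 0 else 1 := by
        have h1 : (∑ j, if j = l then (if j = i then (0 : ℤ) else 1) else 0) =
            if l = i then 0 else 1 := by simp
        rw [← h1, ← Finset.sum_add_distrib]
        refine Finset.sum_congr rfl fun j _ => ?_
        split_ifs <;> simp_all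
      simp only [this]
    · intro j
      split_ifs with h1 h2 h2
      · exact absurd h1 h2.ne
      · exact (Z j).dh_gr (hm j)
      · rw [add_zero, add_zero, (Z j).sh_gr (hm j)]
        exact zsmul_mem (hm j) _
      · rw [add_zero, add_zero]
        exact hm j
  refine ⟨P, S, hS, fun x => ?_, fun m n x => ?_, fun n x => ?_, fun n j hj x => ?_, hP⟩
  · refine (LinearMap.sum_apply S P x).symm.trans
      (LinearMap.congr_fun (tensor_linearMap_ext Z _ LinearMap.id ?_) x)
    intro a b c m hm
    rw [LinearMap.sum_apply, Finset.sum_eq_single (∑ j, if j = i then 0 else a j)]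
    · rw [hP _ a b c m hm, if_pos rfl, LinearMap.id_apply]
    · intro n _ hn
      rw [hP _ a b c m hm, if_neg hn.symm]
    · intro hn
      rw [hS _ hn]
      rfl
  · have := LinearMap.congr_fun (tensor_linearMap_ext Z (P m ∘ₗ P n)
      (if m = n then P n else 0) ?_) x
    · refine this.trans ?_
      split_ifs <;> rfl
    · intro a b c y hy
      rw [LinearMap.comp_apply, hP n a b c y hy]
      split_ifs with h1 h2 h2
      · rw [hP m a b c y hy, hP n a b c y hy, if_pos (h1.trans h2.symm), if_pos h1]
      · rw [hP m a b c y hy, if_neg fun h => h2 (h.symm.trans h1)]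
        rfl
      · rw [map_zero, hP n a b c y hy, if_neg h1]
      · exact map_zero _
  · refine LinearMap.congr_fun (tensor_linearMap_ext Z (P n ∘ₗ slotDiff Z i)
      (slotDiff Z i ∘ₗ P n) ?_) x
    intro a b c y hy
    rw [LinearMap.comp_apply, LinearMap.comp_apply, hd n i a b c y hy, hP n a b c y hy, if_pos rfl,
      add_zero]
    split_ifs
    · rfl
    · rw [map_zero]
  · refine LinearMap.congr_fun (tensor_linearMap_ext Z (P (n + 1) ∘ₗ slotDiff Z j)
      (slotDiff Z j ∘ₗ P n) ?_) x
    intro a b c y hy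
    rw [LinearMap.comp_apply, LinearMap.comp_apply, hd _ j a b c y hy, hP n a b c y hy, if_neg hj]
    simp only [add_left_inj]
    split_ifs
    · rfl
    · rw [map_zero]

/-- A tensor product of morphisms has an exact cone if it has one with respect to the differential
of a single factor. -/
theorem tensorMap_coneExact_of_slot {Z Z' : ι → Bicomplex k σ} (g : ∀ j, Hom (Z j) (Z' j))
    (hZ : ∀ j, HasBiProj (Z j)) (hZ' : ∀ j, HasBiProj (Z' j)) (i : ι)
    (h : ConeExact (slotDiff Z i) (slotDiff Z' i) (PiTensorProduct.map fun j => (g j).toLin)) :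
    ConeExact (tensor Z).dh (tensor Z').dh (tensorMap g).toLin := by
  obtain ⟨P, S, hS, hs, hp, hD, hδ, hP⟩ := exists_slotProj hZ i
  obtain ⟨P', S', hS', hs', hp', hD', hδ', hP'⟩ := exists_slotProj hZ' i
  have sq : ∀ {Z : ι → Bicomplex k σ} (x : ⨂[MvPolynomial σ k] j, (Z j).M),
      slotDiff Z i (slotDiff Z i x) + slotDiff Z i ((∑ j ∈ Finset.univ.erase i, slotDiff Z j) x) +
      ((∑ j ∈ Finset.univ.erase i, slotDiff Z j) (slotDiff Z i x) +
        (∑ j ∈ Finset.univ.erase i, slotDiff Z j)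
          ((∑ j ∈ Finset.univ.erase i, slotDiff Z j) x)) = 0 := by
    intro Z x
    have := (tensor Z).dh_dh x
    rw [tensor_dh_eq Z i] at this
    have e : ∀ A B : (⨂[MvPolynomial σ k] j, (Z j).M) →ₗ[MvPolynomial σ k]
        ⨂[MvPolynomial σ k] j, (Z j).M, (A + B) ((A + B) x) = 0 →
        A (A x) + A (B x) + (B (A x) + B (B x)) = 0 := by
      intro A B h
      rw [LinearMap.add_apply, LinearMap.add_apply, map_add, map_add] at h
      exact h
    exact e _ _ this
  have key := ConeExact.add_of_graded
    (dA := (slotDiff Z i).toAddMonoidHom) (dB := (slotDiff Z' i).toAddMonoidHom)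
    (δA := (∑ j ∈ Finset.univ.erase i, slotDiff Z j).toAddMonoidHom)
    (δB := (∑ j ∈ Finset.univ.erase i, slotDiff Z' j).toAddMonoidHom)
    (G := (PiTensorProduct.map fun j => (g j).toLin).toAddMonoidHom) h
    (fun n => (P n).toAddMonoidHom) (fun n => (P' n).toAddMonoidHom) S S'
    (fun n hn => by rw [hS n hn]; rfl) (fun n hn => by rw [hS' n hn]; rfl)
    hs hs' hp hp' hD hD'
    (fun n x => by
      change P (n + 1) ((∑ j ∈ Finset.univ.erase i, slotDiff Z j) x) =
        (∑ j ∈ Finset.univ.erase i, slotDiff Z j) (P n x)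
      rw [LinearMap.sum_apply, LinearMap.sum_apply, map_sum]
      exact Finset.sum_congr rfl fun j hj => hδ n j (Finset.ne_of_mem_erase hj) x)
    (fun n x => by
      change P' (n + 1) ((∑ j ∈ Finset.univ.erase i, slotDiff Z' j) x) =
        (∑ j ∈ Finset.univ.erase i, slotDiff Z' j) (P' n x)
      rw [LinearMap.sum_apply, LinearMap.sum_apply, map_sum]
      exact Finset.sum_congr rfl fun j hj => hδ' n j (Finset.ne_of_mem_erase hj) x)
    (fun n x => by
      refine LinearMap.congr_fun (tensor_linearMap_ext Z
        (P' n ∘ₗ PiTensorProduct.map fun j => (g j).toLin)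
        ((PiTensorProduct.map fun j => (g j).toLin) ∘ₗ P n) ?_) x
      intro a b c m hm
      rw [LinearMap.comp_apply, LinearMap.comp_apply, PiTensorProduct.map_tprod,
        hP n a b c m hm, hP' n a b c _ fun j => (g j).map_gr (hm j)]
      split_ifs
      · rw [PiTensorProduct.map_tprod]
      · rw [map_zero])
    (map_slotDiff g i)
    (fun x => by
      change PiTensorProduct.map (fun j => (g j).toLin)
        ((∑ j ∈ Finset.univ.erase i, slotDiff Z j) x) =
          (∑ j ∈ Finset.univ.erase i, slotDiff Z' j) (PiTensorProduct.map (fun j => (g j).toLin) x)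
      rw [LinearMap.sum_apply, LinearMap.sum_apply, map_sum]
      exact Finset.sum_congr rfl fun j _ => map_slotDiff g j x)
    sq sq
  rw [tensor_dh_eq Z i, tensor_dh_eq Z' i]
  exact key

/-- Splitting off the factor `i` of a tensor product. -/
def splitSlot (Z : ι → Bicomplex k σ) (i : ι) : (⨂[MvPolynomial σ k] j, (Z j).M)
    ≃ₗ[MvPolynomial σ k]
      (⨂[MvPolynomial σ k] j : ({i}ᶜ : Set ι), (Z j).M) ⊗[MvPolynomial σ k] (Z i).M :=
  PiTensorProduct.equivPiTensorComplSingletonTensor (MvPolynomial σ k) (fun j => (Z j).M) i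

theorem splitSlot_tprod (Z : ι → Bicomplex k σ) (i : ι) (m : ∀ j, (Z j).M) :
    splitSlot Z i (PiTensorProduct.tprod _ m) =
      (PiTensorProduct.tprod _ fun j : ({i}ᶜ : Set ι) => m j) ⊗ₜ m i :=
  PiTensorProduct.equivPiTensorComplSingletonTensor_tprod (MvPolynomial σ k)
    (M := fun j => (Z j).M) i m

/-- The signs in front of the factor `i`. -/
def slotSign (Z : ι → Bicomplex k σ) (i : ι) :
    (⨂[MvPolynomial σ k] j : ({i}ᶜ : Set ι), (Z j).M) →ₗ[MvPolynomial σ k]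
      ⨂[MvPolynomial σ k] j : ({i}ᶜ : Set ι), (Z j).M :=
  PiTensorProduct.map fun j => if j.1 < i then (Z j).sh else LinearMap.id

theorem slotSign_slotSign (Z : ι → Bicomplex k σ) (i : ι) :
    slotSign Z i ∘ₗ slotSign Z i = LinearMap.id := by
  rw [slotSign, ← PiTensorProduct.map_comp, ← PiTensorProduct.map_id]
  congr 1
  funext j
  split_ifs
  · exact LinearMap.ext (Z j).sh_sh
  · rfl

/-- The sign operators of the factors below `i` act on the complementary factors only; there they
form the involution `slotSign`. -/
theorem splitSlot_slotDiff (Z : ι → Bicomplex k σ) (i : ι)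
    (x : ⨂[MvPolynomial σ k] j, (Z j).M) :
    splitSlot Z i (slotDiff Z i x) =
      TensorProduct.map (slotSign Z i) (Z i).dh (splitSlot Z i x) := by
  refine LinearMap.congr_fun (f := (splitSlot Z i).toLinearMap ∘ₗ slotDiff Z i)
    (g := TensorProduct.map (slotSign Z i) (Z i).dh ∘ₗ (splitSlot Z i).toLinearMap)
    (PiTensorProduct.ext (MultilinearMap.ext fun m => ?_)) x
  simp only [LinearMap.compMultilinearMap_apply, LinearMap.comp_apply, LinearEquiv.coe_coe]
  rw [slotDiff, PiTensorProduct.map_tprod, splitSlot_tprod, splitSlot_tprod, TensorProduct.map_tmul,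
    slotSign, PiTensorProduct.map_tprod]
  congr 1
  · congr 1
    funext j
    have : j.1 ≠ i := j.2
    rw [if_neg this]
  · rw [if_neg (lt_irrefl i), if_pos rfl]

/-- If all factors but one are isomorphisms, then it suffices to consider the remaining factor. -/
theorem slotDiff_coneExact {Z Z' : ι → Bicomplex k σ} (g : ∀ j, Hom (Z j) (Z' j)) (i : ι)
    (hg : ∀ j ≠ i, Function.Bijective (g j).toLin)
    (h : ConeExact ((Z i).dh.lTensor (⨂[MvPolynomial σ k] j : ({i}ᶜ : Set ι), (Z j).M))
      ((Z' i).dh.lTensor (⨂[MvPolynomial σ k] j : ({i}ᶜ : Set ι), (Z j).M))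
      ((g i).toLin.lTensor (⨂[MvPolynomial σ k] j : ({i}ᶜ : Set ι), (Z j).M))) :
    ConeExact (slotDiff Z i) (slotDiff Z' i) (PiTensorProduct.map fun j => (g j).toLin) := by
  -- The involution commutes with the differential and the map of the factor `i`, so inserting it
  -- into both differentials does not affect exactness.
  have h1 := h.twist ((slotSign Z i).rTensor (Z i).M).toAddMonoidHom
    ((slotSign Z i).rTensor (Z' i).M).toAddMonoidHom
    (fun a => by
      change (slotSign Z i).rTensor _ ((slotSign Z i).rTensor _ a) = a
      rw [← LinearMap.rTensor_comp_apply, slotSign_slotSign, LinearMap.rTensor_id_apply])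
    (fun a => by
      change (slotSign Z i).rTensor _ ((slotSign Z i).rTensor _ a) = a
      rw [← LinearMap.rTensor_comp_apply, slotSign_slotSign, LinearMap.rTensor_id_apply])
    (LinearMap.congr_fun ((LinearMap.rTensor_comp_lTensor ..).trans
      (LinearMap.lTensor_comp_rTensor ..).symm))
    (LinearMap.congr_fun ((LinearMap.rTensor_comp_lTensor ..).trans
      (LinearMap.lTensor_comp_rTensor ..).symm))
    (LinearMap.congr_fun ((LinearMap.lTensor_comp_rTensor ..).trans
      (LinearMap.rTensor_comp_lTensor ..).symm))
  -- By `hg` the complementary factors of `Z` and `Z'` are isomorphic, compatibly with the signs, so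
  -- both cones can be written with the same complement.
  let γ : (⨂[MvPolynomial σ k] j : ({i}ᶜ : Set ι), (Z j).M) ≃ₗ[MvPolynomial σ k]
      ⨂[MvPolynomial σ k] j : ({i}ᶜ : Set ι), (Z' j).M :=
    PiTensorProduct.congr fun j => LinearEquiv.ofBijective (g j).toLin (hg j j.2)
  have hγ : ∀ m : ∀ j : ({i}ᶜ : Set ι), (Z j).M, γ (PiTensorProduct.tprod _ m) =
      PiTensorProduct.tprod _ fun j : ({i}ᶜ : Set ι) => (g j).toLin (m j) := fun m =>
    PiTensorProduct.congr_tprod _ m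
  have hγs : γ.toLinearMap ∘ₗ slotSign Z i = slotSign Z' i ∘ₗ γ.toLinearMap := by
    refine PiTensorProduct.ext (MultilinearMap.ext fun m => ?_)
    simp only [LinearMap.compMultilinearMap_apply, LinearMap.comp_apply, slotSign,
      PiTensorProduct.map_tprod, LinearEquiv.coe_coe, hγ]
    congr 1
    funext j
    split_ifs
    · exact (g j).comm_sh _
    · rfl
  let γ' := TensorProduct.congr γ (LinearEquiv.refl (MvPolynomial σ k) (Z' i).M)
  have hγ' : ∀ x, γ' (TensorProduct.map (slotSign Z i) (Z' i).dh x) =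
      TensorProduct.map (slotSign Z' i) (Z' i).dh (γ' x) := by
    intro x
    change (TensorProduct.map γ.toLinearMap LinearMap.id ∘ₗ
        TensorProduct.map (slotSign Z i) (Z' i).dh) x =
      (TensorProduct.map (slotSign Z' i) (Z' i).dh ∘ₗ
        TensorProduct.map γ.toLinearMap LinearMap.id) x
    rw [← TensorProduct.map_comp, ← TensorProduct.map_comp, hγs]
    rfl
  refine h1.of_equiv (splitSlot Z i).toAddEquiv ((splitSlot Z' i).trans γ'.symm).toAddEquiv ?_ ?_ ?_
  · intro a
    refine (splitSlot_slotDiff Z i a).trans ?_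
    exact LinearMap.congr_fun (LinearMap.rTensor_comp_lTensor ..).symm _
  · intro b
    change γ'.symm (splitSlot Z' i (slotDiff Z' i b)) =
      ((slotSign Z i).rTensor _ ∘ₗ (Z' i).dh.lTensor _) (γ'.symm (splitSlot Z' i b))
    rw [LinearMap.rTensor_comp_lTensor, LinearEquiv.symm_apply_eq, hγ', γ'.apply_symm_apply,
      splitSlot_slotDiff]
  · intro a
    change γ'.symm (splitSlot Z' i (PiTensorProduct.map (fun j => (g j).toLin) a)) =
      (g i).toLin.lTensor _ (splitSlot Z i a)
    rw [LinearEquiv.symm_apply_eq]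
    refine LinearMap.congr_fun
      (f := (splitSlot Z' i).toLinearMap ∘ₗ PiTensorProduct.map fun j => (g j).toLin)
      (g := γ'.toLinearMap ∘ₗ (g i).toLin.lTensor _ ∘ₗ (splitSlot Z i).toLinearMap)
      (PiTensorProduct.ext (MultilinearMap.ext fun m => ?_)) a
    simp only [LinearMap.compMultilinearMap_apply, LinearMap.comp_apply, LinearEquiv.coe_coe]
    rw [PiTensorProduct.map_tprod, splitSlot_tprod, splitSlot_tprod, LinearMap.lTensor_tmul]
    refine Eq.trans ?_ (TensorProduct.congr_tmul ..).symm
    rw [hγ]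
    rfl

/-- One of two bicomplexes. -/
def pick (C D : Bicomplex k σ) : Bool → Bicomplex k σ
  | false => C
  | true => D

/-- The maps between the members of a pair of bicomplexes that are induced by a morphism. -/
def pickMap {C D : Bicomplex k σ} (f : Hom C D) : ∀ {b b' : Bool}, b ≤ b' →
    Hom (pick C D b) (pick C D b')
  | false, false, _ => Hom.id C
  | false, true, _ => f
  | true, true, _ => Hom.id D
  | true, false, h => absurd h (by decide)

/-- The map is a composite of steps that replace one `C i` by `D i` and are the identity in all
other factors. Meanwhile the other factors are a mixture of `C j` and `D j`, hence the hypothesis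
for every choice `b`. -/
theorem tensorMap_coneExact {C D : ι → Bicomplex k σ} (f : ∀ i, Hom (C i) (D i))
    (hC : ∀ i, HasBiProj (C i)) (hD : ∀ i, HasBiProj (D i))
    (h : ∀ (b : ι → Bool) (i : ι),
      let W := ⨂[MvPolynomial σ k] j : ({i}ᶜ : Set ι), (pick (C j) (D j) (b j)).M
      ConeExact ((C i).dh.lTensor W) ((D i).dh.lTensor W) ((f i).toLin.lTensor W)) :
    ConeExact (tensor C).dh (tensor D).dh (tensorMap f).toLin := by
  have hp : ∀ (b : ι → Bool) i, HasBiProj (pick (C i) (D i) (b i)) := by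
    intro b i
    cases b i
    · exact hC i
    · exact hD i
  have step : ∀ (b b' : ι → Bool) (hb : ∀ j, b j ≤ b' j) (i : ι), b i = false → b' i = true →
      (∀ j ≠ i, b j = b' j) →
      ConeExact (tensor fun j => pick (C j) (D j) (b j)).dh
        (tensor fun j => pick (C j) (D j) (b' j)).dh
        (tensorMap fun j => pickMap (f j) (hb j)).toLin := by
    intro b b' hb i hi hi' hbb
    refine tensorMap_coneExact_of_slot _ (hp b) (hp b') i (slotDiff_coneExact _ i ?_ ?_)
    · intro j hj
      have : ∀ (c c' : Bool) (hc : c ≤ c'), c = c' →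
          Function.Bijective (pickMap (f j) hc).toLin := by
        rintro c _ hc rfl
        cases c <;> exact Function.bijective_id
      exact this _ _ _ (hbb j hj)
    · have : ∀ (c c' : Bool) (hc : c ≤ c') (_ : c = false) (_ : c' = true) (W : Type u)
          [AddCommGroup W] [Module (MvPolynomial σ k) W],
          ConeExact ((C i).dh.lTensor W) ((D i).dh.lTensor W) ((f i).toLin.lTensor W) →
          ConeExact ((pick (C i) (D i) c).dh.lTensor W) ((pick (C i) (D i) c').dh.lTensor W)
            ((pickMap (f i) hc).toLin.lTensor W) := by
        rintro _ _ _ rfl rfl W _ _ hW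
        exact hW
      exact this _ _ _ hi hi' _ (h b i)
  let F (b : ι → Bool) : Hom (tensor C) (tensor fun j => pick (C j) (D j) (b j)) :=
    tensorMap fun j => pickMap (f j) (Bool.false_le (b j))
  -- Here `t` is the set of the factors that have already been exchanged.
  have key : ∀ (t : Finset ι) (b : ι → Bool), (∀ j, b j = decide (j ∈ t)) →
      ConeExact (tensor C).dh (tensor fun j => pick (C j) (D j) (b j)).dh (F b).toLin := by
    intro t
    induction t using Finset.induction_on with
    | empty =>
      intro b hb
      obtain rfl : b = fun _ => false := funext fun j => by simp [hb]
      have hid : (F fun _ => false).toLin = LinearMap.id := PiTensorProduct.map_id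
      refine ConeExact.of_bijective (G := (F fun _ => false).toLin.toAddMonoidHom) (map_zero _) ?_
        (F fun _ => false).comm_dh
      change Function.Bijective (F fun _ => false).toLin
      rw [hid]
      exact Function.bijective_id
    | insert i t hi ih =>
      intro b' hb'
      let b : ι → Bool := fun j => decide (j ∈ t)
      have hle : ∀ j, b j ≤ b' j := fun j => by
        rw [hb']
        by_cases hj : j ∈ t <;> simp [b, hj]
      let G : Hom (tensor fun j => pick (C j) (D j) (b j)) (tensor fun j => pick (C j) (D j) (b' j)) :=
        tensorMap fun j => pickMap (f j) (hle j)
      have h1 : ConeExact _ _ G.toLin := step b b' hle i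
        (by simp [b, hi]) (by simp [hb']) (fun j hj => by simp [b, hb', hj])
      have h2 := ConeExact.comp (dB := (tensor _).dh.toAddMonoidHom)
        (dC := (tensor _).dh.toAddMonoidHom) (G := (F b).toLin.toAddMonoidHom)
        (G' := G.toLin.toAddMonoidHom) (ih b fun _ => rfl) h1 (F b).comm_dh G.comm_dh
      have h3 : (F b').toLin = G.toLin ∘ₗ (F b).toLin := by
        refine Eq.trans ?_ (PiTensorProduct.map_comp ..)
        refine congrArg PiTensorProduct.map (funext fun j => ?_)
        have : ∀ (c c' : Bool) (hc : c ≤ c'), (pickMap (f j) (Bool.false_le c')).toLin =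
            (pickMap (f j) hc).toLin ∘ₗ (pickMap (f j) (Bool.false_le c)).toLin := by
          rintro (_ | _) (_ | _) hc
          · rfl
          · rfl
          · exact absurd hc (by decide)
          · rfl
        exact this _ _ (hle j)
      rw [h3]
      exact h2
  exact key Finset.univ (fun _ => true) fun j => by simp

end Bicomplex
end
end KRTangle

/-! ### Flatness for arc diagrams and the second claim. -/

namespace KRTangle
noncomputable section
open Bicomplex

namespace Bicomplex

variable {k : Type u} [Field k] {ρ σ τ : Type}

theorem isScalarTower_rename (φ : ρ → σ) (ψ : σ → τ) (χ : ρ → τ) (h : ψ ∘ φ = χ) :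
    letI := renameAlgebra k φ
    letI := renameAlgebra k ψ
    letI := renameAlgebra k χ
    IsScalarTower (MvPolynomial ρ k) (MvPolynomial σ k) (MvPolynomial τ k) := by
  let _ := renameAlgebra k φ
  let _ := renameAlgebra k ψ
  let _ := renameAlgebra k χ
  refine .of_algebraMap_eq fun p => ?_
  change rename χ p = rename ψ (rename φ p)
  rw [rename_rename, h]

/-- Extensions of scalars along a map of variables that factors through `ψ`. -/
theorem isExtended_extend (ψ : σ → τ) (φ : ρ → σ) (χ : ρ → τ) (h : ψ ∘ φ = χ)
    (C : Bicomplex k ρ) :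
    letI := renameAlgebra k ψ
    IsExtended (MvPolynomial σ k) (MvPolynomial τ k) (C.extend χ).M := by
  let _ := renameAlgebra k φ
  let _ := renameAlgebra k ψ
  let _ := renameAlgebra k χ
  have := isScalarTower_rename (k := k) φ ψ χ h
  exact IsExtended.baseChange C.M

theorem isExtended_free (ψ : σ → τ) {ι : Type} [Fintype ι] (hd vd qd : ι → ℤ)
    (A B : Matrix ι ι (MvPolynomial τ k)) (hA hB hAA hBB hAB) :
    letI := renameAlgebra k ψ
    IsExtended (MvPolynomial σ k) (MvPolynomial τ k)
      (free hd vd qd A B hA hB hAA hBB hAB).M := by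
  let _ := renameAlgebra k ψ
  exact IsExtended.pi (S := MvPolynomial σ k) (R := MvPolynomial τ k) ι

theorem isExtended_piTensor (ψ : σ → τ) {J : Type} [Finite J] (Z : J → Bicomplex k τ)
    (h : letI := renameAlgebra k ψ
      ∀ j, IsExtended (MvPolynomial σ k) (MvPolynomial τ k) (Z j).M) :
    letI := renameAlgebra k ψ
    IsExtended (MvPolynomial σ k) (MvPolynomial τ k) (⨂[MvPolynomial τ k] j, (Z j).M) := by
  let _ := renameAlgebra k ψ
  exact IsExtended.piTensor h

/-- Tensoring an extension of scalars with a module that is extended from the complementary set of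
variables. -/
theorem extendMap_coneExact {E : Type} (φ : σ → τ) (ψ : E → τ)
    (h : Function.Bijective (Sum.elim ψ φ)) {C D : Bicomplex k σ} {f : Hom C D}
    (hf : ConeExact C.dh D.dh f.toLin) (W : Type u) [AddCommGroup W] [Module (MvPolynomial τ k) W]
    (hW : letI := renameAlgebra k ψ; IsExtended (MvPolynomial E k) (MvPolynomial τ k) W) :
    ConeExact ((C.extend φ).dh.lTensor W) ((D.extend φ).dh.lTensor W)
      ((extendMap φ f).toLin.lTensor W) := by
  let _ := renameAlgebra k ψ
  let _ := renameAlgebra k φ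
  let _ : Module (MvPolynomial σ k) W := Module.compHom W (rename φ).toRingHom
  have : IsScalarTower (MvPolynomial σ k) (MvPolynomial τ k) W :=
    ⟨fun a b c => mul_smul (rename φ a) b c⟩
  have : IsScalarTower k (MvPolynomial σ k) (MvPolynomial τ k) :=
    .of_algebraMap_eq fun a => (rename_C φ a).symm
  have : IsScalarTower k (MvPolynomial E k) (MvPolynomial τ k) :=
    .of_algebraMap_eq fun a => (rename_C ψ a).symm
  have : Algebra.IsPushout k (MvPolynomial σ k) (MvPolynomial E k) (MvPolynomial τ k) :=
    isPushout_rename k φ ψ h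
  -- Flatness over the small ring `k[σ]` suffices, since the cone is extended from it; flatness over
  -- `k[τ]` is not claimed.
  have : Module.Flat (MvPolynomial σ k) W := hW.flat (k := k)
  exact hf.lTensor_baseChange C.dh_dh D.dh_dh f.comm_dh W

end Bicomplex

theorem Tangle.hasBiProj_KR₀ {k : Type u} [Field k] (μ ν : k) {P : SignedPoints} (T : Tangle P) :
    HasBiProj (T.KR₀ μ ν) := by
  refine HasBiProj.restrict (HasBiProj.tensor fun f => ?_) _
  rw [T.factor_eq]
  exact hasBiProj_free ..

namespace ArcDiagram

variable {k : Type u} [Field k] {m : ℕ} {P₀ : SignedPoints} {P : Fin m → SignedPoints}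
  (η : ArcDiagram P₀ P)

theorem hasBiProj_factor {C : ∀ i, Bicomplex k (Fin (P i).n)} (hC : ∀ i, HasBiProj (C i)) :
    ∀ j, HasBiProj (η.factor C j)
  | .inl a => by
    rw [factor_arc]
    exact hasBiProj_free ..
  | .inr i => by
    rw [factor_hole]
    exact (hC i).extend _

theorem hasBiProj_act {C : ∀ i, Bicomplex k (Fin (P i).n)} (hC : ∀ i, HasBiProj (C i)) :
    HasBiProj (η.act C) :=
  (HasBiProj.tensor (η.hasBiProj_factor hC)).restrict _

/-- The variables outside of the hole `i`. -/
abbrev OtherVar (P₀ : SignedPoints) (P : Fin m → SignedPoints) (i : Fin m) : Type :=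
  {v : Var P₀ P // v ∉ Set.range fun x : Fin (P i).n => (Sum.inr ⟨i, x⟩ : Var P₀ P)}

theorem bijective_otherVar (i : Fin m) : Function.Bijective
    (Sum.elim (Subtype.val : OtherVar P₀ P i → Var P₀ P) fun x => Sum.inr ⟨i, x⟩) := by
  constructor
  · refine Function.Injective.sumElim Subtype.val_injective ?_ ?_
    · intro x y h
      simpa using h
    · rintro ⟨v, hv⟩ x rfl
      exact hv ⟨x, rfl⟩
  · intro v
    by_cases hv : v ∈ Set.range fun x : Fin (P i).n => (Sum.inr ⟨i, x⟩ : Var P₀ P)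
    · obtain ⟨x, rfl⟩ := hv
      exact ⟨.inr x, rfl⟩
    · exact ⟨.inl ⟨v, hv⟩, rfl⟩

/-- Arcs give free modules. A hole `j ≠ i` is extended from `k[P j]`, whose variables all lie
outside of the hole `i`. The bicomplexes `C j` are arbitrary, so naive complexes are covered. -/
theorem isExtended_factor (C : ∀ i, Bicomplex k (Fin (P i).n)) (i : Fin m) :
    ∀ j : Factor P₀ P, j ≠ .inr i →
      letI := renameAlgebra k (Subtype.val : OtherVar P₀ P i → Var P₀ P)
      IsExtended (MvPolynomial (OtherVar P₀ P i) k) (MvPolynomial (Var P₀ P) k) (η.factor C j).M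
  | .inl a, _ => by
    rw [factor_arc]
    exact isExtended_free ..
  | .inr j, hj => by
    rw [factor_hole]
    have h : ∀ x : Fin (P j).n, (Sum.inr ⟨j, x⟩ : Var P₀ P) ∉
        Set.range fun y : Fin (P i).n => (Sum.inr ⟨i, y⟩ : Var P₀ P) := by
      rintro x ⟨y, hy⟩
      obtain ⟨rfl, -⟩ := Sigma.mk.inj (Sum.inr.inj hy)
      exact hj rfl
    exact isExtended_extend (Subtype.val : OtherVar P₀ P i → Var P₀ P)
      (fun x : Fin (P j).n => ⟨.inr ⟨j, x⟩, h x⟩) (fun x => .inr ⟨j, x⟩) rfl (C j)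

theorem isExtended_otherFactors (C D : ∀ i, Bicomplex k (Fin (P i).n)) (b : Factor P₀ P → Bool)
    (i : Fin m) :
    letI := renameAlgebra k (Subtype.val : OtherVar P₀ P i → Var P₀ P)
    IsExtended (MvPolynomial (OtherVar P₀ P i) k) (MvPolynomial (Var P₀ P) k)
      (⨂[MvPolynomial (Var P₀ P) k] j : ({(.inr i : Factor P₀ P)}ᶜ : Set (Factor P₀ P)),
        (pick (η.factor C j) (η.factor D j) (b j)).M) := by
  refine isExtended_piTensor _ _ fun j => ?_
  have key : ∀ c, (letI := renameAlgebra k (Subtype.val : OtherVar P₀ P i → Var P₀ P)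
      IsExtended (MvPolynomial (OtherVar P₀ P i) k) (MvPolynomial (Var P₀ P) k)
        (pick (η.factor C j) (η.factor D j) c).M) := by
    rintro (_ | _)
    · exact η.isExtended_factor C i j.1 j.2
    · exact η.isExtended_factor D i j.1 j.2
  exact key (b j)

/-- On an arc the map is the identity. For the hole `i`, the other factors are extended from the
complementary variables, hence flat over `k[P i]`, and tensoring with them keeps the cone of `f i`
exact. -/
theorem actMap_coneExact {C D : ∀ i, Bicomplex k (Fin (P i).n)} (f : ∀ i, Hom (C i) (D i))
    (hC : ∀ i, HasBiProj (C i)) (hD : ∀ i, HasBiProj (D i))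
    (hf : ∀ i, ConeExact (C i).dh (D i).dh (f i).toLin) :
    ConeExact (η.act C).dh (η.act D).dh (η.actMap f).toLin := by
  refine Bicomplex.tensorMap_coneExact _ (η.hasBiProj_factor hC) (η.hasBiProj_factor hD) ?_
  rintro b (a | i) W
  · exact ConeExact.lTensor_id _ _
  · exact extendMap_coneExact (fun x : Fin (P i).n => (.inr ⟨i, x⟩ : Var P₀ P))
      (Subtype.val : OtherVar P₀ P i → Var P₀ P) (bijective_otherVar i) (hf i) _
      (η.isExtended_otherFactors C D b i)

/-- The action of an arc diagram preserves term-wise quasi-isomorphisms to naive complexes, also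
after composition with a homotopy equivalence. -/
theorem isTermwiseQuasiIso_comp (μ ν : k) (T : ∀ i, Tangle (P i))
    (hT : ∀ i, ((T i).KR₀ μ ν).toNaive.IsTermwiseQuasiIso)
    (f : Hom ((η.glue T).KR₀ μ ν) (η.act fun i => (T i).KR₀ μ ν)) (hf : f.IsHomotopyEquiv) :
    ((η.actMap fun i => ((T i).KR₀ μ ν).toNaive).comp f).IsTermwiseQuasiIso := by
  have hp := fun i => (T i).hasBiProj_KR₀ μ ν
  have h := η.actMap_coneExact (fun i => ((T i).KR₀ μ ν).toNaive) hp (fun i => (hp i).naive)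
    fun i => (hT i).coneExact (hp i) (hp i).naive
  refine Hom.isTermwiseQuasiIso_of_coneExact ?_ ((η.glue T).hasBiProj_KR₀ μ ν)
    (η.hasBiProj_act fun i => (hp i).naive)
  exact ConeExact.comp (dB := (Bicomplex.dh _).toAddMonoidHom)
    (dC := (Bicomplex.dh _).toAddMonoidHom) (G := f.toLin.toAddMonoidHom)
    (G' := (η.actMap fun i => ((T i).KR₀ μ ν).toNaive).toLin.toAddMonoidHom) hf.coneExact h
    f.comm_dh (η.actMap fun i => ((T i).KR₀ μ ν).toNaive).comm_dh

end ArcDiagram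
end
end KRTangle

theorem theorem3p1 {k : Type u} [Field k] (μ ν : k) {m : ℕ}
    {P₀ : KRTangle.SignedPoints} {P : Fin m → KRTangle.SignedPoints}
    (η : KRTangle.ArcDiagram P₀ P) (T : ∀ i, KRTangle.Tangle (P i)) :
    (∃ f : KRTangle.Bicomplex.Hom ((η.glue T).KR₀ μ ν) (η.act fun i => (T i).KR₀ μ ν),
      f.IsHomotopyEquiv) ∧
    ((∀ i, ((T i).KR₀ μ ν).toNaive.IsTermwiseQuasiIso) →
      ∀ f : KRTangle.Bicomplex.Hom ((η.glue T).KR₀ μ ν) (η.act fun i => (T i).KR₀ μ ν),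
        f.IsHomotopyEquiv →
          ((η.actMap fun i => ((T i).KR₀ μ ν).toNaive).comp f).IsTermwiseQuasiIso) := by
  exact ⟨η.htpyEquiv_glue μ ν T, η.isTermwiseQuasiIso_comp μ ν T⟩
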